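/- **Conventions.** $S_\infty$ is the group of permutations of $\mathbb N=\{1,2,\dots\}$ moving finitely many points, $t_{ab}$ is the transposition of $a,b$, $s_i=t_{i,i+1}$, products are compositions ($(ww')(i)=w(w'(i))$), and $l(w)$ is the minimal length of a word in the $s_i$ representing $w$. Fix $r\ge 1$. A permutation $w$ is an *$r$-semi-shuffle* if $w(i)<w(i+1)$ for all $i>r$, and an *$r$-shuffle* if $w(i)<w(i+1)$ for all $i\ne r$. For a partition $\lambda$ with at most $r$ parts, $v(\lambda,r)$ is the $r$-shuffle $v$ with $\lambda_j=v(r+1-j)-r-1+j$ for $1\le j\le r$. $\lambda$ is a *hook* if $\lambda_j\le 1$ for all $j\ge2$. *Graphs.* A graph $R$ is a finite set of places $(i,j)$, $i,j\ge1$ (row, column), called its crossings. Reading the labels $i+j-1$ of its crossings row by row from top (row 1) to bottom, each row from right to left, gives a word $i_1\dots i_m$, and $w(R)=s_{i_1}\cdots s_{i_m}$. $R$ is an *rc-graph* of $w(R)$ if this word is reduced; $\mathcal{RC}(w)$ is the set of rc-graphs of $w$. Strand $k$ starts at the left end of row $k$ moving right; at a crossing a strand goes straight on, at any other place the strand coming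 from the left turns up and the strand coming from below turns right. $R_\ell$ and $R_{\ge\ell}$ are the parts of $R$ in row $\ell$ and in rows $\ge\ell$; $x^R=\prod_i x_i^{|R_i|}$. *Tableaux.* The boxes of the diagram of $\lambda$ are numbered $1,2,\dots,|\lambda|$ from the bottom row up and from left to right in each row; a tableau is filled up to $i$ if exactly boxes $1,\dots,i$ are filled. A (partially filled) tableau of integers is row and column strict if its entries strictly increase from left to right in rows and from top to bottom in columns. A *tableau of transpositions* of $v(\lambda,r)$ is a tableau $T$ of shape $\lambda$ whose entries are pairs $(a_ib_i)$ (in box $i$) with $a_i\le r<b_i$. Put $w_i(T)=t_{a_1b_1}\cdots t_{a_ib_i}$ and let $w(T)$ be the product over all filled boxes. $E(w,T)$ is the tableau of the same shape with $ww_i(T)(b_i)$ in box $i$. $(w,R,T)$ is an *$r$-Bruhat package* if $R$ is an rc-graph, $ww(T)=w(R)$, and $l(ww_i(T))=l(w)+i$ for every filled box $i$. For such a package with $m$ filled boxes, $S_m=R$, and $S_j$ is obtained from $S_{j+1}$ by removing exactly one crossing so that $w(S_j)=ww_j(T)$ $(0\le j<m)$. *Word.* For an rc-graph $Y$ of an $r$-shuffle,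 $word(Y)=word(Y,1)\cdots word(Y,r)$, where $word(Y,s)$ lists, in weakly decreasing order, the rows of the crossings on strand $s$. The shape of $Y$ is the partition $\mu$ with $w(Y)=v(\mu,r)$. **The algorithm.** Given rc-graphs $R$ of $w$ and $Y$ of $v(\lambda,r)$, let $m_\ell=|Y_{\ge\ell}|$. For $\ell=r,r-1,\dots,1$ and $i=0,1,\dots,m_\ell$, step $(\ell,i)$ constructs a graph $R(\ell,i)$ and a tableau $T(\ell,i)$ of pairs, of the shape of $Y_{\ge\ell}$ and filled up to $i$. Let $k_1\dots k_{m_\ell}=word(Y_{\ge\ell})$. - *Step $(\ell,0)$.* $T(\ell,0)$ is empty, $R(r,0)=R_{\ge r}$, and for $\ell<r$, $R(\ell,0)=S_0\cup R_\ell$, where $S_0,S_1,\dots$ are formed from $(w(R_{\ge\ell+1}),R(\ell+1,m_{\ell+1}),T(\ell+1,m_{\ell+1}))$. - *Insertion: $i\ge1$, $k_i=\ell$.* A non-crossing place $(\ell,j)$ of $R(\ell,i-1)$ is allowed if the strand $c$ coming from the left and the strand $d$ coming from below satisfy $c\le r<d$. Add a crossing at the rightmost allowed place and put its pair $(cd)$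 into box $i$. - *Rectification: $i\ge1$, $k_i>\ell$.* Let $i_+$ be the index of this letter in $word(Y_{\ge\ell+1})$, which arises from $word(Y_{\ge\ell})$ by deleting the letters $\ell$. With $S_0,S_1,\dots$ as in step $(\ell,0)$, let $R'$ be $R(\ell,i-1)$ together with the crossing of $S_{i_+}$ that is not in $S_{i_+-1}$, and let $T'$ be $T(\ell,i-1)$ with the entry $(ab)$ of box $i_+$ of $T(\ell+1,m_{\ell+1})$ put into box $i$. If $E(w(R_{\ge\ell}),T')$ is row and column strict and $(w(R_{\ge\ell}),R',T')$ is an $r$-Bruhat package, then $R(\ell,i)=R'$, $T(\ell,i)=T'$. Otherwise: if row $\ell$ of $R'$ has a crossing $(\ell,j_0)$ with horizontal strand $b$ and vertical strand $a$, remove it from $R'$ and empty box $i$ of $T'$; if there is none, take a crossing $(\ell,j_0)$ of $R'$ with horizontal strand $b$ and vertical strand $f$, where box $i-1$ of $T'$ contains $(af)$, remove it, empty box $i$ and replace the entry of box $i-1$ by $(ab)$. Call the results $R'',T''$. A non-crossing place $(\ell,j)$ of $R''$, with strand $c$ coming from the left and $d$ from below, is allowed if (1) $c\le r<d$, or (2)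 $c=g$ and $r<d$, where $(eg)$ is the entry of box $i-1$ of $T''$. Add a crossing at the rightmost allowed place with $j<j_0$; in case (1) put $(cd)$ into box $i$; in case (2) replace the entry of box $i-1$ by $(ed)$ and put $(eg)$ into box $i$. At the end, $R\leftarrow Y=R(1,m_1)$ and $T(R,Y)=T(1,m_1)$. **Theorem.** Let $r\ge1$, let $w,v(\lambda,r)\in S_\infty$, and suppose that $w$ is an $r$-semi-shuffle or $\lambda$ is a hook. Let $R\in\mathcal{RC}(w)$ and $Y\in\mathcal{RC}(v(\lambda,r))$. Then the insertion algorithm runs to its end with a unique result $U=R\leftarrow Y$ and $T=T(R,Y)$; $U$ is an rc-graph, $T$ is a completely filled tableau of transpositions of $v(\lambda,r)$, and 1. $E(w,T)$ is row and column strict; 2. $(w,U,T)$ is an $r$-Bruhat package; 3. $x^U=x^Rx^Y$. -/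

import Mathlib

namespace RcInsertion

open Equiv

/-! ## Permutations

`S_∞` is realised inside `Equiv.Perm ℕ`: positions, values, rows, columns and strands are the
positive integers, and `0` is never moved. -/

/-- The simple transposition `s_i`. -/
def simple (i : ℕ) : Perm ℕ := swap i (i + 1)

/-- `s_{i_1} ⋯ s_{i_l}` for the word `i_1 … i_l`. -/
def wordPerm (L : List ℕ) : Perm ℕ := (L.map simple).prod

/-- The length of `w ∈ S_∞`: the least number of letters of a word `i_1 … i_l` in the alphabet
`1, 2, …` with `w = s_{i_1} ⋯ s_{i_l}`. -/
noncomputable def len (w : Perm ℕ) : ℕ :=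
  sInf {n | ∃ L : List ℕ, (∀ i ∈ L, 1 ≤ i) ∧ wordPerm L = w ∧ L.length = n}

/-- `L` is a reduced word of `w`. -/
def IsReducedWord (L : List ℕ) (w : Perm ℕ) : Prop :=
  (∀ i ∈ L, 1 ≤ i) ∧ wordPerm L = w ∧ L.length = len w

/-- `w` is an `r`-shuffle: its only possible descent is at `r`. -/
def IsShuffle (w : Perm ℕ) (r : ℕ) : Prop := ∀ i, 1 ≤ i → i ≠ r → w i < w (i + 1)

/-- `w` is an `r`-semi-shuffle: it has no descent greater than `r`. -/
def IsSemiShuffle (w : Perm ℕ) (r : ℕ) : Prop := ∀ i, r < i → w i < w (i + 1)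

/-- The part `lam_j` (`j = 1, 2, …`) of the partition with Young diagram `lam`. -/
def part (lam : YoungDiagram) (j : ℕ) : ℕ := lam.rowLen (j - 1)

/-- `v = v(lam, r)`: `v` is an `r`-shuffle, `lam` has at most `r` parts and
`lam_j = v(r + 1 - j) - r - 1 + j` for `1 ≤ j ≤ r`. -/
def IsShuffleOf (v : Perm ℕ) (lam : YoungDiagram) (r : ℕ) : Prop :=
  IsShuffle v r ∧ part lam (r + 1) = 0 ∧
    ∀ j, 1 ≤ j → j ≤ r → v (r + 1 - j) = part lam j + (r + 1 - j)

/-- `lam = (lam_1, 1, …, 1)` (rows, columns and the empty partition are included). -/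
def IsHook (lam : YoungDiagram) : Prop := ∀ j, 2 ≤ j → part lam j ≤ 1

/-! ## Graphs and rc-graphs -/

/-- A graph is recorded by the set of places `(row, column)` at which it has a crossing. -/
abbrev Graph := Finset (ℕ × ℕ)

/-- The order in which the crossings are read: rows from top to bottom, each from right to left. -/
def ReadBefore (p q : ℕ × ℕ) : Prop := p.1 < q.1 ∨ (p.1 = q.1 ∧ q.2 ≤ p.2)

instance : DecidableRel ReadBefore := fun p q => by unfold ReadBefore; infer_instance

instance : IsTrans (ℕ × ℕ) ReadBefore := ⟨fun a b c h h' => by unfold ReadBefore at *; omega⟩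

instance : Std.Antisymm ReadBefore :=
  ⟨fun a b h h' => by unfold ReadBefore at *; apply Prod.ext <;> omega⟩

instance : Std.Total ReadBefore := ⟨fun a b => by unfold ReadBefore at *; omega⟩

/-- The word of a graph; the crossing in place `(i, j)` is labelled `i + j - 1`. -/
def graphWord (R : Graph) : List ℕ := (R.sort ReadBefore).map fun p => p.1 + p.2 - 1

/-- The permutation `w(R)` of a graph. -/
def perm (R : Graph) : Perm ℕ := wordPerm (graphWord R)

/-- `R` is an rc-graph: its rows and columns are numbered from `1` and its word is a reduced word
of its permutation. -/
def IsRcGraph (R : Graph) : Prop :=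
  (∀ p ∈ R, 1 ≤ p.1 ∧ 1 ≤ p.2) ∧ IsReducedWord (graphWord R) (perm R)

/-- The set of all rc-graphs of `w`. -/
def RC (w : Perm ℕ) : Set Graph := {R | IsRcGraph R ∧ perm R = w}

/-- `R_{≥ l}`: the part of `R` in the rows `l, l + 1, …`. -/
def rowsFrom (R : Graph) (l : ℕ) : Graph := R.filter fun p => l ≤ p.1

/-- `R_l`: the part of `R` in row `l`. -/
def row (R : Graph) (l : ℕ) : Graph := R.filter fun p => p.1 = l

/-- The monomial `x^R = x_1^{|R_1|} x_2^{|R_2|} ⋯`. -/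
noncomputable def monomialOf (R : Graph) : MvPolynomial ℕ ℤ :=
  ∏ i ∈ R.image Prod.fst, MvPolynomial.X i ^ (row R i).card

/-- The two ways in which a strand can enter a place. -/
inductive Side
  | left
  | below

/-- `Enters R k s i j`: strand `k` (the strand which starts at the left end of row `k`) enters
place `(i, j)` from side `s`. Strands run to the right and upwards; at a crossing a strand goes
straight on, and at any other place the strand coming from the left turns up and the strand coming
from below turns right. (`Enters R k .below 0 j` says that the strand ends on top of column `j`.) -/
inductive Enters (R : Graph) (k : ℕ) : Side → ℕ → ℕ → Prop
  | start : 1 ≤ k → Enters R k .left k 1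
  | straightRight {i j : ℕ} : Enters R k .left i j → (i, j) ∈ R → Enters R k .left i (j + 1)
  | turnUp {i j : ℕ} : Enters R k .left (i + 1) j → (i + 1, j) ∉ R → Enters R k .below i j
  | straightUp {i j : ℕ} : Enters R k .below (i + 1) j → (i + 1, j) ∈ R → Enters R k .below i j
  | turnRight {i j : ℕ} :
      Enters R k .below (i + 1) j → (i + 1, j) ∉ R → Enters R k .left (i + 1) (j + 1)

/-- The strands which pass place `(i, j)` are `c`, coming from the left, and `d`, coming from
below. If there is a crossing at this place, then `c` is its horizontal and `d` its vertical
strand. -/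
def Pass (R : Graph) (i j c d : ℕ) : Prop := Enters R c .left i j ∧ Enters R d .below i j

/-! ## Tableaux -/

/-- A (partially filled) tableau: a Young diagram, whose first `word.length` boxes are filled with
the entries of `word`. -/
structure Tableau (α : Type) where
  shape : YoungDiagram
  word : List α

/-- The label of a box: boxes are numbered `1, 2, …` from the bottom row up, and from left to right
in each row. (In Mathlib's Young diagrams the top row is row `0`.) -/
def boxNumber (D : YoungDiagram) (c : ℕ × ℕ) : ℕ :=
  (D.cells.filter fun d => c.1 < d.1 ∨ (d.1 = c.1 ∧ d.2 ≤ c.2)).card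

/-- The entry `x` stands in box `c` of `T`. -/
def Tableau.HasEntry {α : Type} (T : Tableau α) (c : ℕ × ℕ) (x : α) : Prop :=
  c ∈ T.shape ∧ T.word[boxNumber T.shape c - 1]? = some x

/-- Entries increase from left to right and do not decrease from top to bottom. -/
def RowStrict (T : Tableau ℕ) : Prop :=
  (∀ i j j' x y, j < j' → T.HasEntry (i, j) x → T.HasEntry (i, j') y → x < y) ∧
  (∀ i i' j x y, i < i' → T.HasEntry (i, j) x → T.HasEntry (i', j) y → x ≤ y)

/-- Entries do not decrease from left to right and increase from top to bottom. -/
def ColumnStrict (T : Tableau ℕ) : Prop :=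
  (∀ i j j' x y, j < j' → T.HasEntry (i, j) x → T.HasEntry (i, j') y → x ≤ y) ∧
  (∀ i i' j x y, i < i' → T.HasEntry (i, j) x → T.HasEntry (i', j) y → x < y)

/-- `T` is a tableau of shape `lam` filled up to `n` by pairs `(a b)` with `a ≤ r < b`. -/
def IsTranspositionTableau (r : ℕ) (lam : YoungDiagram) (n : ℕ) (T : Tableau (ℕ × ℕ)) : Prop :=
  T.shape = lam ∧ T.word.length = n ∧ n ≤ lam.card ∧ ∀ p ∈ T.word, 1 ≤ p.1 ∧ p.1 ≤ r ∧ r < p.2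

/-- `w_i(T) = t_{a_1 b_1} ⋯ t_{a_i b_i}`. -/
def chainPerm (T : Tableau (ℕ × ℕ)) (i : ℕ) : Perm ℕ :=
  ((T.word.take i).map fun p => swap p.1 p.2).prod

/-- `w(T)`: the product of the transpositions in all filled boxes. -/
def tableauPerm (T : Tableau (ℕ × ℕ)) : Perm ℕ := chainPerm T T.word.length

/-- `T` is an `r`-Bruhat chain of `w` (the entries of `T` are pairs `(a b)` with `a ≤ r < b`). -/
def IsBruhatChain (r : ℕ) (w : Perm ℕ) (T : Tableau (ℕ × ℕ)) : Prop :=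
  (∀ p ∈ T.word, 1 ≤ p.1 ∧ p.1 ≤ r ∧ r < p.2) ∧
  ∀ i, 1 ≤ i → i ≤ T.word.length → len (w * chainPerm T i) = len w + i

/-- `(w, R, T)` is an `r`-Bruhat package. -/
def IsBruhatPackage (r : ℕ) (w : Perm ℕ) (R : Graph) (T : Tableau (ℕ × ℕ)) : Prop :=
  IsRcGraph R ∧ w * tableauPerm T = perm R ∧ IsBruhatChain r w T

/-- `E(w, T)`: box `i` contains `w w_i(T) (b_i)`. -/
def E (w : Perm ℕ) (T : Tableau (ℕ × ℕ)) : Tableau ℕ where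
  shape := T.shape
  word := T.word.mapIdx fun i p => (w * chainPerm T (i + 1)) p.2

/-! ## The insertion algorithm -/

open Classical in
/-- `word(Y, s)`: the rows of the crossings on strand `s`, in weakly decreasing order. -/
noncomputable def strandWord (Y : Graph) (s : ℕ) : List ℕ :=
  ((Y.filter fun p => ∃ side, Enters Y s side p.1 p.2).val.map Prod.fst).sort (· ≥ ·)

/-- `word(Y) = word(Y, 1) ⋯ word(Y, r)`. -/
noncomputable def insWord (r : ℕ) (Y : Graph) : List ℕ :=
  (List.range r).flatMap fun s => strandWord Y (s + 1)

/-- For an `r`-Bruhat package `(w, R, T)` with `m` filled boxes, `S` lists the rc-graphs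
`S_0, …, S_m`: `S_m = R`, and `S_j` arises from `S_{j+1}` by removing exactly one crossing in such
a way that `w(S_j) = w w_j(T)`. -/
def IsBacktrack (w : Perm ℕ) (R : Graph) (T : Tableau (ℕ × ℕ)) (S : ℕ → Graph) : Prop :=
  S T.word.length = R ∧
  ∀ j, j < T.word.length →
    (∃ p ∈ S (j + 1), S j = (S (j + 1)).erase p) ∧ perm (S j) = w * chainPerm T j

/-- Place `(l, j)` is not a crossing, strands `c` (from the left) and `d` (from below) pass it, and
`c ≤ r < d`. -/
def Allowed (r : ℕ) (Q : Graph) (l j c d : ℕ) : Prop :=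
  (l, j) ∉ Q ∧ Pass Q l j c d ∧ c ≤ r ∧ r < d

/-- Insertion in row `l`: a crossing is added at the rightmost allowed place and its strands are
recorded in the next box. -/
def InsertionStep (r l : ℕ) (Q : Graph) (T : Tableau (ℕ × ℕ)) (Q' : Graph)
    (T' : Tableau (ℕ × ℕ)) : Prop :=
  ∃ j c d, Allowed r Q l j c d ∧ (∀ j' c' d', j < j' → ¬ Allowed r Q l j' c' d') ∧
    Q' = insert (l, j) Q ∧ T' = ⟨T.shape, T.word ++ [(c, d)]⟩

/-- `(w, Q, T)` satisfies the two conditions required after each step. -/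
def Valid (r : ℕ) (w : Perm ℕ) (Q : Graph) (T : Tableau (ℕ × ℕ)) : Prop :=
  RowStrict (E w T) ∧ ColumnStrict (E w T) ∧ IsBruhatPackage r w Q T

/-- The last filled box of `T` contains `(a b)`, and `Q` has a crossing at `(l, j)` with horizontal
strand `b` and vertical strand `a`. -/
def FirstRemoval (l : ℕ) (Q : Graph) (T : Tableau (ℕ × ℕ)) (j : ℕ) : Prop :=
  ∃ L a b, T.word = L ++ [(a, b)] ∧ (l, j) ∈ Q ∧ Pass Q l j b a

/-- The last two filled boxes of `T` contain `(a f)` and `(a b)`, the entries before them form `L`,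
and `Q` has a crossing at `(l, j)` with horizontal strand `b` and vertical strand `f`. -/
def SecondRemoval (l : ℕ) (Q : Graph) (T : Tableau (ℕ × ℕ)) (j : ℕ) (L : List (ℕ × ℕ))
    (a b : ℕ) : Prop :=
  ∃ f, T.word = L ++ [(a, f), (a, b)] ∧ (l, j) ∈ Q ∧ Pass Q l j b f

/-- The removal part of a rectification, from `(Q, T) = (R', T')` to `(Q', T') = (R'', T'')`; the
crossing removed is the one at `(l, j)`. -/
def RemovalStep (l : ℕ) (Q : Graph) (T : Tableau (ℕ × ℕ)) (j : ℕ) (Q' : Graph)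
    (T' : Tableau (ℕ × ℕ)) : Prop :=
  Q' = Q.erase (l, j) ∧
  ((FirstRemoval l Q T j ∧ T' = ⟨T.shape, T.word.dropLast⟩) ∨
   ((∀ j', ¬ FirstRemoval l Q T j') ∧
     ∃ L a b, SecondRemoval l Q T j L a b ∧ T' = ⟨T.shape, L ++ [(a, b)]⟩))

/-- The second kind of place where insertion is allowed in a rectification: the last filled box of
`T` contains `(e g)`, place `(l, j)` is not a crossing, strands `g` (from the left) and `d` (from
below) pass it, and `r < d`. -/
def AllowedSecond (r : ℕ) (Q : Graph) (T : Tableau (ℕ × ℕ)) (l j : ℕ) (L : List (ℕ × ℕ))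
    (e g d : ℕ) : Prop :=
  T.word = L ++ [(e, g)] ∧ (l, j) ∉ Q ∧ Pass Q l j g d ∧ r < d

/-- The reinsertion part of a rectification: a crossing is added at the rightmost allowed place to
the left of `(l, j₀)`. -/
def ReinsertionStep (r l j₀ : ℕ) (Q : Graph) (T : Tableau (ℕ × ℕ)) (Q' : Graph)
    (T' : Tableau (ℕ × ℕ)) : Prop :=
  ∃ j, j < j₀ ∧
    (∀ j', j < j' → j' < j₀ →
      (∀ c d, ¬ Allowed r Q l j' c d) ∧ (∀ L e g d, ¬ AllowedSecond r Q T l j' L e g d)) ∧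
    Q' = insert (l, j) Q ∧
    ((∃ c d, Allowed r Q l j c d ∧ T' = ⟨T.shape, T.word ++ [(c, d)]⟩) ∨
     (∃ L e g d, AllowedSecond r Q T l j L e g d ∧ T' = ⟨T.shape, L ++ [(e, d), (e, g)]⟩))

/-- The second half of a rectification in row `l`, starting from `R'` and `T'` (here `Q₁`, `T₁`):
nothing is done if the required conditions hold; otherwise one crossing is removed from row `l` and
another one is inserted to the left of it. Here `w = w(R_{≥ l})`. -/
def RectifyStep (r l : ℕ) (w : Perm ℕ) (Q₁ : Graph) (T₁ : Tableau (ℕ × ℕ)) (Q' : Graph)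
    (T' : Tableau (ℕ × ℕ)) : Prop :=
  (Valid r w Q₁ T₁ ∧ Q' = Q₁ ∧ T' = T₁) ∨
  (¬ Valid r w Q₁ T₁ ∧ ∃ j₀ Q₂ T₂, RemovalStep l Q₁ T₁ j₀ Q₂ T₂ ∧
    ReinsertionStep r l j₀ Q₂ T₂ Q' T')

/-- `Step r R Y l i Q T`: the insertion algorithm, applied to `R` and `Y`, produces
`R(l, i) = Q` and `T(l, i) = T` in step `(l, i)`. The steps of row `l` are `(l, 0), …, (l, m_l)` with
`m_l = |Y_{≥ l}|`; the rows are processed in the order `r, r - 1, …, 1`. -/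
inductive Step (r : ℕ) (R Y : Graph) : ℕ → ℕ → Graph → Tableau (ℕ × ℕ) → Prop
  /-- Start: `R(r, 0) = R_{≥ r}`, and `T(r, 0)` is the empty tableau of the shape of `Y_{≥ r}`. -/
  | start {D : YoungDiagram} (hD : IsShuffleOf (perm (rowsFrom Y r)) D r) :
      Step r R Y r 0 (rowsFrom R r) ⟨D, []⟩
  /-- Row-to-row step: `R(l, 0) = S_0 ∪ R_l`, where `S_0, S_1, …` backtrack the result of row
  `l + 1`, and `T(l, 0)` is the empty tableau of the shape of `Y_{≥ l}`. -/
  | rowToRow {l : ℕ} {U : Graph} {T : Tableau (ℕ × ℕ)} {S : ℕ → Graph} {D : YoungDiagram}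
      (hl : 1 ≤ l) (hprev : Step r R Y (l + 1) (rowsFrom Y (l + 1)).card U T)
      (hS : IsBacktrack (perm (rowsFrom R (l + 1))) U T S)
      (hD : IsShuffleOf (perm (rowsFrom Y l)) D r) :
      Step r R Y l 0 (S 0 ∪ row R l) ⟨D, []⟩
  /-- Insertion: letter `i + 1` of the word of `Y_{≥ l}` is `l`. -/
  | insertion {l i : ℕ} {Q Q' : Graph} {T T' : Tableau (ℕ × ℕ)}
      (hcur : Step r R Y l i Q T)
      (hletter : (insWord r (rowsFrom Y l))[i]? = some l)
      (hstep : InsertionStep r l Q T Q' T') :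
      Step r R Y l (i + 1) Q' T'
  /-- Rectification: letter `i + 1` of the word of `Y_{≥ l}` is greater than `l`. Deleting the
  letters `l` from this word gives the word of `Y_{≥ l + 1}`, in which the letter in question has
  index `n + 1`, where `n` is the number of letters greater than `l` before it. The crossing in
  which `S_{n + 1}` differs from `S_n` is added to the graph and the entry of box `n + 1` of
  `T(l + 1, m_{l+1})` to the tableau, and the result is rectified. -/
  | rectification {l i k n : ℕ} {U Q Q' : Graph} {V T T' : Tableau (ℕ × ℕ)} {S : ℕ → Graph}
      {ab : ℕ × ℕ}
      (hprev : Step r R Y (l + 1) (rowsFrom Y (l + 1)).card U V)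
      (hS : IsBacktrack (perm (rowsFrom R (l + 1))) U V S)
      (hcur : Step r R Y l i Q T)
      (hletter : (insWord r (rowsFrom Y l))[i]? = some k) (hk : l < k)
      (hn : n = (((insWord r (rowsFrom Y l)).take i).filter (fun k' => l < k')).length)
      (hab : V.word[n]? = some ab)
      (hstep : RectifyStep r l (perm (rowsFrom R l)) (Q ∪ (S (n + 1) \ S n))
        ⟨T.shape, T.word ++ [ab]⟩ Q' T') :
      Step r R Y l (i + 1) Q' T'

/-- The insertion algorithm, applied to `R` and `Y`, ends with `R ← Y = U` and `T(R, Y) = T`. -/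
def Inserts (r : ℕ) (R Y U : Graph) (T : Tableau (ℕ × ℕ)) : Prop :=
  Step r R Y 1 (rowsFrom Y 1).card U T

end RcInsertion

open RcInsertion

/-!
# Insertion of an rc-graph of a shuffle

*One row.* While row `l` is processed, the graph is `S ∪ rowGraph l C`: a graph `S` in the rows
below row `l`, of which only the permutation `u = perm S` matters (it maps a strand to its
position), and the set `C` of the labels of the crossings in row `l`. The strands which pass the
place with label `p` are those at the positions `carryPos C p` and `p + 1`, and the graph has the
permutation `rowPerm C * u`. It is an rc-graph iff in each crossing of the row the horizontal
strand is smaller than the vertical one (`len_rowPerm_mul`). Adding a crossing at an allowed place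
multiplies the permutation on the right by a transposition of its two strands, and this is a
covering in the Bruhat order (`GoodRow.insert_place`); the corresponding entry of `E` is the label
of the place.

*One rectification.* The lower part of the graph makes a step `u → u * swap a b`, a covering. If
the row does not exchange `a` and `b`, this is also a covering for the whole graph
(`RowState.keep`). Otherwise `a` and `b` cross in row `l`, and if this crossing is removed, the
permutation of the graph is the old one again (`RowState.remove`); a crossing inserted to the left
of it makes up for the loss. It remains to see that the new entry of `E` is larger than the one to
its left and smaller than the one below it. The properties `RowInv` and `ColInv` of the last box
guarantee the former, if the next box is to its right (`RowState.row_step`), and the latter, if the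
next box is above it (`RowState.col_step`), and each step reestablishes them.

*Columns.* In a hook two successive boxes are always neighbours, so that these two kinds of steps
suffice (`HookState.step`). If `w` is a semi-shuffle, then the big strands `b > r` have increasing
positions all along the chain. Therefore the second kind of removal and of insertion never occurs,
entries of `E` increase in a column as soon as the big strands of its boxes weakly decrease from
the bottom to the top, and this property is inherited from the row of the algorithm before
(`BoxContiguous`, `SemiState.step`).

*The loop.* The words of `Y_{≥ l}` and `Y_{≥ l + 1}` are compared in `IsRcGraph.insWord_rowsFrom`:
their shapes differ by a horizontal strip, and the letters `l` stand at the ends of the rows. An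
inserted box therefore has no box below it which could be too small. Backtracking exists by the
exchange property, and it is unique as different crossings of an rc-graph cannot be removed with the
same result (`exists_backtrack`, `backtrack_unique`). So the algorithm is deterministic
(`Step.unique`), and its result is constructed row by row (`RowResult.next`).
-/

namespace RcInsertion

open Equiv

/-! ### Permutations, length and covers -/

/-- `w` belongs to `S_∞`: it is a product of simple transpositions `s_i` with `i ≥ 1`. -/
def IsFinitary (w : Perm ℕ) : Prop := ∃ L : List ℕ, (∀ i ∈ L, 1 ≤ i) ∧ wordPerm L = w

@[simp] lemma wordPerm_nil : wordPerm [] = 1 := rfl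

@[simp] lemma wordPerm_cons (i : ℕ) (L : List ℕ) : wordPerm (i :: L) = simple i * wordPerm L := by
  simp [wordPerm]

@[simp] lemma wordPerm_append (L M : List ℕ) :
    wordPerm (L ++ M) = wordPerm L * wordPerm M := by
  simp [wordPerm]

@[simp] lemma simple_mul_self (i : ℕ) : simple i * simple i = 1 := by simp [simple]

@[simp] lemma simple_inv (i : ℕ) : (simple i)⁻¹ = simple i := by simp [simple]

lemma simple_apply (i k : ℕ) :
    simple i k = if k = i then i + 1 else if k = i + 1 then i else k := by
  simp [simple, swap_apply_def]

lemma simple_simple (i k : ℕ) : simple i (simple i k) = k := by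
  simp [simple]

lemma wordPerm_reverse (L : List ℕ) : wordPerm L.reverse = (wordPerm L)⁻¹ := by
  induction L with
  | nil => simp
  | cons i L ih => simp [ih]

lemma isFinitary_simple {i : ℕ} (hi : 1 ≤ i) : IsFinitary (simple i) := ⟨[i], by simpa, by simp⟩

lemma isFinitary_wordPerm {L : List ℕ} (h : ∀ i ∈ L, 1 ≤ i) : IsFinitary (wordPerm L) := ⟨L, h, rfl⟩

lemma IsFinitary.mul {v w : Perm ℕ} (hv : IsFinitary v) (hw : IsFinitary w) :
    IsFinitary (v * w) := by
  obtain ⟨L, hL, rfl⟩ := hv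
  obtain ⟨M, hM, rfl⟩ := hw
  refine ⟨L ++ M, fun i hi => ?_, by simp⟩
  rcases List.mem_append.1 hi with h | h
  exacts [hL i h, hM i h]

lemma IsFinitary.inv {w : Perm ℕ} (hw : IsFinitary w) : IsFinitary w⁻¹ := by
  obtain ⟨L, hL, rfl⟩ := hw
  exact ⟨L.reverse, by simpa using hL, wordPerm_reverse L⟩

lemma IsFinitary.apply_zero {w : Perm ℕ} (hw : IsFinitary w) : w 0 = 0 := by
  obtain ⟨L, hL, rfl⟩ := hw
  induction L with
  | nil => simp
  | cons i L ih =>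
    have hi := hL i (by simp)
    rw [wordPerm_cons, Perm.mul_apply, ih fun j hj => hL j (by simp [hj])]
    simp only [simple_apply]
    rw [if_neg (by omega), if_neg (by omega)]

lemma isFinitary_swap {a b : ℕ} (ha : 1 ≤ a) (hab : a < b) : IsFinitary (swap a b) := by
  induction b, hab using Nat.le_induction with
  | base => exact isFinitary_simple ha
  | succ b hb ih =>
    have : swap a (b + 1) = simple b * swap a b * simple b := by
      have h := swap_apply_apply (simple b) a b
      rw [simple_inv] at h
      rw [← h, simple_apply, simple_apply]
      congr 1
      · split_ifs <;> omega
      · simp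
    rw [this]
    exact ((isFinitary_simple (by omega)).mul ih).mul (isFinitary_simple (by omega))

/-- The inversions of `w`, as pairs of positions. -/
def invSet (w : Perm ℕ) : Set (ℕ × ℕ) := {p | p.1 < p.2 ∧ w p.2 < w p.1}

lemma invSet_one : invSet 1 = ∅ := by
  ext p; simp [invSet]; omega

lemma invSet_mul_simple {w : Perm ℕ} {i : ℕ} (h : w i < w (i + 1)) :
    invSet (w * simple i) =
      insert (i, i + 1) (Prod.map (simple i) (simple i) '' invSet w) := by
  ext ⟨p, q⟩
  have himg : (p, q) ∈ Prod.map (simple i) (simple i) '' invSet w ↔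
      simple i p < simple i q ∧ w (simple i q) < w (simple i p) := by
    constructor
    · rintro ⟨⟨p', q'⟩, hm, he⟩
      simp only [Prod.map_apply, Prod.mk.injEq] at he
      obtain ⟨rfl, rfl⟩ := he
      simpa [simple_simple, invSet] using hm
    · intro hm
      exact ⟨(simple i p, simple i q), hm, by simp [simple_simple]⟩
  rw [Set.mem_insert_iff, himg]
  change p < q ∧ w (simple i q) < w (simple i p) ↔ _
  rw [Prod.mk.injEq]
  have key : ∀ k, (k = i ∧ simple i k = i + 1) ∨ (k = i + 1 ∧ simple i k = i) ∨
      (k ≠ i ∧ k ≠ i + 1 ∧ simple i k = k) := by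
    intro k
    rw [simple_apply]
    split_ifs <;> omega
  rcases key p with ⟨hp, ep⟩ | ⟨hp, ep⟩ | ⟨hp, hp', ep⟩ <;>
    rcases key q with ⟨hq, eq⟩ | ⟨hq, eq⟩ | ⟨hq, hq', eq⟩ <;> rw [ep, eq] <;> omega

lemma ncard_image_simple (s : Set (ℕ × ℕ)) (i : ℕ) :
    (Prod.map (simple i) (simple i) '' s).ncard = s.ncard :=
  Set.ncard_image_of_injective _ ((simple i).injective.prodMap (simple i).injective)

lemma not_mem_image_simple {w : Perm ℕ} {i : ℕ} :
    (i, i + 1) ∉ Prod.map (simple i) (simple i) '' invSet w := by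
  rintro ⟨⟨p, q⟩, hm, he⟩
  simp only [Prod.map_apply, Prod.mk.injEq] at he
  have h1 : p = simple i i := by
    have := congrArg (simple i) he.1
    rwa [simple_simple] at this
  have h2 : q = simple i (i + 1) := by
    have := congrArg (simple i) he.2
    rwa [simple_simple] at this
  simp only [simple_apply] at h1 h2
  simp at h1 h2
  have := hm.1
  simp only at this
  omega

lemma mul_simple_mul_simple (w : Perm ℕ) (i : ℕ) : w * simple i * simple i = w := by
  simp [mul_assoc]

lemma invSet_finite_mul_simple {w : Perm ℕ} (hw : (invSet w).Finite) (i : ℕ) :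
    (invSet (w * simple i)).Finite := by
  rcases lt_or_gt_of_ne (w.injective.ne (Nat.ne_of_lt (Nat.lt_succ_self i))) with h | h
  · rw [invSet_mul_simple h]
    exact (hw.image _).insert _
  · have h' : (w * simple i) i < (w * simple i) (i + 1) := by
      simpa [simple_apply] using h
    have := invSet_mul_simple h'
    rw [mul_simple_mul_simple] at this
    rw [this] at hw
    exact (hw.subset (Set.subset_insert _ _)).of_finite_image
      ((simple i).injective.prodMap (simple i).injective).injOn

lemma IsFinitary.invSet_finite {w : Perm ℕ} (hw : IsFinitary w) : (invSet w).Finite := by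
  obtain ⟨L, -, rfl⟩ := hw
  induction L using List.reverseRecOn with
  | nil => simp [invSet_one]
  | append_singleton L i ih =>
    simpa using invSet_finite_mul_simple ih i

lemma ncard_invSet_mul_simple {w : Perm ℕ} (hw : (invSet w).Finite) {i : ℕ}
    (h : w i < w (i + 1)) : (invSet (w * simple i)).ncard = (invSet w).ncard + 1 := by
  rw [invSet_mul_simple h, Set.ncard_insert_of_notMem not_mem_image_simple (hw.image _),
    ncard_image_simple]

lemma perm_eq_one_of_no_descent {w : Perm ℕ} (h : ∀ i, w i < w (i + 1)) : w = 1 := by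
  have hm : StrictMono w := strictMono_nat_of_lt_succ h
  have hm' : StrictMono (w⁻¹ : Perm ℕ) := by
    intro a b hab
    by_contra hcon
    have := hm.monotone (not_lt.1 hcon)
    simp at this
    omega
  ext k
  have h1 := hm.le_apply (x := k)
  have h2 := hm'.le_apply (x := w k)
  simp at h2 ⊢
  omega

lemma exists_word_of_ncard (n : ℕ) : ∀ w : Perm ℕ, IsFinitary w → (invSet w).ncard = n →
    ∃ L : List ℕ, (∀ i ∈ L, 1 ≤ i) ∧ wordPerm L = w ∧ L.length = n := by
  induction n with
  | zero =>
    intro w hw hn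
    have : invSet w = ∅ := (Set.ncard_eq_zero hw.invSet_finite).1 hn
    refine ⟨[], by simp, ?_, rfl⟩
    rw [wordPerm_nil, eq_comm]
    refine perm_eq_one_of_no_descent fun i => ?_
    by_contra hcon
    have hne := w.injective.ne (Nat.ne_of_lt (Nat.lt_succ_self i))
    have : (i, i + 1) ∈ invSet w := ⟨Nat.lt_succ_self i, by
      change w (i + 1) < w i
      change w i ≠ w (i + 1) at hne
      omega⟩
    simp_all
  | succ n ih =>
    intro w hw hn
    have : ∃ i, w (i + 1) < w i := by
      by_contra hcon
      push Not at hcon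
      have : w = 1 := perm_eq_one_of_no_descent fun i =>
        lt_of_le_of_ne (hcon i) (w.injective.ne (by omega))
      rw [this, invSet_one] at hn
      simp at hn
    obtain ⟨i, hi⟩ := this
    have hi1 : 1 ≤ i := by
      rcases Nat.eq_zero_or_pos i with rfl | h
      · rw [hw.apply_zero] at hi; omega
      · exact h
    have h' : (w * simple i) i < (w * simple i) (i + 1) := by simpa [simple_apply] using hi
    have hf := hw.mul (isFinitary_simple hi1)
    have := ncard_invSet_mul_simple hf.invSet_finite h'
    rw [mul_simple_mul_simple] at this
    obtain ⟨L, h1, h2, h3⟩ := ih _ hf (by omega)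
    refine ⟨L ++ [i], fun j hj => ?_, ?_, by simp [h3]⟩
    · rcases List.mem_append.1 hj with h | h
      · exact h1 j h
      · simp at h; omega
    · simp [h2, mul_simple_mul_simple]

lemma ncard_invSet_le_length (L : List ℕ) (hL : ∀ i ∈ L, 1 ≤ i) :
    (invSet (wordPerm L)).ncard ≤ L.length := by
  induction L using List.reverseRecOn with
  | nil => simp [invSet_one]
  | append_singleton L i ih =>
    have ih := ih fun j hj => hL j (by simp [hj])
    have hf : IsFinitary (wordPerm L) := isFinitary_wordPerm fun j hj => hL j (by simp [hj])
    set w := wordPerm L with hwdef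
    rcases lt_or_gt_of_ne (w.injective.ne (Nat.ne_of_lt (Nat.lt_succ_self i))) with h | h
    · have := ncard_invSet_mul_simple hf.invSet_finite h
      simp only [wordPerm_append, wordPerm_cons, wordPerm_nil, mul_one, List.length_append,
        List.length_singleton, ← hwdef]
      omega
    · have h' : (w * simple i) i < (w * simple i) (i + 1) := by simpa [simple_apply] using h
      have := ncard_invSet_mul_simple (hf.mul (isFinitary_simple (hL i (by simp)))).invSet_finite h'
      rw [mul_simple_mul_simple] at this
      simp only [wordPerm_append, wordPerm_cons, wordPerm_nil, mul_one, List.length_append,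
        List.length_singleton, ← hwdef]
      omega

/-- The length is the number of inversions. -/
lemma len_eq_ncard {w : Perm ℕ} (hw : IsFinitary w) : len w = (invSet w).ncard := by
  apply le_antisymm
  · exact Nat.sInf_le (exists_word_of_ncard _ w hw rfl)
  · obtain ⟨L, hL, hw', -⟩ := exists_word_of_ncard _ w hw rfl
    have hne : {n | ∃ L : List ℕ, (∀ i ∈ L, 1 ≤ i) ∧ wordPerm L = w ∧ L.length = n}.Nonempty :=
      ⟨_, L, hL, hw', rfl⟩
    obtain ⟨M, hM, hMw, hMl⟩ := Nat.sInf_mem hne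
    have := ncard_invSet_le_length M hM
    rw [hMw] at this
    unfold len
    omega

lemma len_wordPerm_le {L : List ℕ} (hL : ∀ i ∈ L, 1 ≤ i) : len (wordPerm L) ≤ L.length := by
  rw [len_eq_ncard (isFinitary_wordPerm hL)]
  exact ncard_invSet_le_length L hL

lemma len_mul_simple {w : Perm ℕ} (hw : IsFinitary w) {i : ℕ} (hi : 1 ≤ i)
    (h : w i < w (i + 1)) : len (w * simple i) = len w + 1 := by
  rw [len_eq_ncard hw, len_eq_ncard (hw.mul (isFinitary_simple hi)),
    ncard_invSet_mul_simple hw.invSet_finite h]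

lemma len_mul_simple' {w : Perm ℕ} (hw : IsFinitary w) {i : ℕ} (hi : 1 ≤ i)
    (h : w (i + 1) < w i) : len (w * simple i) + 1 = len w := by
  have h' : (w * simple i) i < (w * simple i) (i + 1) := by simpa [simple_apply] using h
  have := len_mul_simple (hw.mul (isFinitary_simple hi)) hi h'
  rw [mul_simple_mul_simple] at this
  omega

lemma len_inv_le {w : Perm ℕ} (hw : IsFinitary w) : len w⁻¹ ≤ len w := by
  obtain ⟨L, hL, hw', hl⟩ := exists_word_of_ncard _ w hw rfl
  rw [len_eq_ncard hw, ← hl, ← hw', ← wordPerm_reverse, ← List.length_reverse]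
  exact len_wordPerm_le (by simpa using hL)

lemma len_inv {w : Perm ℕ} (hw : IsFinitary w) : len w⁻¹ = len w :=
  le_antisymm (len_inv_le hw) (by simpa using len_inv_le hw.inv)

lemma len_simple_mul {w : Perm ℕ} (hw : IsFinitary w) {i : ℕ} (hi : 1 ≤ i)
    (h : w⁻¹ i < w⁻¹ (i + 1)) : len (simple i * w) = len w + 1 := by
  have := len_mul_simple hw.inv hi h
  rw [len_inv hw, ← len_inv (hw.inv.mul (isFinitary_simple hi))] at this
  simpa using this

lemma len_simple_mul' {w : Perm ℕ} (hw : IsFinitary w) {i : ℕ} (hi : 1 ≤ i)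
    (h : w⁻¹ (i + 1) < w⁻¹ i) : len (simple i * w) + 1 = len w := by
  have := len_mul_simple' hw.inv hi h
  rw [len_inv hw, ← len_inv (hw.inv.mul (isFinitary_simple hi))] at this
  simpa using this

/-- Multiplying by a transposition which creates an inversion lengthens `w` by one plus twice the
number of values passed on the way. -/
lemma len_mul_swap (a b : ℕ) (ha : 1 ≤ a) (hab : a < b) (w : Perm ℕ) (hw : IsFinitary w)
    (h : w a < w b) :
    len (w * swap a b) =
      len w + 1 + 2 * ((Finset.Ioo a b).filter fun c => w a < w c ∧ w c < w b).card := by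
  induction hn : b - a generalizing a w with
  | zero => omega
  | succ n ih =>
    rcases Nat.eq_or_lt_of_le hab with rfl | hab'
    · have := len_mul_simple hw ha h
      simp only [simple] at this
      simp [this]
    · have hne1 : w a ≠ w (a + 1) := w.injective.ne (by omega)
      have hne2 : w b ≠ w (a + 1) := w.injective.ne (by omega)
      have hs : swap a b = simple a * swap (a + 1) b * simple a := by
        have h := swap_apply_apply (simple a) (a + 1) b
        rw [simple_inv] at h
        rw [← h, simple_apply, simple_apply]
        congr 1
        · simp
        · split_ifs <;> omega
      have hf := isFinitary_simple ha
      set w1 := w * simple a with hw1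
      have e1 : w1 (a + 1) = w a := by simp [hw1, simple_apply]
      have e2 : w1 b = w b := by
        simp only [hw1, Perm.mul_apply, simple_apply]
        rw [if_neg (by omega), if_neg (by omega)]
      have e3 : w1 a = w (a + 1) := by simp [hw1, simple_apply]
      have hIH := ih (a + 1) (by omega) hab' w1 (hw.mul hf) (by rw [e1, e2]; exact h) (by omega)
      set w2 := w1 * swap (a + 1) b with hw2
      have hw2f : IsFinitary w2 := (hw.mul hf).mul (isFinitary_swap (by omega) hab')
      have e4 : w2 a = w (a + 1) := by
        rw [hw2, Perm.mul_apply, swap_apply_of_ne_of_ne (by omega) (by omega), e3]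
      have e5 : w2 (a + 1) = w b := by
        rw [hw2, Perm.mul_apply, swap_apply_left, e2]
      have hgoal : w * swap a b = w2 * simple a := by
        rw [hs, hw2, hw1]; simp only [mul_assoc]
      have hset : ((Finset.Ioo (a + 1) b).filter fun c => w1 (a + 1) < w1 c ∧ w1 c < w1 b) =
          (Finset.Ioo (a + 1) b).filter fun c => w a < w c ∧ w c < w b := by
        apply Finset.filter_congr
        intro c hc
        rw [Finset.mem_Ioo] at hc
        have : w1 c = w c := by
          simp only [hw1, Perm.mul_apply, simple_apply]
          rw [if_neg (by omega), if_neg (by omega)]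
        rw [e1, e2, this]
      rw [hset] at hIH
      have hIoo : Finset.Ioo a b = insert (a + 1) (Finset.Ioo (a + 1) b) := by
        ext c; simp only [Finset.mem_Ioo, Finset.mem_insert]; omega
      have hnm : a + 1 ∉ (Finset.Ioo (a + 1) b).filter fun c => w a < w c ∧ w c < w b := by simp
      rw [hgoal, hIoo, Finset.filter_insert]
      rcases lt_or_gt_of_ne hne1 with h1 | h1
      · have l1 : len w1 = len w + 1 := len_mul_simple hw ha h1
        rcases lt_or_gt_of_ne hne2 with h2 | h2
        · have l2 := len_mul_simple' hw2f ha (by rw [e4, e5]; exact h2)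
          rw [if_neg (by omega)]
          omega
        · have l2 := len_mul_simple hw2f ha (by rw [e4, e5]; exact h2)
          rw [if_pos ⟨h1, h2⟩, Finset.card_insert_of_notMem hnm]
          omega
      · have l1 : len w1 + 1 = len w := len_mul_simple' hw ha h1
        have l2 := len_mul_simple hw2f ha (by rw [e4, e5]; omega)
        rw [if_neg (by omega)]
        omega

/-- `u` is covered by `u t_{ab}` in the Bruhat order, in terms of the positions `u a < u b` of `a`
and `b`: no strand numbered between `a` and `b` stands between them. -/
def Cover (u : Perm ℕ) (a b : ℕ) : Prop :=
  a < b ∧ u a < u b ∧ ∀ c, a < c → c < b → ¬ (u a < u c ∧ u c < u b)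

lemma lt_len_mul_swap {u : Perm ℕ} (hu : IsFinitary u) {a b : ℕ} (ha : 1 ≤ a) (hab : a < b)
    (h : u a < u b) : len u < len (u * swap a b) := by
  rw [len_mul_swap a b ha hab u hu h]; omega

lemma len_mul_swap_lt {u : Perm ℕ} (hu : IsFinitary u) {a b : ℕ} (ha : 1 ≤ a) (hab : a < b)
    (h : u b < u a) : len (u * swap a b) < len u := by
  have := lt_len_mul_swap (hu.mul (isFinitary_swap ha hab)) ha hab (by simpa using h)
  simpa [mul_assoc] using this

lemma cover_iff {u : Perm ℕ} (hu : IsFinitary u) {a b : ℕ} (ha : 1 ≤ a) (hab : a < b) :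
    Cover u a b ↔ len (u * swap a b) = len u + 1 := by
  constructor
  · rintro ⟨-, h, hc⟩
    rw [len_mul_swap a b ha hab u hu h, Finset.card_eq_zero.2]
    apply Finset.filter_eq_empty_iff.2
    intro c hc'
    rw [Finset.mem_Ioo] at hc'
    exact hc c hc'.1 hc'.2
  · intro h
    have hlt : u a < u b := by
      by_contra hcon
      have := len_mul_swap_lt hu ha hab (lt_of_le_of_ne (not_lt.1 hcon)
        (u.injective.ne (by omega)))
      omega
    refine ⟨hab, hlt, fun c h1 h2 h3 => ?_⟩
    rw [len_mul_swap a b ha hab u hu hlt] at h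
    have : c ∈ (Finset.Ioo a b).filter fun c => u a < u c ∧ u c < u b := by simp [*]
    have := Finset.card_pos.2 ⟨c, this⟩
    omega

lemma Cover.len_eq {u : Perm ℕ} {a b : ℕ} (h : Cover u a b) (hu : IsFinitary u) (ha : 1 ≤ a) :
    len (u * swap a b) = len u + 1 := (cover_iff hu ha h.1).1 h

/-! ### A single row of crossings -/

/-- A row of crossings is recorded by the set `C` of the labels of its crossings. Scanning the row
from left to right, `carryPos C p` is the position, below the row, of the strand which enters the
place labelled `p` from the left. -/
def carryPos (C : Finset ℕ) : ℕ → ℕ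
  | 0 => 0
  | p + 1 => if p ∈ C then carryPos C p else p + 1

/-- The permutation of a row of crossings with set of labels `C`. -/
def rowPerm (C : Finset ℕ) : Perm ℕ := wordPerm (C.sort (· ≥ ·))

lemma carryPos_succ_of_mem {C : Finset ℕ} {p : ℕ} (h : p ∈ C) :
    carryPos C (p + 1) = carryPos C p := by simp [carryPos, h]

lemma carryPos_succ_of_notMem {C : Finset ℕ} {p : ℕ} (h : p ∉ C) :
    carryPos C (p + 1) = p + 1 := by simp [carryPos, h]

lemma carryPos_le (C : Finset ℕ) (p : ℕ) : carryPos C p ≤ p := by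
  induction p with
  | zero => simp [carryPos]
  | succ p ih => simp only [carryPos]; split_ifs <;> omega

lemma one_le_carryPos {C : Finset ℕ} (hC : 0 ∉ C) {p : ℕ} (hp : 1 ≤ p) : 1 ≤ carryPos C p := by
  induction p, hp using Nat.le_induction with
  | base => simp [carryPos, hC]
  | succ p hp ih => simp only [carryPos]; split_ifs <;> omega

lemma carryPos_spec {C : Finset ℕ} {q p : ℕ} (h1 : carryPos C q ≤ p) (h2 : p ≤ q) :
    carryPos C p = carryPos C q ∧ (p < q → p ∈ C) := by
  induction q, h2 using Nat.le_induction with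
  | base => simp
  | succ q hq ih =>
    by_cases hm : q ∈ C
    · rw [carryPos_succ_of_mem hm] at h1 ⊢
      refine ⟨(ih h1).1, fun _ => ?_⟩
      rcases Nat.eq_or_lt_of_le hq with rfl | h
      exacts [hm, (ih h1).2 h]
    · rw [carryPos_succ_of_notMem hm] at h1
      omega

lemma carryPos_congr {C D : Finset ℕ} {p : ℕ} (h : ∀ k, k < p → (k ∈ C ↔ k ∈ D)) :
    carryPos C p = carryPos D p := by
  induction p with
  | zero => rfl
  | succ p ih =>
    simp only [carryPos, h p (by omega), ih fun k hk => h k (by omega)]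

/-- The strand which leaves the place labelled `p` upwards comes from this position. -/
def rowInv (C : Finset ℕ) (p : ℕ) : ℕ := if p ∈ C then p + 1 else carryPos C p

lemma carryPos_eq_self {C : Finset ℕ} {p : ℕ} (h : ∀ q ∈ C, p ≤ q) : carryPos C p = p := by
  cases p with
  | zero => rfl
  | succ p =>
    apply carryPos_succ_of_notMem
    intro hm
    have := h p hm
    omega

lemma carryPos_of_gt {C : Finset ℕ} {p : ℕ} (h : ∀ q ∈ C, q + 1 < p) : carryPos C p = p := by
  cases p with
  | zero => rfl
  | succ p =>
    apply carryPos_succ_of_notMem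
    intro hm
    have := h p hm
    omega

lemma rowPerm_empty : rowPerm ∅ = 1 := by simp [rowPerm]

lemma sort_insert_max {C : Finset ℕ} {p : ℕ} (h : ∀ q ∈ C, q < p) :
    (insert p C).sort (· ≥ ·) = p :: C.sort (· ≥ ·) := by
  refine Finset.sort_insert (r := (· ≥ ·)) ?_ ?_
  · intro q hq
    exact (h q hq).le
  · intro hm
    exact lt_irrefl _ (h p hm)

lemma rowPerm_insert_max {C : Finset ℕ} {p : ℕ} (h : ∀ q ∈ C, q < p) :
    rowPerm (insert p C) = simple p * rowPerm C := by
  simp [rowPerm, sort_insert_max h]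

lemma rowPerm_inv_apply (C : Finset ℕ) (q : ℕ) : (rowPerm C)⁻¹ q = rowInv C q := by
  induction C using Finset.induction_on_max generalizing q with
  | empty => 
    simp [rowPerm_empty, rowInv]
    exact (carryPos_eq_self (by simp)).symm
  | insert p C hp ih =>
    rw [rowPerm_insert_max hp, mul_inv_rev, simple_inv, Perm.mul_apply, ih]
    have hpC : p ∉ C := fun h => lt_irrefl _ (hp p h)
    have hcp : ∀ k, k ≤ p → carryPos (insert p C) k = carryPos C k := fun k hk =>
      carryPos_congr fun m hm => by simp; omega
    have hbig : ∀ k, p < k → k ∉ C := fun k hk hm => by have := hp k hm; omega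
    simp only [simple_apply, rowInv, Finset.mem_insert]
    rcases lt_trichotomy q p with h | rfl | h
    · simp [h.ne, show q ≠ p + 1 by omega, hcp q h.le]
    · simp [hbig (q + 1) (by omega), carryPos_succ_of_notMem hpC]
    · rcases Nat.eq_or_lt_of_le h with rfl | h'
      · have e : carryPos (insert p C) (p + 1) = carryPos C p := by
          rw [carryPos_succ_of_mem (by simp), hcp p le_rfl]
        simp [hpC, hbig (p + 1) (by omega), e]
      · have e1 : carryPos (insert p C) q = q := carryPos_of_gt fun k hk => by
          rcases Finset.mem_insert.1 hk with rfl | hk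
          · omega
          · have := hp k hk; omega
        have e2 : carryPos C q = q := carryPos_of_gt fun k hk => by have := hp k hk; omega
        have h1 : q ≠ p + 1 := by omega
        simp [hbig q h, h.ne', h1, e1, e2]

lemma carryPos_insert {C : Finset ℕ} {p : ℕ} (hp : p ∉ C) {q : ℕ} (hq : p < q) :
    carryPos (insert p C) q = swap (carryPos C p) (p + 1) (carryPos C q) := by
  have hcp : carryPos (insert p C) p = carryPos C p := carryPos_congr fun m hm => by simp; omega
  induction q, hq using Nat.le_induction with
  | base =>
    rw [Nat.succ_eq_add_one, carryPos_succ_of_mem (by simp), carryPos_succ_of_notMem hp,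
      swap_apply_right, hcp]
  | succ q hq ih =>
    by_cases hm : q ∈ C
    · rw [carryPos_succ_of_mem (by simp [hm]), carryPos_succ_of_mem hm, ih]
    · have : q ∉ insert p C := by simp [hm]; omega
      have hle := carryPos_le C p
      rw [carryPos_succ_of_notMem this, carryPos_succ_of_notMem hm,
        swap_apply_of_ne_of_ne (by omega) (by omega)]

lemma carryPos_insert_le {C : Finset ℕ} {p q : ℕ} (hq : q ≤ p) :
    carryPos (insert p C) q = carryPos C q := carryPos_congr fun m hm => by simp; omega

lemma carryPos_erase_le {C : Finset ℕ} {p q : ℕ} (hq : q ≤ p) :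
    carryPos (C.erase p) q = carryPos C q := carryPos_congr fun m hm => by simp; omega

lemma rowPerm_apply_eq_iff {C : Finset ℕ} {k q : ℕ} : rowPerm C k = q ↔ k = rowInv C q := by
  rw [← rowPerm_inv_apply, Perm.eq_inv_iff_eq]

/-- Adding a crossing exchanges the two strands which pass the place. -/
lemma rowPerm_insert {C : Finset ℕ} {p : ℕ} (hp : p ∉ C) :
    rowPerm (insert p C) = rowPerm C * swap (carryPos C p) (p + 1) := by
  rw [← inv_inj, mul_inv_rev, swap_inv]
  ext q
  rw [Perm.mul_apply, rowPerm_inv_apply, rowPerm_inv_apply]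
  have hle := carryPos_le C p
  rcases lt_trichotomy q p with h | rfl | h
  · have h1 : rowInv (insert p C) q = rowInv C q := by
      simp [rowInv, h.ne, carryPos_insert_le h.le]
    have h2 : rowInv C q ≠ carryPos C p := by
      have : rowInv C p = carryPos C p := by simp [rowInv, hp]
      rw [← this, ← rowPerm_inv_apply, ← rowPerm_inv_apply]
      exact (rowPerm C)⁻¹.injective.ne h.ne
    have h3 : rowInv C q < p + 1 := by
      have := carryPos_le C q
      unfold rowInv
      split_ifs <;> omega
    rw [h1, swap_apply_of_ne_of_ne h2 h3.ne]
  · simp [rowInv, hp]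
  · unfold rowInv
    by_cases hm : q ∈ C
    · rw [if_pos (by simp [hm]), if_pos hm, swap_apply_of_ne_of_ne (by omega) (by omega)]
    · rw [if_neg (by simp [hm]; omega), if_neg hm, carryPos_insert hp h]

lemma rowPerm_erase {C : Finset ℕ} {p : ℕ} (hp : p ∈ C) :
    rowPerm (C.erase p) = rowPerm C * swap (carryPos C p) (p + 1) := by
  have := rowPerm_insert (Finset.notMem_erase p C)
  rw [Finset.insert_erase hp, carryPos_erase_le le_rfl] at this
  rw [this, mul_assoc, swap_mul_self, mul_one]

lemma isFinitary_rowPerm {C : Finset ℕ} (hC : 0 ∉ C) : IsFinitary (rowPerm C) := by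
  refine isFinitary_wordPerm fun i hi => ?_
  rw [Finset.mem_sort] at hi
  exact Nat.one_le_iff_ne_zero.2 fun h => hC (h ▸ hi)

/-- Along a row, the strand from the left may cross at each crossing only a larger strand: the
condition for a row of crossings above a reduced graph with permutation `u` to be reduced. -/
def GoodRow (u : Perm ℕ) (C : Finset ℕ) : Prop := ∀ p ∈ C, u⁻¹ (carryPos C p) < u⁻¹ (p + 1)

lemma mul_inv_at {C : Finset ℕ} {u : Perm ℕ} (q : ℕ) :
    (rowPerm C * u)⁻¹ q = u⁻¹ (rowInv C q) := by
  rw [mul_inv_rev, Perm.mul_apply, rowPerm_inv_apply]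

lemma len_rowPerm_mul {u : Perm ℕ} (hu : IsFinitary u) {C : Finset ℕ} (hC : 0 ∉ C) :
    len (rowPerm C * u) ≤ len u + C.card ∧
      (len (rowPerm C * u) = len u + C.card ↔ GoodRow u C) := by
  induction C using Finset.induction_on_max with
  | empty => simp [rowPerm_empty, GoodRow]
  | insert p C hp ih =>
    have hC' : 0 ∉ C := fun h => hC (by simp [h])
    have hp1 : 1 ≤ p := Nat.one_le_iff_ne_zero.2 fun h => hC (by simp [h])
    obtain ⟨ih1, ih2⟩ := ih hC'
    have hpC : p ∉ C := fun h => lt_irrefl _ (hp p h)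
    have hf := (isFinitary_rowPerm hC').mul hu
    rw [rowPerm_insert_max hp, mul_assoc, Finset.card_insert_of_notMem hpC]
    have e1 : (rowPerm C * u)⁻¹ p = u⁻¹ (carryPos C p) := by
      rw [mul_inv_at]; simp [rowInv, hpC]
    have e2 : (rowPerm C * u)⁻¹ (p + 1) = u⁻¹ (p + 1) := by
      have h1 : p + 1 ∉ C := fun hm => by have := hp _ hm; omega
      rw [mul_inv_at]; simp [rowInv, h1, carryPos_succ_of_notMem hpC]
    have hg : GoodRow u (insert p C) ↔ GoodRow u C ∧ u⁻¹ (carryPos C p) < u⁻¹ (p + 1) := by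
      constructor
      · intro h
        refine ⟨fun q hq => ?_, ?_⟩
        · have := h q (by simp [hq])
          rwa [carryPos_insert_le (hp q hq).le] at this
        · have := h p (by simp)
          rwa [carryPos_insert_le le_rfl] at this
      · rintro ⟨h1, h2⟩ q hq
        rcases Finset.mem_insert.1 hq with rfl | hq
        · rwa [carryPos_insert_le le_rfl]
        · rw [carryPos_insert_le (hp q hq).le]
          exact h1 q hq
    have hne : (rowPerm C * u)⁻¹ p ≠ (rowPerm C * u)⁻¹ (p + 1) :=
      (rowPerm C * u)⁻¹.injective.ne (by omega)
    rcases lt_or_gt_of_ne hne with h | h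
    · have hl := len_simple_mul hf hp1 h
      rw [e1, e2] at h
      rw [hl, hg]
      refine ⟨by omega, ?_⟩
      rw [← ih2]
      constructor
      · intro hh; exact ⟨by omega, h⟩
      · intro hh; omega
    · have hl := len_simple_mul' hf hp1 h
      rw [e1, e2] at h
      rw [hg]
      refine ⟨by omega, ?_⟩
      constructor
      · intro hh; omega
      · rintro ⟨-, hh⟩; omega

lemma GoodRow.len_eq {u : Perm ℕ} {C : Finset ℕ} (h : GoodRow u C) (hu : IsFinitary u)
    (hC : 0 ∉ C) : len (rowPerm C * u) = len u + C.card := (len_rowPerm_mul hu hC).2.2 h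

/-- Two strands which are exchanged by a row cross in this row. -/
lemma crossing_of_exchanged {C : Finset ℕ} {k m : ℕ} (hkm : k < m)
    (h : rowPerm C m < rowPerm C k) :
    rowPerm C m + 1 = m ∧ rowPerm C m ∈ C ∧ carryPos C (rowPerm C m) = k := by
  set q1 := rowPerm C k with hq1
  set q2 := rowPerm C m with hq2
  have h1 : k = rowInv C q1 := rowPerm_apply_eq_iff.1 hq1.symm
  have h2 : m = rowInv C q2 := rowPerm_apply_eq_iff.1 hq2.symm
  have l2 := carryPos_le C q2
  unfold rowInv at h1 h2
  have h1' : q1 ∉ C ∧ carryPos C q1 = k := by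
    by_cases hm : q1 ∈ C
    · rw [if_pos hm] at h1
      split_ifs at h2 <;> omega
    · rw [if_neg hm] at h1
      exact ⟨hm, h1.symm⟩
  by_cases hm : q2 ∈ C
  · rw [if_pos hm] at h2
    refine ⟨h2.symm, hm, ?_⟩
    have := (carryPos_spec (C := C) (q := q1) (p := q2) (by omega) h.le).1
    omega
  · rw [if_neg hm] at h2
    have := (carryPos_spec (C := C) (q := q1) (p := q2) (by omega) h.le).2 h
    exact absurd this hm

lemma rowPerm_of_mem {C : Finset ℕ} {p : ℕ} (h : p ∈ C) : rowPerm C (p + 1) = p := by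
  rw [rowPerm_apply_eq_iff, rowInv, if_pos h]

lemma rowPerm_carryPos {C : Finset ℕ} {p : ℕ} (h : p ∉ C) : rowPerm C (carryPos C p) = p := by
  rw [rowPerm_apply_eq_iff, rowInv, if_neg h]

/-- A strand either jumps one position to the left or moves weakly to the right. -/
lemma rowPerm_cases (C : Finset ℕ) (k : ℕ) :
    (rowPerm C k ∈ C ∧ rowPerm C k + 1 = k) ∨
      (rowPerm C k ∉ C ∧ k ≤ rowPerm C k ∧ carryPos C (rowPerm C k) = k) := by
  have h : k = rowInv C (rowPerm C k) := rowPerm_apply_eq_iff.1 rfl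
  have := carryPos_le C (rowPerm C k)
  by_cases hm : rowPerm C k ∈ C
  · rw [rowInv, if_pos hm] at h
    exact Or.inl ⟨hm, h.symm⟩
  · rw [rowInv, if_neg hm] at h
    exact Or.inr ⟨hm, by omega, h.symm⟩

lemma le_rowPerm_add_one (C : Finset ℕ) (k : ℕ) : k ≤ rowPerm C k + 1 := by
  rcases rowPerm_cases C k with h | h <;> omega

lemma perm_apply_inv (u : Perm ℕ) (k : ℕ) : u (u⁻¹ k) = k := by simp

lemma lt_rowPerm_carryPos {C : Finset ℕ} {p : ℕ} (hp : p ∈ C) :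
    p < rowPerm C (carryPos C p) := by
  have hle := carryPos_le C p
  rcases rowPerm_cases C (carryPos C p) with ⟨h1, h2⟩ | ⟨h1, h2, h3⟩
  · have h4 := (carryPos_spec (C := C) (q := p) (p := carryPos C p) le_rfl hle).1
    have h5 := carryPos_le C (rowPerm C (carryPos C p))
    have h6 := carryPos_succ_of_mem h1
    rw [h2] at h6
    omega
  · by_contra hcon
    rcases Nat.eq_or_lt_of_le (not_lt.1 hcon) with h | h
    · exact h1 (by rw [h]; exact hp)
    · exact h1 ((carryPos_spec (C := C) (q := p) h2 h.le).2 h)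

/-- A strand crosses every strand which it passes over. -/
lemma rowPerm_lt_of_le {C : Finset ℕ} {k m : ℕ} (h1 : k < m) (h2 : m ≤ rowPerm C k) :
    rowPerm C m < rowPerm C k ∧ rowPerm C m + 1 = m := by
  rcases rowPerm_cases C k with ⟨h3, h4⟩ | ⟨h3, h4, h5⟩
  · omega
  · have h6 := (carryPos_spec (C := C) (q := rowPerm C k) (p := m - 1) (by omega) (by omega)).2
      (by omega)
    have h7 := rowPerm_of_mem h6
    rw [Nat.sub_add_cancel (by omega)] at h7
    omega

lemma rowPerm_lt_of_between {C : Finset ℕ} {k m n : ℕ} (h1 : k < m) (h2 : m < n)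
    (h3 : rowPerm C n < rowPerm C k) : rowPerm C m < rowPerm C k := by
  have h4 := crossing_of_exchanged (h1.trans h2) h3
  exact (rowPerm_lt_of_le h1 (by omega)).1

/-- A row is good if and only if whenever two strands cross in it, the one coming from the left is
the smaller one. -/
lemma goodRow_iff {u : Perm ℕ} {C : Finset ℕ} :
    GoodRow u C ↔ ∀ s t, u s < u t → rowPerm C (u t) < rowPerm C (u s) → s < t := by
  constructor
  · intro h s t h1 h2
    obtain ⟨h3, h4, h5⟩ := crossing_of_exchanged h1 h2
    have := h _ h4
    rw [h3, h5] at this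
    simpa using this
  · intro h p hp
    apply h
    · simp only [perm_apply_inv]
      have := carryPos_le C p
      omega
    · simp only [perm_apply_inv]
      rw [rowPerm_of_mem hp]
      exact lt_rowPerm_carryPos hp

lemma mul_swap_apply_left (u : Perm ℕ) (a b : ℕ) : (u * swap a b) a = u b := by simp

lemma mul_swap_apply_right (u : Perm ℕ) (a b : ℕ) : (u * swap a b) b = u a := by simp

lemma mul_swap_apply_other (u : Perm ℕ) {a b s : ℕ} (ha : s ≠ a) (hb : s ≠ b) :
    (u * swap a b) s = u s := by
  rw [Perm.mul_apply, swap_apply_of_ne_of_ne ha hb]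

/-- If the exchange of `a` and `b` below a row lengthens the permutation above the row, then the row
stays good. -/
lemma GoodRow.mul_swap {u : Perm ℕ} {C : Finset ℕ} {a b : ℕ} (hg : GoodRow u C)
    (hc : Cover u a b) (h : rowPerm C (u a) < rowPerm C (u b)) :
    GoodRow (u * swap a b) C := by
  rw [goodRow_iff] at hg ⊢
  obtain ⟨hab, huab, hno⟩ := hc
  intro s t h1 h2
  rcases eq_or_ne s a with rfl | hsa
  · rw [mul_swap_apply_left] at h1 h2
    rcases eq_or_ne t b with rfl | htb
    · exact hab
    rcases eq_or_ne t s with rfl | hts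
    · simp at h1
    rw [mul_swap_apply_other u hts htb] at h1 h2
    have := hg _ _ h1 h2
    omega
  rcases eq_or_ne s b with rfl | hsb
  · rw [mul_swap_apply_right] at h1 h2
    rcases eq_or_ne t a with rfl | hta
    · rw [mul_swap_apply_left] at h1 h2; omega
    rcases eq_or_ne t s with rfl | hts
    · simp at h1
    rw [mul_swap_apply_other u hta hts] at h1 h2
    have hlt := hg _ _ h1 h2
    rcases lt_or_gt_of_ne (u.injective.ne hts) with h3 | h3
    · by_contra hcon
      exact hno t hlt (by omega) ⟨h1, h3⟩
    · have := rowPerm_lt_of_between huab h3 h2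
      omega
  rw [mul_swap_apply_other u hsa hsb] at h1 h2
  rcases eq_or_ne t a with rfl | hta
  · rw [mul_swap_apply_left] at h1 h2
    have hlt := hg _ _ h1 h2
    rcases lt_or_gt_of_ne (u.injective.ne hsa) with h3 | h3
    · exact hg _ _ h3 (rowPerm_lt_of_between h3 huab h2)
    · by_contra hcon
      exact hno s (by omega) hlt ⟨h3, h1⟩
  rcases eq_or_ne t b with rfl | htb
  · rw [mul_swap_apply_right] at h1 h2
    have := hg _ _ h1 h2
    omega
  rw [mul_swap_apply_other u hta htb] at h1 h2
  exact hg _ _ h1 h2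

/-- If the exchange of `a` and `b` below a row shortens the permutation above the row, then `a`
crosses `b` in the row, and removing this crossing compensates the exchange. -/
lemma GoodRow.erase_crossing {u : Perm ℕ} {C : Finset ℕ} {a b : ℕ} (hg : GoodRow u C)
    (hc : Cover u a b) (h : rowPerm C (u b) < rowPerm C (u a)) :
    ∃ j ∈ C, u b = j + 1 ∧ carryPos C j = u a ∧ rowPerm C (u b) = j ∧
      rowPerm (C.erase j) * (u * swap a b) = rowPerm C * u ∧
      GoodRow (u * swap a b) (C.erase j) := by
  obtain ⟨hab, huab, hno⟩ := hc
  obtain ⟨h1, h2, h3⟩ := crossing_of_exchanged huab h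
  have hperm : rowPerm (C.erase (rowPerm C (u b))) * (u * swap a b) = rowPerm C * u := by
    have : swap (u a) (u b) * u = u * swap a b := by
      rw [swap_apply_apply]; simp [mul_assoc]
    rw [rowPerm_erase h2, h3, h1, ← this, mul_assoc, ← mul_assoc (swap _ _) (swap _ _) u,
      swap_mul_self, one_mul]
  refine ⟨rowPerm C (u b), h2, h1.symm, h3, rfl, hperm, ?_⟩
  rw [goodRow_iff] at hg ⊢
  have hY : ∀ s, rowPerm (C.erase (rowPerm C (u b))) ((u * swap a b) s) = rowPerm C (u s) :=
    fun s => by rw [← Perm.mul_apply, hperm, Perm.mul_apply]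
  intro s t h4 h5
  rw [hY, hY] at h5
  rcases eq_or_ne s b with rfl | hsb
  · rw [mul_swap_apply_right] at h4
    rcases eq_or_ne t a with rfl | hta
    · omega
    rcases eq_or_ne t s with rfl | hts
    · omega
    rw [mul_swap_apply_other u hta hts] at h4
    rcases lt_or_gt_of_ne (u.injective.ne hts) with h6 | h6
    · have h7 := hg a t h4 (by omega)
      by_contra hcon
      exact hno t h7 (by omega) ⟨h4, h6⟩
    · exact hg _ _ h6 h5
  rcases eq_or_ne t a with rfl | hta
  · rw [mul_swap_apply_left] at h4
    rcases eq_or_ne s t with rfl | hst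
    · omega
    rw [mul_swap_apply_other u hst hsb] at h4
    rcases lt_or_gt_of_ne (u.injective.ne hst) with h6 | h6
    · exact hg _ _ h6 h5
    · have := rowPerm_lt_of_between h6 h4 h
      omega
  rcases eq_or_ne t b with rfl | htb
  · rw [mul_swap_apply_right] at h4
    rcases eq_or_ne s a with rfl | hsa
    · exact hab
    rw [mul_swap_apply_other u hsa hsb] at h4
    exact hg _ _ (h4.trans huab) h5
  rw [mul_swap_apply_other u hta htb] at h4
  rcases eq_or_ne s a with rfl | hsa
  · rw [mul_swap_apply_left] at h4
    exact hg _ _ (huab.trans h4) h5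
  rw [mul_swap_apply_other u hsa hsb] at h4
  exact hg _ _ h4 h5

/-- A crossing may be added at every free place at which the strand from the left is the smaller
one. -/
lemma GoodRow.insert_place {u : Perm ℕ} {C : Finset ℕ} {p : ℕ} (hg : GoodRow u C)
    (hu : IsFinitary u) (hC : 0 ∉ C) (hp : p ∉ C) (hp1 : 1 ≤ p)
    (hlt : u⁻¹ (carryPos C p) < u⁻¹ (p + 1)) :
    GoodRow u (insert p C) ∧
      rowPerm (insert p C) * u = rowPerm C * u * swap (u⁻¹ (carryPos C p)) (u⁻¹ (p + 1)) ∧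
      Cover (rowPerm C * u) (u⁻¹ (carryPos C p)) (u⁻¹ (p + 1)) := by
  set c := u⁻¹ (carryPos C p) with hc
  set d := u⁻¹ (p + 1) with hd
  have hperm : rowPerm (insert p C) * u = rowPerm C * u * swap c d := by
    rw [rowPerm_insert hp, mul_assoc, mul_assoc, hc, hd, swap_apply_apply]
    congr 1
    simp [mul_assoc]
  have hC' : 0 ∉ insert p C := by simp [hC]; omega
  have hc1 : 1 ≤ c := by
    by_contra hcon
    have : c = 0 := by omega
    have h0 := hu.apply_zero
    rw [← this, hc, perm_apply_inv] at h0
    have := one_le_carryPos hC hp1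
    omega
  have hf := (isFinitary_rowPerm hC).mul hu
  have e1 : rowPerm C (u c) = p := by rw [hc, perm_apply_inv, rowPerm_carryPos hp]
  have e2 : p < rowPerm C (u d) := by
    have h1 : rowPerm C (u d) ≠ p := by
      rw [← e1]
      exact (rowPerm C).injective.ne (u.injective.ne hlt.ne')
    have h2 := le_rowPerm_add_one C (u d)
    rw [hd, perm_apply_inv] at h1 h2 ⊢
    omega
  have h1 := lt_len_mul_swap hf hc1 hlt (by rw [Perm.mul_apply, Perm.mul_apply, e1]; exact e2)
  rw [← hperm] at h1
  obtain ⟨h2, h3⟩ := len_rowPerm_mul hu hC'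
  rw [Finset.card_insert_of_notMem hp] at h2 h3
  have h4 := hg.len_eq hu hC
  refine ⟨h3.1 (by omega), hperm, ?_⟩
  rw [cover_iff hf hc1 hlt, ← hperm]
  omega

/-- `p` is the label of a free place of the row which is passed by a strand `≤ r` from the left and
a strand `> r` from below. -/
def IsAllowed (r : ℕ) (u : Perm ℕ) (C : Finset ℕ) (p : ℕ) : Prop :=
  p ∉ C ∧ u⁻¹ (carryPos C p) ≤ r ∧ r < u⁻¹ (p + 1)

/-- `p` is the label of a free place of the row which is passed by `g` from the left and a strand
`> r` from below. -/
def IsAllowedSecond (r : ℕ) (u : Perm ℕ) (C : Finset ℕ) (g p : ℕ) : Prop :=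
  p ∉ C ∧ u⁻¹ (carryPos C p) = g ∧ r < u⁻¹ (p + 1)

lemma IsAllowedSecond.rowPerm_eq {r : ℕ} {u : Perm ℕ} {C : Finset ℕ} {g p : ℕ}
    (h : IsAllowedSecond r u C g p) : rowPerm C (u g) = p := by
  rw [← h.2.1, perm_apply_inv, rowPerm_carryPos h.1]

lemma exists_isAllowed {r : ℕ} {u : Perm ℕ} {C : Finset ℕ} {m n : ℕ} (hmn : m ≤ n)
    (hm : u⁻¹ (carryPos C m) ≤ r) (hn : r < u⁻¹ (carryPos C n)) :
    ∃ p, m ≤ p ∧ p < n ∧ IsAllowed r u C p := by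
  induction n, hmn using Nat.le_induction with
  | base => omega
  | succ n hmn ih =>
    by_cases h : r < u⁻¹ (carryPos C n)
    · obtain ⟨p, h1, h2, h3⟩ := ih h
      exact ⟨p, h1, by omega, h3⟩
    · have hnC : n ∉ C := fun hm => by
        rw [carryPos_succ_of_mem hm] at hn
        exact h hn
      rw [carryPos_succ_of_notMem hnC] at hn
      exact ⟨n, hmn, by omega, hnC, by omega, hn⟩

lemma exists_rightmost {P : ℕ → Prop} {j p : ℕ} (hp : p < j) (h : P p) :
    ∃ q, p ≤ q ∧ q < j ∧ P q ∧ ∀ k, q < k → k < j → ¬ P k := by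
  induction hn : j - p using Nat.strong_induction_on generalizing p with
  | _ n ih =>
    by_cases hex : ∃ k, p < k ∧ k < j ∧ P k
    · obtain ⟨k, h1, h2, h3⟩ := hex
      obtain ⟨q, h4, h5, h6, h7⟩ := ih (j - k) (by omega) h2 h3 rfl
      exact ⟨q, by omega, h5, h6, h7⟩
    · exact ⟨p, le_rfl, hp, h, fun k h1 h2 h3 => hex ⟨k, h1, h2, h3⟩⟩

lemma carry_small_of_small {r : ℕ} {u : Perm ℕ} {C : Finset ℕ} (hg : GoodRow u C) {k : ℕ}
    (hk : u⁻¹ k ≤ r) : u⁻¹ (carryPos C k) ≤ r := by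
  cases k with
  | zero => simpa [carryPos] using hk
  | succ k =>
    by_cases hm : k ∈ C
    · rw [carryPos_succ_of_mem hm]
      have := hg k hm
      omega
    · rwa [carryPos_succ_of_notMem hm]

/-- If no place strictly between `p` and `e` is allowed and the strand entering `e` from the left
is big, then all strands entering the row between `p` and `e` are big. -/
lemma big_of_not_isAllowed {r : ℕ} {u : Perm ℕ} {C : Finset ℕ} (hg : GoodRow u C) {p e : ℕ}
    (hno : ∀ k, p < k → k < e → ¬ IsAllowed r u C k)
    (he : r < u⁻¹ (carryPos C e)) {k : ℕ} (h1 : p < k) (h2 : k ≤ e) : r < u⁻¹ k := by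
  by_contra hcon
  have hs := carry_small_of_small hg (not_lt.1 hcon)
  obtain ⟨p', h3, h4, h5⟩ := exists_isAllowed h2 hs he
  exact hno p' (by omega) h4 h5

/-- The rightmost allowed place to the left of a free place `j` at which a big strand, coming from
position `e`, arrives from the left. -/
lemma exists_rightmost_isAllowed {r : ℕ} {u : Perm ℕ} {C : Finset ℕ} (hu : IsFinitary u)
    (hg : GoodRow u C) {j e : ℕ} (he : carryPos C j = e) (hbig : r < u⁻¹ e) :
    ∃ p, p < e ∧ IsAllowed r u C p ∧ (∀ k, p < k → k < j → ¬ IsAllowed r u C k) ∧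
      ∀ k, p < k → k ≤ e → r < u⁻¹ k := by
  have h0 : u⁻¹ (carryPos C 0) ≤ r := by
    have : u⁻¹ 0 = 0 := hu.inv.apply_zero
    simp [carryPos, this]
  obtain ⟨p0, -, h1, h2⟩ := exists_isAllowed (Nat.zero_le j) h0 (by rw [he]; exact hbig)
  obtain ⟨p, -, h3, h4, h5⟩ := exists_rightmost h1 h2
  have hpe : p < e := by
    by_contra hcon
    exact h4.1 ((carryPos_spec (C := C) (q := j) (by omega) h3.le).2 h3)
  have hej : e ≤ j := he ▸ carryPos_le C j
  have hce : carryPos C e = e := by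
    rw [(carryPos_spec (C := C) (q := j) (p := e) he.le hej).1, he]
  refine ⟨p, hpe, h4, h5, fun k h6 h7 => ?_⟩
  exact big_of_not_isAllowed hg (e := e) (fun k h8 h9 => h5 k h8 (by omega))
    (by rw [hce]; exact hbig) h6 h7

/-! ### Bruhat chains above a row -/

/-- The product of the transpositions in a list of pairs. -/
def chainProd (L : List (ℕ × ℕ)) : Perm ℕ := (L.map fun p => swap p.1 p.2).prod

@[simp] lemma chainProd_nil : chainProd [] = 1 := rfl

@[simp] lemma chainProd_append (L M : List (ℕ × ℕ)) :
    chainProd (L ++ M) = chainProd L * chainProd M := by simp [chainProd]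

@[simp] lemma chainProd_cons (p : ℕ × ℕ) (L : List (ℕ × ℕ)) :
    chainProd (p :: L) = swap p.1 p.2 * chainProd L := by simp [chainProd]

/-- `L` is an `r`-Bruhat chain starting at `w`: every pair `(a, b)` satisfies `a ≤ r < b` and gives
a cover. -/
def CoverChain (r : ℕ) (w : Perm ℕ) (L : List (ℕ × ℕ)) : Prop :=
  ∀ L₁ a b L₂, L = L₁ ++ (a, b) :: L₂ → 1 ≤ a ∧ a ≤ r ∧ r < b ∧ Cover (w * chainProd L₁) a b

/-- The entries of `E(w, T)`: the positions to which the big strands of the chain move. -/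
def chainEntries (w : Perm ℕ) : List (ℕ × ℕ) → List ℕ
  | [] => []
  | p :: L => w p.1 :: chainEntries (w * swap p.1 p.2) L

lemma chainEntries_append (w : Perm ℕ) (L M : List (ℕ × ℕ)) :
    chainEntries w (L ++ M) = chainEntries w L ++ chainEntries (w * chainProd L) M := by
  induction L generalizing w with
  | nil => simp [chainEntries]
  | cons p L ih => simp [chainEntries, ih, mul_assoc]

@[simp] lemma length_chainEntries (w : Perm ℕ) (L : List (ℕ × ℕ)) :
    (chainEntries w L).length = L.length := by
  induction L generalizing w with
  | nil => rfl
  | cons p L ih => simp [chainEntries, ih]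

lemma chainEntries_concat (w : Perm ℕ) (L : List (ℕ × ℕ)) (a b : ℕ) :
    chainEntries w (L ++ [(a, b)]) = chainEntries w L ++ [(w * chainProd L) a] := by
  simp [chainEntries_append, chainEntries]

lemma coverChain_nil (r : ℕ) (w : Perm ℕ) : CoverChain r w [] := by
  intro L₁ a b L₂ h
  simp at h

lemma CoverChain.concat {r : ℕ} {w : Perm ℕ} {L : List (ℕ × ℕ)} (h : CoverChain r w L) {a b : ℕ}
    (ha : 1 ≤ a) (har : a ≤ r) (hb : r < b) (hc : Cover (w * chainProd L) a b) :
    CoverChain r w (L ++ [(a, b)]) := by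
  intro L₁ a' b' L₂ he
  rcases List.eq_nil_or_concat L₂ with rfl | ⟨L₃, x, rfl⟩
  · have := List.append_inj' he rfl
    simp only [List.cons.injEq, Prod.mk.injEq, and_true] at this
    obtain ⟨rfl, rfl, rfl⟩ := this
    exact ⟨ha, har, hb, hc⟩
  · rw [List.concat_eq_append, ← List.cons_append, ← List.append_assoc] at he
    have := (List.append_inj' he rfl).1
    exact h _ _ _ _ this

lemma CoverChain.of_append {r : ℕ} {w : Perm ℕ} {L M : List (ℕ × ℕ)}
    (h : CoverChain r w (L ++ M)) : CoverChain r w L := by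
  intro L₁ a b L₂ he
  exact h L₁ a b (L₂ ++ M) (by simp [he])

lemma CoverChain.last {r : ℕ} {w : Perm ℕ} {L : List (ℕ × ℕ)} {a b : ℕ}
    (h : CoverChain r w (L ++ [(a, b)])) :
    1 ≤ a ∧ a ≤ r ∧ r < b ∧ Cover (w * chainProd L) a b := h L a b [] rfl

lemma CoverChain.isFinitary {r : ℕ} {w : Perm ℕ} {L : List (ℕ × ℕ)} (h : CoverChain r w L)
    (hw : IsFinitary w) : IsFinitary (w * chainProd L) := by
  induction L using List.reverseRecOn with
  | nil => simpa
  | append_singleton L p ih =>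
    obtain ⟨a, b⟩ := p
    obtain ⟨h1, h2, h3, h4⟩ := h.last
    have := (ih h.of_append).mul (isFinitary_swap h1 h4.1)
    simpa [mul_assoc] using this

/-- The data of the top row `l` during the algorithm: below it stands a graph with permutation `u`,
`C` is the set of labels of the crossings in the row, and `L` is a chain from `w` to the permutation
of the whole graph. -/
structure RowState (r l : ℕ) (w u : Perm ℕ) (C : Finset ℕ) (L : List (ℕ × ℕ)) : Prop where
  one_le : 1 ≤ l
  le : l ≤ r
  fix : ∀ k ≤ l, u k = k
  labels : ∀ p ∈ C, l ≤ p
  fin : IsFinitary u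
  finW : IsFinitary w
  good : GoodRow u C
  chain : CoverChain r w L
  eq : w * chainProd L = rowPerm C * u

lemma RowState.zero {r l : ℕ} {w u : Perm ℕ} {C : Finset ℕ} {L : List (ℕ × ℕ)}
    (P : RowState r l w u C L) : 0 ∉ C := fun h => by
  have := P.labels 0 h
  have := P.one_le
  omega

lemma RowState.value {r l : ℕ} {w u : Perm ℕ} {C : Finset ℕ} {L : List (ℕ × ℕ)}
    (P : RowState r l w u C L) (s : ℕ) : (w * chainProd L) s = rowPerm C (u s) := by
  rw [P.eq, Perm.mul_apply]

/-- The last entry of `E` is the present position of the last big strand. -/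
lemma RowState.last_value {r l : ℕ} {w u : Perm ℕ} {C : Finset ℕ} {L : List (ℕ × ℕ)} {a b : ℕ}
    (P : RowState r l w u C (L ++ [(a, b)])) : (w * chainProd L) a = rowPerm C (u b) := by
  rw [← P.value b]
  simp

lemma le_of_inv_gt {r l : ℕ} {u : Perm ℕ} (hl : l ≤ r) (hfix : ∀ k ≤ l, u k = k) {p : ℕ}
    (h : r < u⁻¹ (p + 1)) : l ≤ p := by
  by_contra hcon
  have h1 := hfix (p + 1) (by omega)
  have : u⁻¹ (p + 1) = p + 1 := by rw [Perm.inv_eq_iff_eq, h1]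
  omega

/-- Adding a crossing at an allowed place prolongs the chain. -/
lemma RowState.insert_place {r l : ℕ} {w u : Perm ℕ} {C : Finset ℕ} {L : List (ℕ × ℕ)}
    (P : RowState r l w u C L) {p : ℕ} (hp : IsAllowed r u C p) :
    RowState r l w u (insert p C) (L ++ [(u⁻¹ (carryPos C p), u⁻¹ (p + 1))]) ∧
      (w * chainProd L) (u⁻¹ (carryPos C p)) = p ∧
      rowPerm (insert p C) (u (u⁻¹ (p + 1))) = p := by
  obtain ⟨h1, h2, h3⟩ := hp
  have hlp := le_of_inv_gt P.le P.fix h3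
  have hl := P.one_le
  obtain ⟨h4, h5, h6⟩ := P.good.insert_place P.fin P.zero h1 (hl.trans hlp) (by omega)
  have hc : 1 ≤ u⁻¹ (carryPos C p) := by
    by_contra hcon
    have h0 := P.fin.apply_zero
    have h7 : u⁻¹ (carryPos C p) = 0 := by omega
    rw [← h7, perm_apply_inv] at h0
    have := one_le_carryPos P.zero (hl.trans hlp)
    omega
  refine ⟨⟨P.one_le, P.le, P.fix, ?_, P.fin, P.finW, h4, ?_, ?_⟩, ?_, ?_⟩
  · intro q hq
    rcases Finset.mem_insert.1 hq with rfl | hq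
    exacts [hlp, P.labels q hq]
  · exact P.chain.concat hc h2 h3 (by rw [P.eq]; exact h6)
  · rw [chainProd_append, ← mul_assoc, P.eq, h5]
    simp
  · rw [P.value, perm_apply_inv, rowPerm_carryPos h1]
  · rw [perm_apply_inv, rowPerm_of_mem (by simp)]

/-- The properties of the last box `(α, β)` of the chain which are needed for the next box to its
right; `qp` is the entry of `E` which the same box had in the row below. -/
structure RowInv (r : ℕ) (u : Perm ℕ) (C : Finset ℕ) (α β qp : ℕ) : Prop where
  pos : u β ≤ qp
  small : ∀ s ≤ r, qp < u s → rowPerm C (u β) < rowPerm C (u s)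
  cross : rowPerm C (u β) ∈ C → u⁻¹ (carryPos C (rowPerm C (u β))) ≤ r
  free_lt : rowPerm C (u β) ∉ C → rowPerm C (u β) < u α
  free_between : rowPerm C (u β) ∉ C → ∀ s, rowPerm C (u β) < u s → u s < u α → s < α ∨ β < s
  free_cross : rowPerm C (u β) ∉ C →
    ∀ s, u α < u s → rowPerm C (u s) < rowPerm C (u α) → β < s

/-- The properties of the last box `(α, β)` of the chain which are needed for the next box above it;
`qp` is the entry of `E` which the same box had in the row below. Small strands which are moved by
the row to the wrong side of `β` either are equal to `α`, or cannot be next in the lower chain. -/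
def ColInv (r : ℕ) (u : Perm ℕ) (C : Finset ℕ) (α β qp : ℕ) : Prop :=
  ((∀ s ≤ r, u s < qp → rowPerm C (u β) < rowPerm C (u s) → s = α) ∧
      u α < u β ∧ rowPerm C (u β) < rowPerm C (u α)) ∨
    (qp ≤ rowPerm C (u β) + 1 ∧
      ∀ s ≤ r, u s < qp → rowPerm C (u β) < rowPerm C (u s) →
        ∀ b, qp < u b → r < b → ¬ Cover u s b)

/-- The step in which the entry `(a, b)` of the lower chain is kept. -/
lemma RowState.keep {r l : ℕ} {w u : Perm ℕ} {C : Finset ℕ} {L : List (ℕ × ℕ)}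
    (P : RowState r l w u C L) {a b : ℕ} (ha : 1 ≤ a) (har : a ≤ r) (hb : r < b)
    (hc : Cover u a b) (hfix : ∀ k ≤ l, (u * swap a b) k = k)
    (h : rowPerm C (u a) < rowPerm C (u b)) :
    RowState r l w (u * swap a b) C (L ++ [(a, b)]) ∧
      RowInv r (u * swap a b) C a b (u a) ∧ ColInv r (u * swap a b) C a b (u a) := by
  have hg := P.good.mul_swap hc h
  have hfin := P.fin.mul (isFinitary_swap ha hc.1)
  have hcov : Cover (rowPerm C * u) a b := by
    rw [cover_iff ((isFinitary_rowPerm P.zero).mul P.fin) ha hc.1, mul_assoc,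
      hg.len_eq hfin P.zero, P.good.len_eq P.fin P.zero, hc.len_eq P.fin ha]
    omega
  have hgi := goodRow_iff.1 hg
  have hgu := goodRow_iff.1 P.good
  obtain ⟨hab, huab, hno⟩ := hc
  have e1 : (u * swap a b) b = u a := mul_swap_apply_right u a b
  have e2 : (u * swap a b) a = u b := mul_swap_apply_left u a b
  have e3 : ∀ {s}, s ≠ a → s ≠ b → (u * swap a b) s = u s := fun h1 h2 =>
    mul_swap_apply_other u h1 h2
  refine ⟨⟨P.one_le, P.le, hfix, P.labels, hfin, P.finW, hg, ?_, ?_⟩, ?_, ?_⟩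
  · exact P.chain.concat ha har hb (by rw [P.eq]; exact hcov)
  · rw [chainProd_append, ← mul_assoc, P.eq, ← mul_assoc]
    simp
  · set u' := u * swap a b with hu'
    refine ⟨e1.le, ?_, ?_, ?_, ?_, ?_⟩
    · intro s hs hus
      by_contra hcon
      have hne : s ≠ b := by omega
      have := hgi b s (by rw [e1]; exact hus) (lt_of_le_of_ne (not_lt.1 hcon)
        ((rowPerm C).injective.ne (u'.injective.ne hne)))
      omega
    · intro hq
      rw [e1] at hq ⊢
      rcases rowPerm_cases C (u a) with ⟨h1, h2⟩ | ⟨h1, h2, h3⟩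
      · have h4 := P.good _ hq
        rw [h2] at h4
        have h5 : u⁻¹ (u a) = a := by simp
        rw [h5] at h4
        rw [hu', mul_inv_rev, swap_inv, Perm.mul_apply,
          swap_apply_of_ne_of_ne (by omega) (by omega)]
        omega
      · exact absurd hq h1
    · intro hq
      rw [e1] at hq ⊢
      rw [e2]
      by_contra hcon
      have := (rowPerm_lt_of_le huab (not_lt.1 hcon)).1
      omega
    · intro hq s h1 h2
      rw [e1] at hq h1
      rw [e2] at h2
      rcases rowPerm_cases C (u a) with ⟨h3, h4⟩ | ⟨h3, h4, h5⟩
      · exact absurd h3 hq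
      · have hsa : s ≠ a := by rintro rfl; rw [e2] at h2; omega
        have hsb : s ≠ b := by rintro rfl; rw [e1] at h1; omega
        rw [e3 hsa hsb] at h1 h2
        by_contra hcon
        exact hno s (by omega) (by omega) ⟨by omega, h2⟩
    · intro hq s h1 h2
      rw [e2] at h1 h2
      have hsa : s ≠ a := by rintro rfl; rw [e2] at h2; omega
      have hsb : s ≠ b := by rintro rfl; rw [e1] at h1; omega
      rw [e3 hsa hsb] at h1 h2
      exact hgu b s h1 h2
  · refine Or.inr ⟨by rw [e1]; exact le_rowPerm_add_one C _, ?_⟩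
    intro s hs h1 h2 b2 h3 hb2 h4
    have hsa : s ≠ a := by rintro rfl; rw [e2] at h1; omega
    have hsb : s ≠ b := by omega
    rw [e3 hsa hsb] at h1 h2
    rw [e1] at h2
    have h5 := hgu s a h1 h2
    obtain ⟨h6, h7, h8⟩ := h4
    have hb2a : b2 ≠ a := by omega
    have hb2b : b2 ≠ b := by rintro rfl; rw [e1] at h3; omega
    have h9 : u b2 < u b := by
      by_contra hcon
      have : u b ≠ u b2 := u.injective.ne hb2b.symm
      refine h8 a h5 (by omega) ⟨?_, ?_⟩
      · rw [e2, e3 hsa hsb]; omega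
      · rw [e2, e3 hb2a hb2b]; omega
    rw [e3 hb2a hb2b] at h3
    by_cases h10 : b2 < b
    · exact hno b2 (by omega) h10 ⟨h3, h9⟩
    · refine h8 b (by omega) (by omega) ⟨?_, ?_⟩
      · rw [e1, e3 hsa hsb]; exact h1
      · rw [e1, e3 hb2a hb2b]; exact h3

/-- After the insertion of a crossing at an allowed place `p` such that all strands entering the row
right of `p`, up to `e`, are big. -/
lemma rowInv_insert {r : ℕ} {u : Perm ℕ} {C : Finset ℕ} {p e : ℕ} (hp : IsAllowed r u C p)
    (hpe : p < e) :
    RowInv r u (insert p C) (u⁻¹ (carryPos C p)) (u⁻¹ (p + 1)) e := by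
  have e0 : rowPerm (insert p C) (u (u⁻¹ (p + 1))) = p := by
    rw [perm_apply_inv, rowPerm_of_mem (by simp)]
  have hm : p ∈ insert p C := Finset.mem_insert_self _ _
  refine ⟨?_, ?_, ?_, ?_, ?_, ?_⟩
  · rw [perm_apply_inv]; exact hpe
  · intro s hs hus
    rw [e0]
    have := le_rowPerm_add_one (insert p C) (u s)
    omega
  · intro _
    rw [e0, carryPos_insert_le le_rfl]
    exact hp.2.1
  all_goals
    intro hq
    rw [e0] at hq
    exact absurd hm hq

lemma colInv_insert {r : ℕ} {u : Perm ℕ} {C : Finset ℕ} {p e qp : ℕ} (hqp : qp ≤ e + 1)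
    (hbig : ∀ k, p < k → k ≤ e → r < u⁻¹ k) :
    ColInv r u (insert p C) (u⁻¹ (carryPos C p)) (u⁻¹ (p + 1)) qp := by
  have e0 : rowPerm (insert p C) (u (u⁻¹ (p + 1))) = p := by
    rw [perm_apply_inv, rowPerm_of_mem (by simp)]
  have hm : p ∈ insert p C := Finset.mem_insert_self _ _
  have e1 : carryPos (insert p C) p = carryPos C p := carryPos_insert_le le_rfl
  refine Or.inl ⟨?_, ?_, ?_⟩
  · intro s hs h1 h2
    rw [e0] at h2
    have h3 : u s ≤ p := by
      by_contra hcon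
      have := hbig (u s) (by omega) (by omega)
      simp at this
      omega
    rcases rowPerm_cases (insert p C) (u s) with ⟨h4, h5⟩ | ⟨h4, h5, h6⟩
    · omega
    · have h7 := (carryPos_spec (C := insert p C) (q := rowPerm (insert p C) (u s)) (p := p)
        (by omega) h2.le).1
      rw [← e1, h7, h6]
      simp
  · rw [perm_apply_inv, perm_apply_inv]
    have := carryPos_le C p
    omega
  · rw [e0, perm_apply_inv, ← e1]
    exact lt_rowPerm_carryPos hm

/-! ### Rectification in a row -/

/-- The removal part of a rectification, in terms of labels: the crossing labelled `j` is removed,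
and the chain, without its last entry `(a, b)`, becomes `L₂`. -/
def RowRemoval (u : Perm ℕ) (C : Finset ℕ) (L : List (ℕ × ℕ)) (a b j : ℕ)
    (L₂ : List (ℕ × ℕ)) : Prop :=
  j ∈ C ∧ u⁻¹ (carryPos C j) = b ∧
    ((u⁻¹ (j + 1) = a ∧ L₂ = L) ∨
      ((∀ k ∈ C, u⁻¹ (carryPos C k) = b → u⁻¹ (k + 1) ≠ a) ∧
        ∃ L₀ f, L = L₀ ++ [(a, f)] ∧ u⁻¹ (j + 1) = f ∧ L₂ = L₀ ++ [(a, b)]))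

/-- The reinsertion part of a rectification, in terms of labels. -/
def RowReinsertion (r : ℕ) (u : Perm ℕ) (C : Finset ℕ) (L : List (ℕ × ℕ)) (j : ℕ) (C' : Finset ℕ)
    (L' : List (ℕ × ℕ)) : Prop :=
  ∃ p, p < j ∧
    (∀ k, p < k → k < j → ¬ IsAllowed r u C k ∧
      ∀ L₀ e g, L = L₀ ++ [(e, g)] → ¬ IsAllowedSecond r u C g k) ∧
    C' = insert p C ∧
    ((IsAllowed r u C p ∧ L' = L ++ [(u⁻¹ (carryPos C p), u⁻¹ (p + 1))]) ∨
      ∃ L₀ e g, L = L₀ ++ [(e, g)] ∧ IsAllowedSecond r u C g p ∧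
        L' = L₀ ++ [(e, u⁻¹ (p + 1)), (e, g)])

/-- A rectification, in terms of labels. -/
def RowRectification (r : ℕ) (u : Perm ℕ) (C : Finset ℕ) (L : List (ℕ × ℕ)) (a b : ℕ)
    (C' : Finset ℕ) (L' : List (ℕ × ℕ)) : Prop :=
  ∃ j L₂, RowRemoval u C L a b j L₂ ∧ RowReinsertion r u (C.erase j) L₂ j C' L'

lemma concat_inj {L₁ L₂ : List (ℕ × ℕ)} {p q : ℕ × ℕ} (h : L₁ ++ [p] = L₂ ++ [q]) :
    L₁ = L₂ ∧ p = q := by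
  have := List.append_inj' h rfl
  simpa using this

lemma inv_mul_swap_apply (u : Perm ℕ) (a b k : ℕ) :
    (u * swap a b)⁻¹ k = swap a b (u⁻¹ k) := by
  rw [mul_inv_rev, swap_inv, Perm.mul_apply]

/-- The state after the first kind of removal. -/
lemma RowState.remove {r l : ℕ} {w u : Perm ℕ} {C : Finset ℕ} {L : List (ℕ × ℕ)}
    (P : RowState r l w u C L) {a b : ℕ} (ha : 1 ≤ a)
    (hc : Cover u a b) (hfix : ∀ k ≤ l, (u * swap a b) k = k)
    (h : rowPerm C (u b) < rowPerm C (u a)) :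
    ∃ j ∈ C, u b = j + 1 ∧ carryPos C j = u a ∧ rowPerm C (u b) = j ∧
      RowRemoval (u * swap a b) C L a b j L ∧
      rowPerm (C.erase j) * (u * swap a b) = rowPerm C * u ∧
      RowState r l w (u * swap a b) (C.erase j) L := by
  obtain ⟨j, hj, h1, h2, h3, h4, h5⟩ := P.good.erase_crossing hc h
  refine ⟨j, hj, h1, h2, h3, ⟨hj, ?_, Or.inl ⟨?_, rfl⟩⟩, h4, ⟨P.one_le, P.le, hfix, ?_,
    P.fin.mul (isFinitary_swap ha hc.1), P.finW, h5, P.chain, ?_⟩⟩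
  · rw [inv_mul_swap_apply, h2]; simp
  · rw [inv_mul_swap_apply, ← h1]; simp
  · intro p hp
    exact P.labels p (Finset.mem_of_mem_erase hp)
  · rw [h4, P.eq]

/-- After a removal, a crossing is inserted at the rightmost allowed place of the first kind, if
there is no place of the second kind further to the right. -/
lemma RowState.reinsert {r l : ℕ} {w u : Perm ℕ} {C : Finset ℕ} {L : List (ℕ × ℕ)}
    (P : RowState r l w u C L) {j p e : ℕ} (hpj : p < j) (hpe : p < e) (hp : IsAllowed r u C p)
    (hno : ∀ k, p < k → k < j → ¬ IsAllowed r u C k)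
    (hno2 : ∀ L₀ α β, L = L₀ ++ [(α, β)] → ∀ k, p < k → k < j → ¬ IsAllowedSecond r u C β k)
    (hbig : ∀ k, p < k → k ≤ e → r < u⁻¹ k) :
    ∃ c d, d = u⁻¹ (p + 1) ∧ RowReinsertion r u C L j (insert p C) (L ++ [(c, d)]) ∧
      RowState r l w u (insert p C) (L ++ [(c, d)]) ∧
      (insert p C).card = C.card + 1 ∧
      chainEntries w (L ++ [(c, d)]) = chainEntries w L ++ [p] ∧
      rowPerm (insert p C) (u d) = p ∧
      RowInv r u (insert p C) c d e ∧ ColInv r u (insert p C) c d e := by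
  obtain ⟨h1, h2, h3⟩ := P.insert_place hp
  refine ⟨u⁻¹ (carryPos C p), u⁻¹ (p + 1), rfl, ⟨p, hpj, fun k hk1 hk2 => ⟨hno k hk1 hk2,
    fun L₀ α β hL => hno2 L₀ α β hL k hk1 hk2⟩, rfl, Or.inl ⟨hp, rfl⟩⟩, h1,
    Finset.card_insert_of_notMem hp.1, ?_, h3, rowInv_insert hp hpe, colInv_insert (by omega) hbig⟩
  rw [chainEntries_concat, h2]

/-- If two transpositions lengthen a permutation by two, and each of them lengthens it, then both
are covers. -/
lemma cover_cover_of_len {z : Perm ℕ} {a b c d : ℕ} (hz : IsFinitary z) (ha : 1 ≤ a) (hab : a < b)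
    (hc : 1 ≤ c) (hcd : c < d) (h1 : z a < z b) (h2 : (z * swap a b) c < (z * swap a b) d)
    (h3 : len (z * swap a b * swap c d) = len z + 2) :
    Cover z a b ∧ Cover (z * swap a b) c d := by
  have hz' := hz.mul (isFinitary_swap ha hab)
  have l1 := lt_len_mul_swap hz ha hab h1
  have l2 := lt_len_mul_swap hz' hc hcd h2
  rw [cover_iff hz ha hab, cover_iff hz' hc hcd]
  omega

/-- The outcome of a rectification which neither keeps the entry `(a, b)` nor removes and reinserts
crossings of the first kind: the crossing at the place of the last big strand `β`, which is
exchanged there with a larger big strand `d`. -/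
lemma RowState.reinsert_second {r l : ℕ} {w u : Perm ℕ} {C : Finset ℕ} {L₀ : List (ℕ × ℕ)}
    {a b α β qp j : ℕ} (P : RowState r l w u C (L₀ ++ [(α, β)])) (ha : 1 ≤ a) (har : a ≤ r)
    (hb : r < b) (I : RowInv r u C α β qp) (hc : Cover u a b) (hqp : qp < u a)
    (h : rowPerm C (u b) < rowPerm C (u a)) (hjb : u b = j + 1)
    (hcj : carryPos C j = u a)
    (hperm : rowPerm (C.erase j) * (u * swap a b) = rowPerm C * u)
    (P' : RowState r l w (u * swap a b) (C.erase j) (L₀ ++ [(α, β)]))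
    (hq : rowPerm C (u β) + 1 ≤ u a) (hqC : rowPerm C (u β) ∉ C)
    (hno : ∀ k, rowPerm C (u β) < k → k < j → ¬ IsAllowed r (u * swap a b) (C.erase j) k) :
    ∃ C' L₁ v, RowReinsertion r (u * swap a b) (C.erase j) (L₀ ++ [(α, β)]) j C'
        (L₁ ++ [(α, β)]) ∧
      RowState r l w (u * swap a b) C' (L₁ ++ [(α, β)]) ∧
      C'.card = (C.erase j).card + 1 ∧ L₁.length = L₀.length + 1 ∧
      chainEntries w (L₁ ++ [(α, β)]) = chainEntries w (L₀ ++ [(α, β)]) ++ [v] ∧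
      rowPerm C (u β) < v ∧ RowInv r (u * swap a b) C' α β (u a) ∧
      ∃ d, β < d ∧ (w * chainProd (L₁ ++ [(α, β)])) d < (w * chainProd (L₁ ++ [(α, β)])) β := by
  have hgu := goodRow_iff.1 P.good
  obtain ⟨hab, huab, hnob⟩ := hc
  set u' := u * swap a b with hu'
  set D := C.erase j with hD
  set q := rowPerm C (u β) with hqdef
  obtain ⟨hα1, hαr, hβr, hcov⟩ := P.chain.last
  have e1 : u' b = u a := mul_swap_apply_right u a b
  have e2 : u' a = u b := mul_swap_apply_left u a b
  have e3 : ∀ {s}, s ≠ a → s ≠ b → u' s = u s := fun h1 h2 => mul_swap_apply_other u h1 h2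
  have hY : ∀ s, rowPerm D (u' s) = rowPerm C (u s) := fun s => by
    rw [← Perm.mul_apply, hperm, Perm.mul_apply]
  have hgD := goodRow_iff.1 P'.good
  have hcle := carryPos_le C j
  -- the strand `β` is the carry at the place `q`
  have hcq : carryPos C q = u β := by
    rcases rowPerm_cases C (u β) with ⟨h1, h2⟩ | ⟨h1, h2, h3⟩
    exacts [absurd h1 hqC, h3]
  have hβq : u β ≤ q := hcq ▸ carryPos_le C q
  have hβb : β ≠ b := by rintro rfl; omega
  have hβa : β ≠ a := by omega
  have hαb : α ≠ b := by omega
  have hqj : q < j := by omega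
  have hqD : q ∉ D := fun hm => hqC (Finset.mem_of_mem_erase hm)
  have hcqD : carryPos D q = u β := by rw [← hcq]; exact carryPos_erase_le hqj.le
  have hinvβ : u'⁻¹ (carryPos D q) = β := by
    rw [hcqD, Perm.inv_eq_iff_eq, e3 hβa hβb]
  have hbige : r < u'⁻¹ (u a) := by rw [← e1]; simpa using hb
  -- all strands entering the row between `q` and `u a` are big
  have hcarry : carryPos D (u a) = u a := by
    rw [show carryPos D (u a) = carryPos C (u a) from carryPos_erase_le (by omega),
      (carryPos_spec (C := C) (q := j) (p := u a) hcj.le (by omega)).1, hcj]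
  have hbig1 : r < u'⁻¹ (q + 1) := by
    by_contra hcon
    have hs : u'⁻¹ (carryPos D (q + 1)) ≤ r := by
      rw [carryPos_succ_of_notMem hqD]; omega
    obtain ⟨p, h1, h2, h3⟩ := exists_isAllowed hq hs (by rw [hcarry]; exact hbige)
    exact hno p (by omega) (by omega) h3
  have hA2 : IsAllowedSecond r u' D β q := ⟨hqD, hinvβ, hbig1⟩
  set d := u'⁻¹ (q + 1) with hd
  have hud' : u' d = q + 1 := perm_apply_inv u' _
  have hqα := I.free_lt hqC
  have hbet := I.free_between hqC
  have hcr := I.free_cross hqC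
  have hαβ : α ≠ β := by omega
  have hαd : α ≠ d := by omega
  -- `b` is larger than `β`, as soon as `a` is not to the right of `α`
  have hβlt : u a ≤ u α → β < b := by
    intro hle
    rcases Nat.eq_or_lt_of_le hle with heq | hlt
    · have : a = α := u.injective heq
      subst this
      exact hcr b huab h
    · rcases lt_or_gt_of_ne (u.injective.ne hαb) with h1 | h1
      · exfalso
        have h2 := hbet a (by omega) hlt
        refine hnob α (by omega) (by omega) ⟨hlt, h1⟩
      · have := hbet b (by omega) h1
        omega
  have hβd : β < d := by
    rcases Nat.eq_or_lt_of_le hq with heq | hlt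
    · have hdb : d = b := by
        apply u'.injective; rw [hud', e1]; exact heq
      rw [hdb]
      apply hβlt
      omega
    · have hda : d ≠ a := by rintro h0; rw [h0, e2] at hud'; omega
      have hdb : d ≠ b := by rintro h0; rw [h0, e1] at hud'; omega
      rw [e3 hda hdb] at hud'
      have hne : u d ≠ u α := u.injective.ne hαd.symm
      have := hbet d (by omega) (by omega)
      omega
  have h0D := P'.zero
  have hq1 : 1 ≤ q := le_trans P.one_le (le_of_inv_gt P'.le P'.fix hbig1)
  obtain ⟨hg', hperm', hcov'⟩ := P'.good.insert_place P'.fin h0D hqD hq1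
    (by rw [hinvβ]; exact hβd)
  rw [hinvβ, ← hd] at hperm' hcov'
  have hgi := goodRow_iff.1 hg'
  set C' := insert q D with hC'
  have hY' : ∀ s, rowPerm C' (u' s) = rowPerm C (u (swap β d s)) := fun s => by
    rw [← Perm.mul_apply, hperm', Perm.mul_apply, Perm.mul_apply, hY]
  have hY'β : rowPerm C' (u' β) = rowPerm C (u d) := by rw [hY', swap_apply_left]
  have hY'd : rowPerm C' (u' d) = q := by rw [hY', swap_apply_right]
  have hY'o : ∀ s, s ≠ β → s ≠ d → rowPerm C' (u' s) = rowPerm C (u s) := fun s h1 h2 => by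
    rw [hY', swap_apply_of_ne_of_ne h1 h2]
  have hqC' : q ∈ C' := Finset.mem_insert_self _ _
  have hcqC' : carryPos C' q = u β := by rw [← hcqD]; exact carryPos_insert_le le_rfl
  have hu'β : u' β = u β := e3 hβa hβb
  have hq2 : q < rowPerm C' (u' β) := by
    rw [hu'β, ← hcqC']; exact lt_rowPerm_carryPos hqC'
  set q2 := rowPerm C' (u' β) with hq2def
  have hq2C : q2 ∉ C' ∧ carryPos C' q2 = u β := by
    rcases rowPerm_cases C' (u' β) with ⟨h1, h2⟩ | ⟨h1, h2, h3⟩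
    · omega
    · exact ⟨h1, by rw [← hu'β]; exact h3⟩
  -- `α` is to the right of the new place of `β`, below and above the row
  have hu'α : q2 < u' α := by
    by_contra hcon
    have h1 : u' β < u' α := by
      rcases eq_or_ne α a with rfl | hne
      · rw [e2, hu'β]; omega
      · rw [e3 hne hαb, hu'β]; omega
    have h2 := hgi β α h1 (rowPerm_lt_of_le h1 (not_lt.1 hcon)).1
    omega
  have hY'α : q2 < rowPerm C' (u' α) := by
    by_contra hcon
    have h1 : u' β < u' α := by omega
    have h2 := hgi β α h1 (lt_of_le_of_ne (not_lt.1 hcon)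
      ((rowPerm C').injective.ne (u'.injective.ne hαβ)))
    omega
  -- the two new covers
  set z := w * chainProd L₀ with hz
  have hfinz : IsFinitary z := P.chain.of_append.isFinitary P.finW
  have hzy : z * swap α β = rowPerm D * u' := by
    rw [hperm, ← P.eq, hz, chainProd_append, mul_assoc]
    simp
  have hswap : swap α d * swap α β = swap α β * swap β d := by
    have h1 := swap_apply_apply (swap α β) β d
    rw [swap_apply_right, swap_apply_of_ne_of_ne hαd.symm hβd.ne', swap_inv] at h1
    rw [h1, mul_assoc, swap_mul_self, mul_one]
  have hz1 : ∀ s, z s = rowPerm C (u (swap α β s)) := fun s => by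
    have h1 : z = rowPerm D * u' * swap α β := by rw [← hzy, mul_assoc, swap_mul_self, mul_one]
    rw [h1, Perm.mul_apply, Perm.mul_apply, hY]
  have hzα : z α = q := by rw [hz1, swap_apply_left]
  have hzd : z d = q2 := by
    rw [hz1, swap_apply_of_ne_of_ne hαd.symm hβd.ne', ← hY'β]
  have hzβ : z β = rowPerm C' (u' α) := by
    rw [hz1, swap_apply_right, hY'o α hαβ hαd]
  have hlen : len (z * swap α d * swap α β) = len z + 2 := by
    rw [mul_assoc, hswap, ← mul_assoc, hzy,
      hcov'.len_eq (hzy ▸ hfinz.mul (isFinitary_swap hα1 (by omega))) (by omega), ← hzy,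
      hcov.len_eq hfinz hα1]
  obtain ⟨c1, c2⟩ := cover_cover_of_len hfinz hα1 (b := d) (by omega) hα1 (d := β) (by omega)
    (by rw [hzα, hzd]; exact hq2)
    (by rw [mul_swap_apply_left, mul_swap_apply_other z hαβ.symm hβd.ne, hzd, hzβ]; exact hY'α)
    hlen
  have hprod : w * chainProd (L₀ ++ [(α, d)] ++ [(α, β)]) = rowPerm C' * u' := by
    rw [hperm', ← hzy, mul_assoc, ← hswap, hz]
    simp [mul_assoc]
  refine ⟨C', L₀ ++ [(α, d)], q2, ⟨q, hqj, fun k hk1 hk2 => ⟨hno k hk1 hk2, ?_⟩, rfl,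
    Or.inr ⟨L₀, α, β, rfl, hA2, by simp [hd]⟩⟩, ⟨P.one_le, P.le, P'.fix, ?_, P'.fin, P.finW, hg',
    ?_, hprod⟩, Finset.card_insert_of_notMem hqD, by simp, ?_, hq2, ?_, d, hβd, ?_⟩
  · intro L₁ e g hL hA
    have h1 := concat_inj hL
    simp only [Prod.mk.injEq] at h1
    obtain ⟨-, -, rfl⟩ := h1
    have := hA.rowPerm_eq
    rw [hY] at this
    omega
  · intro p hp
    rcases Finset.mem_insert.1 hp with rfl | hp
    exacts [le_of_inv_gt P'.le P'.fix hbig1, P'.labels p hp]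
  · exact (P.chain.of_append.concat hα1 hαr (by omega) c1).concat hα1 hαr hβr
      (by rw [chainProd_append, ← mul_assoc]; simpa using c2)
  · rw [chainEntries_concat, chainEntries_concat, chainEntries_concat, chainProd_append,
      ← mul_assoc]
    simp only [chainProd_cons, chainProd_nil, mul_one]
    rw [mul_swap_apply_left, ← hz, hzd]
  · refine ⟨?_, ?_, ?_, ?_, ?_, ?_⟩
    · rw [hu'β]; omega
    · intro s hs hus
      rw [← hq2def, hY'β]
      have hsβ : s ≠ β := by omega
      have hsd : s ≠ d := by omega
      rw [hY'o s hsβ hsd]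
      by_contra hcon
      have h1 := hgD d s (by omega) (by
        rw [hY, hY]
        exact lt_of_le_of_ne (not_lt.1 hcon) ((rowPerm C).injective.ne (u.injective.ne hsd)))
      omega
    · intro hm; exact absurd hm hq2C.1
    · intro _; exact hu'α
    · intro _ s h1 h2
      rw [← hq2def] at h1
      rcases eq_or_ne s b with rfl | hsb
      · refine Or.inr (hβlt ?_)
        rcases eq_or_ne α a with rfl | hne
        · exact le_rfl
        · rw [e1, e3 hne hαb] at h2; exact h2.le
      rcases eq_or_ne s a with rfl | hsa
      · have hne : α ≠ s := by rintro rfl; omega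
        rw [e3 hne hαb, e2] at h2
        exact hbet s (by omega) (by omega)
      rw [e3 hsa hsb] at h1 h2
      rcases eq_or_ne α a with rfl | hne
      · rw [e2] at h2
        rcases lt_or_gt_of_ne (u.injective.ne hsa) with h3 | h3
        · exact hbet s (by omega) h3
        · have := hβlt le_rfl
          have := hnob s
          by_contra hcon
          exact hnob s (by omega) (by omega) ⟨h3, h2⟩
      · rw [e3 hne hαb] at h2
        exact hbet s (by omega) h2
    · intro _ s h1 h2
      rw [hY'o α hαβ hαd] at h2
      have hsβ : s ≠ β := by rintro rfl; omega
      have hsd : s ≠ d := by rintro rfl; omega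
      rw [hY'o s hsβ hsd] at h2
      rcases eq_or_ne α a with rfl | hne
      · rw [e2] at h1
        have hsb : s ≠ b := by rintro rfl; rw [e1] at h1; omega
        have hsa : s ≠ α := by rintro rfl; rw [e2] at h1; omega
        rw [e3 hsa hsb] at h1
        exact hcr s (by omega) h2
      · rw [e3 hne hαb] at h1
        rcases eq_or_ne s b with rfl | hsb
        · rw [e1] at h1
          exact hcr s (by omega) h2
        rcases eq_or_ne s a with rfl | hsa
        · rw [e2] at h1
          rcases lt_or_gt_of_ne (u.injective.ne hne) with h3 | h3
          · exact hcr s h3 h2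
          · have := hbet s (by omega) h3
            exact absurd ⟨h3, h1⟩ (hnob α (by omega) (by omega))
        rw [e3 hsa hsb] at h1
        exact hcr s h1 h2
  · rw [hprod]
    change rowPerm C' (u' d) < rowPerm C' (u' β)
    rw [hY'd]
    exact hq2

/-- The row step: a box to the right of the previous one. -/
theorem RowState.row_step {r l : ℕ} {w u : Perm ℕ} {C : Finset ℕ} {L₀ : List (ℕ × ℕ)}
    {a b α β qp : ℕ} (P : RowState r l w u C (L₀ ++ [(α, β)])) (ha : 1 ≤ a) (har : a ≤ r)
    (hb : r < b) (I : RowInv r u C α β qp) (hc : Cover u a b) (hqp : qp < u a)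
    (hfix : ∀ k ≤ l, (u * swap a b) k = k)
    (h : rowPerm C (u b) < rowPerm C (u a)) :
    ∃ C' L₁ α' β' v, RowRectification r (u * swap a b) C (L₀ ++ [(α, β)]) a b C'
        (L₁ ++ [(α', β')]) ∧
      RowState r l w (u * swap a b) C' (L₁ ++ [(α', β')]) ∧
      C'.card = C.card ∧ L₁.length = L₀.length + 1 ∧
      chainEntries w (L₁ ++ [(α', β')]) = chainEntries w (L₀ ++ [(α, β)]) ++ [v] ∧
      rowPerm C (u β) < v ∧ RowInv r (u * swap a b) C' α' β' (u a) ∧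
      ((L₁ = L₀ ++ [(α, β)] ∧ (u * swap a b) β' ≤ u a ∧
          ∀ k, (u * swap a b) β' ≤ k → k ≤ u a → r < (u * swap a b)⁻¹ k) ∨
        ∃ d, β' < d ∧ r < β' ∧ (w * chainProd (L₁ ++ [(α', β')])) d <
          (w * chainProd (L₁ ++ [(α', β')])) β') := by
  obtain ⟨j, hj, h1, h2, h3, h4, h5, P'⟩ := P.remove ha hc hfix h
  obtain ⟨hα1, hαr, hβr, hcov⟩ := P.chain.last
  have hcard : (C.erase j).card + 1 = C.card := Finset.card_erase_add_one hj
  have hub : (u * swap a b) b = u a := mul_swap_apply_right u a b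
  have hbig : r < (u * swap a b)⁻¹ (u a) := by rw [← hub]; simpa using hb
  have hcj : carryPos (C.erase j) j = u a := by rw [carryPos_erase_le le_rfl, h2]
  have hce : carryPos C (u a) = u a := by
    have hle : u a ≤ j := h2 ▸ carryPos_le C j
    rw [(carryPos_spec (C := C) (q := j) (p := u a) h2.le hle).1, h2]
  have hpos := I.pos
  set q := rowPerm C (u β) with hq
  have hqe : q + 1 ≤ u a := by
    have hcs := rowPerm_cases C (u β)
    rw [← hq] at hcs
    rcases hcs with ⟨h6, h7⟩ | ⟨h6, h7, h8⟩
    · omega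
    · by_contra hcon
      have h9 := (carryPos_spec (C := C) (q := q) (p := u a - 1) (by omega) (by omega)).2
        (by omega)
      have h10 := carryPos_succ_of_mem h9
      rw [Nat.sub_add_cancel (by omega), hce] at h10
      have := carryPos_le C (u a - 1)
      omega
  have hno2 : ∀ p, q ≤ p → ∀ L₁ α' β', L₀ ++ [(α, β)] = L₁ ++ [(α', β')] → ∀ k, p < k → k < j →
      ¬ IsAllowedSecond r (u * swap a b) (C.erase j) β' k := by
    intro p hp L₁ α' β' hL k hk1 hk2 hA
    have h6 := concat_inj hL
    simp only [Prod.mk.injEq] at h6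
    obtain ⟨-, -, rfl⟩ := h6
    have h7 := hA.rowPerm_eq
    rw [← Perm.mul_apply, h5, Perm.mul_apply] at h7
    omega
  by_cases hex : ∃ p, q < p ∧ p < j ∧ IsAllowed r (u * swap a b) (C.erase j) p
  · obtain ⟨p0, hp0, hp0j, hA0⟩ := hex
    obtain ⟨p, hpe, hA, hno, hbigs⟩ := exists_rightmost_isAllowed P'.fin P'.good hcj hbig
    have hpp : p0 ≤ p := by
      by_contra hcon
      exact hno p0 (by omega) hp0j hA0
    have hpj : p < j := by
      have := carryPos_le (C.erase j) j
      omega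
    obtain ⟨c, d, hd, hR, hS, hcd, hev, hval, hrow, -⟩ :=
      P'.reinsert hpj hpe hA hno (hno2 p (by omega)) hbigs
    refine ⟨_, L₀ ++ [(α, β)], c, d, p, ⟨j, _, h4, hR⟩, hS, by omega, by simp, hev, by omega,
      hrow, Or.inl ⟨rfl, ?_⟩⟩
    have : (u * swap a b) d = p + 1 := by rw [hd, perm_apply_inv]
    rw [this]
    exact ⟨hpe, fun k hk1 hk2 => hbigs k (by omega) hk2⟩
  · have hqC : q ∉ C := by
      intro hm
      have h6 : u⁻¹ (carryPos C q) ≤ r := I.cross hm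
      have h7 : carryPos C (q + 1) = carryPos C q := carryPos_succ_of_mem hm
      have hle := carryPos_le C q
      have hj' := carryPos_le C j
      have h8 : carryPos (C.erase j) (q + 1) = carryPos C q := by
        rw [carryPos_erase_le (by omega), h7]
      obtain ⟨p, h9, h10, h11⟩ := exists_isAllowed (r := r) (u := u * swap a b) (C := C.erase j)
        (m := q + 1) (n := j) (by omega)
        (by
          rw [h8, inv_mul_swap_apply]
          have h12 : u⁻¹ (carryPos C q) ≠ a := by
            rw [Ne, Perm.inv_eq_iff_eq]; omega
          rw [swap_apply_of_ne_of_ne h12 (by omega)]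
          exact h6)
        (by rw [hcj]; exact hbig)
      exact hex ⟨p, by omega, h10, h11⟩
    obtain ⟨C', L₁, v, hR, hS, hcd, hlen, hev, hv, hrow, d, hd⟩ :=
      P.reinsert_second ha har hb I hc hqp h h1 h2 h5 P' hqe hqC
      (fun k hk1 hk2 hA => hex ⟨k, hk1, hk2, hA⟩)
    exact ⟨C', L₁, α, β, v, ⟨j, _, h4, hR⟩, hS, by omega, hlen, hev, hv, hrow,
      Or.inr ⟨d, hd.1, hβr, hd.2⟩⟩

/-- The first step in a line of boxes, if the last big strand of the chain does not interfere. -/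
theorem RowState.first_step {r l : ℕ} {w u : Perm ℕ} {C : Finset ℕ} {L : List (ℕ × ℕ)}
    {a b : ℕ} (P : RowState r l w u C L) (ha : 1 ≤ a) (hb : r < b) (hc : Cover u a b)
    (hfix : ∀ k ≤ l, (u * swap a b) k = k)
    (hlast : ∀ L₀ α β, L = L₀ ++ [(α, β)] → u a ≤ (u * swap a b) β)
    (h : rowPerm C (u b) < rowPerm C (u a)) :
    ∃ C' c d v, RowRectification r (u * swap a b) C L a b C' (L ++ [(c, d)]) ∧
      RowState r l w (u * swap a b) C' (L ++ [(c, d)]) ∧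
      C'.card = C.card ∧
      chainEntries w (L ++ [(c, d)]) = chainEntries w L ++ [v] ∧
      RowInv r (u * swap a b) C' c d (u a) ∧ ColInv r (u * swap a b) C' c d (u a) ∧
      (u * swap a b) d ≤ u a ∧
      ∀ k, (u * swap a b) d ≤ k → k ≤ u a → r < (u * swap a b)⁻¹ k := by
  obtain ⟨j, hj, h1, h2, h3, h4, h5, P'⟩ := P.remove ha hc hfix h
  have hcard : (C.erase j).card + 1 = C.card := Finset.card_erase_add_one hj
  have hub : (u * swap a b) b = u a := mul_swap_apply_right u a b
  have hbig : r < (u * swap a b)⁻¹ (u a) := by rw [← hub]; simpa using hb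
  have hcj : carryPos (C.erase j) j = u a := by rw [carryPos_erase_le le_rfl, h2]
  obtain ⟨p, hpe, hA, hno, hbigs⟩ := exists_rightmost_isAllowed P'.fin P'.good hcj hbig
  have hpj : p < j := by
    have := carryPos_le (C.erase j) j
    omega
  have hno2 : ∀ L₀ α β, L = L₀ ++ [(α, β)] → ∀ k, p < k → k < j →
      ¬ IsAllowedSecond r (u * swap a b) (C.erase j) β k := by
    intro L₀ α β hL k hk1 hk2 hA
    have h6 := hlast _ _ _ hL
    have h7 : carryPos (C.erase j) k = (u * swap a b) β := by
      rw [← hA.2.1, perm_apply_inv]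
    have h8 := carryPos_le (C.erase j) k
    exact hA.1 ((carryPos_spec (C := C.erase j) (q := j) (p := k) (by omega) hk2.le).2 hk2)
  obtain ⟨c, d, hd, hR, hS, hcd, hev, hval, hrow, hcol⟩ :=
    P'.reinsert hpj hpe hA hno hno2 hbigs
  have hud : (u * swap a b) d = p + 1 := by rw [hd, perm_apply_inv]
  refine ⟨_, c, d, p, ⟨j, _, h4, hR⟩, hS, by omega, hev, hrow, hcol, ?_⟩
  rw [hud]
  exact ⟨hpe, fun k hk1 hk2 => hbigs k (by omega) hk2⟩

/-- The second kind of removal: `a` is the small strand of the previous box `(a, β)` and crosses `β`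
in the row. -/
lemma RowState.remove_second {r l : ℕ} {w u : Perm ℕ} {C : Finset ℕ} {L₀ : List (ℕ × ℕ)}
    {a b β : ℕ} (P : RowState r l w u C (L₀ ++ [(a, β)])) (ha : 1 ≤ a) (har : a ≤ r)
    (hb : r < b) (hc : Cover u a b) (hfix : ∀ k ≤ l, (u * swap a b) k = k)
    (h : rowPerm C (u a) < rowPerm C (u b)) (h1 : u a < u β)
    (h2 : rowPerm C (u β) < rowPerm C (u a)) :
    ∃ j ∈ C, rowPerm C (u β) = j ∧ carryPos C j = u a ∧
      RowRemoval (u * swap a b) C (L₀ ++ [(a, β)]) a b j (L₀ ++ [(a, b)]) ∧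
      RowState r l w (u * swap a b) (C.erase j) (L₀ ++ [(a, b)]) ∧
      chainEntries w (L₀ ++ [(a, b)]) = chainEntries w (L₀ ++ [(a, β)]) := by
  obtain ⟨K, -, -⟩ := P.keep ha har hb hc hfix h
  obtain ⟨-, -, hβr, hcov⟩ := P.chain.last
  obtain ⟨-, -, -, hcovY⟩ := K.chain.last
  obtain ⟨h3, h4, h5⟩ := crossing_of_exchanged h1 h2
  have hgK := goodRow_iff.1 K.good
  set j := rowPerm C (u β) with hj
  have hβb : β ≠ b := by rintro rfl; omega
  have hβa : β ≠ a := by omega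
  have hab := hc.1
  have e1 : (u * swap a b) b = u a := mul_swap_apply_right u a b
  have hj1 : (u * swap a b)⁻¹ (carryPos C j) = b := by
    rw [h5, Perm.inv_eq_iff_eq, e1]
  have hj2 : (u * swap a b)⁻¹ (j + 1) = β := by
    rw [h3, Perm.inv_eq_iff_eq, mul_swap_apply_other u hβa hβb]
  have hbβ : b < β := by
    have := K.good j h4
    rwa [hj1, hj2] at this
  set z := w * chainProd L₀ with hz
  have hfinz : IsFinitary z := P.chain.of_append.isFinitary P.finW
  have hzy : z * swap a β = rowPerm C * u := by
    rw [← P.eq, hz, chainProd_append, mul_assoc]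
    simp
  have hz1 : z = rowPerm C * u * swap a β := by rw [← hzy, mul_assoc, swap_mul_self, mul_one]
  have hza : z a = j := by rw [hz1, mul_swap_apply_left, Perm.mul_apply]
  have hzβ : z β = rowPerm C (u a) := by rw [hz1, mul_swap_apply_right, Perm.mul_apply]
  have hzo : ∀ s, s ≠ a → s ≠ β → z s = rowPerm C (u s) := fun s h1 h2 => by
    rw [hz1, mul_swap_apply_other _ h1 h2, Perm.mul_apply]
  have hcz : Cover z a b := by
    refine ⟨hab, by rw [hza, hzo b (by omega) hβb.symm]; omega, ?_⟩
    intro c hc1 hc2 ⟨hc3, hc4⟩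
    have hca : c ≠ a := by omega
    have hcβ : c ≠ β := by omega
    rw [hzo b (by omega) hβb.symm] at hc4
    by_cases hlt : z c < z β
    · exact hcov.2.2 c hc1 (by omega) ⟨hc3, hlt⟩
    · have hne : z c ≠ z β := z.injective.ne hcβ
      refine hcovY.2.2 c hc1 hc2 ?_
      rw [P.eq, Perm.mul_apply, Perm.mul_apply, Perm.mul_apply, ← hzβ, ← hzo c hca hcβ]
      exact ⟨by omega, hc4⟩
  have hperm : rowPerm (C.erase j) * (u * swap a b) = z * swap a b := by
    have h6 := swap_apply_apply u a β
    have h7 : swap a β * swap a b * swap b β = swap a b := by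
      have h8 := swap_apply_apply (swap a b) a β
      rw [swap_apply_left, swap_apply_of_ne_of_ne hβa hβb, swap_inv] at h8
      rw [h8]
      calc swap a β * swap a b * (swap a b * swap a β * swap a b)
          = swap a β * (swap a b * swap a b) * swap a β * swap a b := by simp only [mul_assoc]
        _ = swap a b := by rw [swap_mul_self, mul_one, swap_mul_self, one_mul]
    have h8 : swap (u a) (u β) * (u * swap a b) = u * swap a b * swap b β := by
      have h9 := swap_apply_apply (u * swap a b) b β
      rw [e1, mul_swap_apply_other u hβa hβb] at h9
      rw [h9]
      simp [mul_assoc]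
    rw [rowPerm_erase h4, h5, h3, mul_assoc, h8, ← mul_assoc, ← mul_assoc, ← hzy, mul_assoc,
      mul_assoc, ← mul_assoc (swap a β), h7]
  have hfin := P.fin.mul (isFinitary_swap ha hab)
  have h0 : 0 ∉ C.erase j := fun hm => P.zero (Finset.mem_of_mem_erase hm)
  refine ⟨j, h4, rfl, h5, ⟨h4, hj1, Or.inr ⟨?_, L₀, β, rfl, hj2, rfl⟩⟩,
    ⟨P.one_le, P.le, hfix, ?_, hfin, P.finW, ?_, ?_, ?_⟩, ?_⟩
  · intro k hk hk1 hk2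
    have := K.good k hk
    omega
  · intro p hp
    exact P.labels p (Finset.mem_of_mem_erase hp)
  · rw [← (len_rowPerm_mul hfin h0).2, hperm, hcz.len_eq hfinz ha]
    have l1 := K.good.len_eq hfin P.zero
    rw [← K.eq, chainProd_append, ← mul_assoc, P.eq] at l1
    simp only [chainProd_cons, chainProd_nil, mul_one] at l1
    rw [← P.eq, hcovY.len_eq (P.eq ▸ (isFinitary_rowPerm P.zero).mul P.fin) ha, P.eq, ← hzy,
      hcov.len_eq hfinz ha] at l1
    have l2 := Finset.card_erase_add_one h4
    omega
  · exact P.chain.of_append.concat ha har hb hcz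
  · rw [hperm, hz]
    simp [mul_assoc]
  · rw [chainEntries_concat, chainEntries_concat]

/-- The column step: a box above the previous one, in the case in which the entry `(a, b)` of the
lower chain cannot be kept. -/
theorem RowState.col_step {r l : ℕ} {w u : Perm ℕ} {C : Finset ℕ} {L₀ : List (ℕ × ℕ)}
    {a b α β qp : ℕ} (P : RowState r l w u C (L₀ ++ [(α, β)])) (ha : 1 ≤ a) (har : a ≤ r)
    (hb : r < b) (I : ColInv r u C α β qp) (hc : Cover u a b) (hqp : u a < qp)
    (hfix : ∀ k ≤ l, (u * swap a b) k = k)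
    (h : rowPerm C (u b) < rowPerm C (u a) ∨ rowPerm C (u β) < rowPerm C (u a)) :
    ∃ C' L₁ c d v, RowRectification r (u * swap a b) C (L₀ ++ [(α, β)]) a b C'
        (L₁ ++ [(c, d)]) ∧
      RowState r l w (u * swap a b) C' (L₁ ++ [(c, d)]) ∧
      C'.card = C.card ∧ L₁.length = L₀.length + 1 ∧
      chainEntries w (L₁ ++ [(c, d)]) = chainEntries w (L₀ ++ [(α, β)]) ++ [v] ∧
      v < rowPerm C (u β) ∧
      RowInv r (u * swap a b) C' c d (u a) ∧ ColInv r (u * swap a b) C' c d (u a) := by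
  have hub : (u * swap a b) b = u a := mul_swap_apply_right u a b
  have hbig : r < (u * swap a b)⁻¹ (u a) := by rw [← hub]; simpa using hb
  have hab := hc.1
  have huab := hc.2.1
  set q := rowPerm C (u β) with hq
  rcases lt_or_gt_of_ne ((rowPerm C).injective.ne (u.injective.ne hab.ne')) with hlt | hlt
  · obtain ⟨j, hj, h1, h2, h3, h4, h5, P'⟩ := P.remove ha hc hfix hlt
    have hcard : (C.erase j).card + 1 = C.card := Finset.card_erase_add_one hj
    have hcj : carryPos (C.erase j) j = u a := by rw [carryPos_erase_le le_rfl, h2]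
    obtain ⟨p, hpe, hA, hno, hbigs⟩ := exists_rightmost_isAllowed P'.fin P'.good hcj hbig
    have hej : u a ≤ j := by
      have := carryPos_le (C.erase j) j
      omega
    have hpj : p < j := by omega
    have hinside : ∀ k, u a ≤ k → k < j → k ∈ C.erase j := fun k hk1 hk2 =>
      (carryPos_spec (C := C.erase j) (q := j) (p := k) (by omega) hk2.le).2 hk2
    have hY : ∀ s, rowPerm (C.erase j) ((u * swap a b) s) = rowPerm C (u s) := fun s => by
      rw [← Perm.mul_apply, h5, Perm.mul_apply]
    have key : p < q ∧ ∀ k, k < j → ¬ IsAllowedSecond r (u * swap a b) (C.erase j) β k := by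
      rcases I with ⟨i1, i2, i3⟩ | ⟨i1, i2⟩
      · have hqC : q ∈ C := (crossing_of_exchanged i2 i3).2.1
        constructor
        · by_contra hcon
          have hpq : p ≠ q := by
            rintro rfl
            have := hA.1
            exact this (Finset.mem_erase.2 ⟨by omega, hqC⟩)
          set c2 := (u * swap a b)⁻¹ (carryPos (C.erase j) p) with hc2
          have hu2 : (u * swap a b) c2 = carryPos (C.erase j) p := perm_apply_inv _ _
          have hle := carryPos_le (C.erase j) p
          have hne1 : c2 ≠ a := by
            intro h0; rw [h0, mul_swap_apply_left] at hu2; omega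
          have hne2 : c2 ≠ b := by
            intro h0; rw [h0, hub] at hu2; omega
          have hY2 := hY c2
          rw [hu2, rowPerm_carryPos hA.1] at hY2
          rw [mul_swap_apply_other u hne1 hne2] at hu2
          have h7 := i1 c2 hA.2.1 (by omega) (by omega)
          have h8 := i1 a har hqp (by omega)
          exact hne1 (h7.trans h8.symm)
        · intro k hk hA2
          have h7 := hA2.rowPerm_eq
          rw [hY] at h7
          have h8 := hA2.1
          rw [← h7] at h8
          exact h8 (Finset.mem_erase.2 ⟨by omega, hqC⟩)
      · refine ⟨by omega, ?_⟩
        intro k hk hA2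
        have h7 := hA2.rowPerm_eq
        rw [hY] at h7
        exact hA2.1 (hinside k (by omega) hk)
    obtain ⟨c, d, hd, hR, hS, hcd, hev, hval, hrow, hcol⟩ :=
      P'.reinsert hpj hpe hA hno (by
        intro L₁ α' β' hL k hk1 hk2
        have h6 := concat_inj hL
        simp only [Prod.mk.injEq] at h6
        obtain ⟨-, -, rfl⟩ := h6
        exact key.2 k hk2) hbigs
    exact ⟨_, _, c, d, p, ⟨j, _, h4, hR⟩, hS, by omega, by simp, hev, key.1, hrow, hcol⟩
  · have hqa : q < rowPerm C (u a) := by omega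
    rcases I with ⟨i1, i2, i3⟩ | ⟨i1, i2⟩
    · obtain rfl := i1 a har hqp hqa
      obtain ⟨j, hj, h1, h2, h3, P', hev⟩ :=
        P.remove_second ha har hb hc hfix hlt i2 i3
      have hcard : (C.erase j).card + 1 = C.card := Finset.card_erase_add_one hj
      have hcj : carryPos (C.erase j) j = u a := by rw [carryPos_erase_le le_rfl, h2]
      obtain ⟨p, hpe, hA, hno, hbigs⟩ := exists_rightmost_isAllowed P'.fin P'.good hcj hbig
      have hej : u a ≤ j := by
        have := carryPos_le (C.erase j) j
        omega
      obtain ⟨c, d, hd, hR, hS, hcd, hev', hval, hrow, hcol⟩ :=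
        P'.reinsert (by omega) hpe hA hno (by
          intro L₁ α' β' hL k hk1 hk2 hA2
          have h6 := concat_inj hL
          simp only [Prod.mk.injEq] at h6
          obtain ⟨-, -, rfl⟩ := h6
          have h7 := hA2.rowPerm_eq
          have h8 := rowPerm_carryPos (Finset.notMem_erase j C)
          rw [hcj, ← hub, h7] at h8
          omega) hbigs
      exact ⟨_, _, c, d, p, ⟨j, _, h3, hR⟩, hS, by omega, by simp, by rw [hev', hev], by omega,
        hrow, hcol⟩
    · exfalso
      have h7 : u b ≤ qp := by
        by_contra hcon
        exact i2 a har hqp hqa b (by omega) hb hc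
      have := (rowPerm_lt_of_le (C := C) huab (m := u b) (by omega)).1
      omega

/-! ### Graphs and their strands -/

lemma sort_eq_of_perm {α : Type*} [DecidableEq α] (r : α → α → Prop) [DecidableRel r] [IsTrans α r]
    [Std.Antisymm r] [Std.Total r] {s : Finset α} {l : List α} (hs : l.Pairwise r) (hn : l.Nodup)
    (hm : ∀ a, a ∈ l ↔ a ∈ s) : s.sort r = l := by
  have hp : (s.sort r).Perm l := by
    rw [List.perm_ext_iff_of_nodup (s.sort_nodup r) hn]
    intro a
    rw [Finset.mem_sort, hm]
  exact hp.eq_of_pairwise' (s.pairwise_sort r) hs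

lemma graphWord_union {A B : Graph} (h : ∀ p ∈ A, ∀ q ∈ B, p.1 < q.1) :
    graphWord (A ∪ B) = graphWord A ++ graphWord B := by
  have : (A ∪ B).sort ReadBefore = A.sort ReadBefore ++ B.sort ReadBefore := by
    apply sort_eq_of_perm
    · rw [List.pairwise_append]
      refine ⟨A.pairwise_sort _, B.pairwise_sort _, fun a ha b hb => Or.inl ?_⟩
      exact h a ((Finset.mem_sort _).1 ha) b ((Finset.mem_sort _).1 hb)
    · rw [List.nodup_append]
      refine ⟨A.sort_nodup _, B.sort_nodup _, fun a ha b hb hab => ?_⟩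
      have := h a ((Finset.mem_sort _).1 ha) b ((Finset.mem_sort _).1 hb)
      rw [hab] at this
      exact lt_irrefl _ this
    · intro a; simp
  simp [graphWord, this]

/-- The labels of the crossings in row `i`. -/
def rowLabels (R : Graph) (i : ℕ) : Finset ℕ := (row R i).image fun p => p.1 + p.2 - 1

lemma mem_rowLabels {R : Graph} {i j : ℕ} (hi : 1 ≤ i) :
    i + j - 1 ∈ rowLabels R i ↔ (i, j) ∈ R := by
  simp only [rowLabels, row, Finset.mem_image, Finset.mem_filter]
  constructor
  · rintro ⟨⟨a, b⟩, ⟨h1, h2⟩, h3⟩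
    simp only at h2 h3
    subst h2
    have : b = j := by omega
    rwa [← this]
  · intro h
    exact ⟨(i, j), ⟨h, rfl⟩, rfl⟩

lemma perm_row {R : Graph} {i : ℕ} (hi : 1 ≤ i) : perm (row R i) = rowPerm (rowLabels R i) := by
  unfold perm rowPerm
  congr 1
  symm
  have hmem : ∀ p ∈ (row R i).sort ReadBefore, p.1 = i := fun p hp => by
    have := (Finset.mem_sort _).1 hp
    exact (Finset.mem_filter.1 this).2
  apply sort_eq_of_perm
  · unfold graphWord
    rw [List.pairwise_map]
    refine ((row R i).pairwise_sort ReadBefore).imp_of_mem ?_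
    intro a b ha hb hab
    have h1 := hmem a ha
    have h2 := hmem b hb
    unfold ReadBefore at hab
    omega
  · unfold graphWord
    refine ((row R i).sort_nodup ReadBefore).map_on ?_
    intro a ha b hb hab
    have h1 := hmem a ha
    have h2 := hmem b hb
    apply Prod.ext <;> omega
  · intro a
    simp [graphWord, rowLabels]

lemma rowsFrom_eq_union (R : Graph) (i : ℕ) : rowsFrom R i = row R i ∪ rowsFrom R (i + 1) := by
  ext p
  simp only [rowsFrom, row, Finset.mem_union, Finset.mem_filter]
  constructor
  · rintro ⟨h1, h2⟩
    rcases Nat.eq_or_lt_of_le h2 with h | h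
    exacts [Or.inl ⟨h1, h.symm⟩, Or.inr ⟨h1, h⟩]
  · rintro (⟨h1, h2⟩ | ⟨h1, h2⟩)
    exacts [⟨h1, h2.ge⟩, ⟨h1, by omega⟩]

lemma perm_rowsFrom {R : Graph} {i : ℕ} (hi : 1 ≤ i) :
    perm (rowsFrom R i) = rowPerm (rowLabels R i) * perm (rowsFrom R (i + 1)) := by
  rw [← perm_row hi, rowsFrom_eq_union R i]
  unfold perm
  rw [graphWord_union, wordPerm_append]
  intro p hp q hq
  simp only [rowsFrom, row, Finset.mem_filter] at hp hq
  omega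

lemma perm_empty : perm ∅ = 1 := by simp [perm, graphWord]

/-- All rows and columns of the graph are numbered from `1`. -/
def IsPlaced (R : Graph) : Prop := ∀ p ∈ R, 1 ≤ p.1 ∧ 1 ≤ p.2

lemma IsPlaced.subset {R S : Graph} (h : IsPlaced R) (hs : S ⊆ R) : IsPlaced S :=
  fun p hp => h p (hs hp)

lemma IsPlaced.letters {R : Graph} (h : IsPlaced R) : ∀ i ∈ graphWord R, 1 ≤ i := by
  intro i hi
  simp only [graphWord, List.mem_map, Finset.mem_sort] at hi
  obtain ⟨p, hp, rfl⟩ := hi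
  have := h p hp
  omega

lemma IsPlaced.isFinitary {R : Graph} (h : IsPlaced R) : IsFinitary (perm R) :=
  isFinitary_wordPerm h.letters

lemma length_graphWord (R : Graph) : (graphWord R).length = R.card := by simp [graphWord]

lemma isRcGraph_iff {R : Graph} : IsRcGraph R ↔ IsPlaced R ∧ len (perm R) = R.card := by
  constructor
  · rintro ⟨h1, h2, h3, h4⟩
    exact ⟨h1, by rw [← h4, length_graphWord]⟩
  · rintro ⟨h1, h2⟩
    exact ⟨h1, h1.letters, rfl, by rw [length_graphWord, h2]⟩

lemma perm_fix {R : Graph} {m : ℕ} (h : ∀ p ∈ R, m ≤ p.1 ∧ 1 ≤ p.2) {k : ℕ} (hk : k < m) :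
    perm R k = k := by
  have hl : ∀ i ∈ graphWord R, m ≤ i := by
    intro i hi
    simp only [graphWord, List.mem_map, Finset.mem_sort] at hi
    obtain ⟨p, hp, rfl⟩ := hi
    have := h p hp
    omega
  unfold perm
  generalize graphWord R = L at hl
  induction L with
  | nil => simp
  | cons i L ih =>
    have h1 := hl i (by simp)
    rw [wordPerm_cons, Perm.mul_apply, ih fun j hj => hl j (by simp [hj]), simple_apply,
      if_neg (by omega), if_neg (by omega)]

lemma IsPlaced.rowsFrom_fix {R : Graph} (h : IsPlaced R) {m k : ℕ} (hk : k < m) :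
    perm (rowsFrom R m) k = k := by
  refine perm_fix (fun p hp => ?_) hk
  simp only [rowsFrom, Finset.mem_filter] at hp
  exact ⟨hp.2, (h p hp.1).2⟩

lemma rowLabels_ge {R : Graph} (h : IsPlaced R) {i q : ℕ} (hq : q ∈ rowLabels R i) : i ≤ q := by
  simp only [rowLabels, row, Finset.mem_image, Finset.mem_filter] at hq
  obtain ⟨p, ⟨h1, h2⟩, h3⟩ := hq
  have := h p h1
  omega

/-- The strand which enters a place is determined by the carry of the row, or by the permutation of
the rows below. -/
lemma Enters.spec {R : Graph} (hR : IsPlaced R) {k : ℕ} {side : Side} {i j : ℕ}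
    (h : Enters R k side i j) :
    1 ≤ j ∧ match side with
      | .left => 1 ≤ i ∧ perm (rowsFrom R (i + 1)) k = carryPos (rowLabels R i) (i + j - 1)
      | .below => perm (rowsFrom R (i + 1)) k = i + j := by
  induction h with
  | start hk =>
    refine ⟨le_rfl, hk, ?_⟩
    rw [hR.rowsFrom_fix (by omega), Nat.add_sub_cancel]
    exact (carryPos_eq_self fun q hq => rowLabels_ge hR hq).symm
  | @straightRight i j h hm ih =>
    obtain ⟨h1, h2, h3⟩ := ih
    refine ⟨by omega, h2, ?_⟩
    have := carryPos_succ_of_mem ((mem_rowLabels (j := j) h2).2 hm)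
    rw [Nat.sub_add_cancel (by omega)] at this
    rw [h3, ← this]
    congr 1
  | @turnUp i j h hm ih =>
    obtain ⟨h1, h2, h3⟩ := ih
    refine ⟨h1, ?_⟩
    have hm' : i + 1 + j - 1 ∉ rowLabels R (i + 1) := fun hh => hm ((mem_rowLabels h2).1 hh)
    simp only
    rw [perm_rowsFrom h2, Perm.mul_apply, h3, rowPerm_carryPos hm']
    omega
  | @straightUp i j h hm ih =>
    obtain ⟨h1, h2⟩ := ih
    refine ⟨h1, ?_⟩
    have hm' := (mem_rowLabels (i := i + 1) (j := j) (by omega)).2 hm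
    simp only at h2 ⊢
    rw [perm_rowsFrom (by omega), Perm.mul_apply, h2]
    have := rowPerm_of_mem hm'
    rw [Nat.sub_add_cancel (by omega)] at this
    rw [this]
    omega
  | @turnRight i j h hm ih =>
    obtain ⟨h1, h2⟩ := ih
    refine ⟨by omega, by omega, ?_⟩
    have hm' : i + 1 + j - 1 ∉ rowLabels R (i + 1) := fun hh => hm ((mem_rowLabels (by omega)).1 hh)
    have := carryPos_succ_of_notMem hm'
    rw [Nat.sub_add_cancel (by omega)] at this
    simp only at h2
    rw [h2, ← this]
    congr 1

lemma perm_inv_apply (u : Perm ℕ) (k : ℕ) : u⁻¹ (u k) = k := by simp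

lemma exists_row_bound (R : Graph) : ∃ N, ∀ p ∈ R, p.1 ≤ N :=
  ⟨R.sup Prod.fst, fun _ hp => Finset.le_sup (f := Prod.fst) hp⟩

lemma exists_enters_below (R : Graph) {j : ℕ} (hl : ∀ i, 1 ≤ i → ∃ k, Enters R k .left i j)
    (i : ℕ) :
    ∃ k, Enters R k .below i j := by
  obtain ⟨N, hN⟩ := exists_row_bound R
  induction hn : N - i generalizing i with
  | zero =>
    obtain ⟨k, hk⟩ := hl (i + 1) (by omega)
    refine ⟨k, hk.turnUp fun hm => ?_⟩
    have := hN _ hm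
    simp only at this
    omega
  | succ n ih =>
    by_cases hm : (i + 1, j) ∈ R
    · obtain ⟨k, hk⟩ := ih (i + 1) (by omega)
      exact ⟨k, hk.straightUp hm⟩
    · obtain ⟨k, hk⟩ := hl (i + 1) (by omega)
      exact ⟨k, hk.turnUp hm⟩

lemma exists_enters_left (R : Graph) {i j : ℕ} (hi : 1 ≤ i) (hj : 1 ≤ j) :
    ∃ k, Enters R k .left i j := by
  induction j, hj using Nat.le_induction generalizing i with
  | base => exact ⟨i, .start hi⟩
  | succ j hj ih =>
    by_cases hm : (i, j) ∈ R
    · obtain ⟨k, hk⟩ := ih hi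
      exact ⟨k, hk.straightRight hm⟩
    · obtain ⟨k, hk⟩ := exists_enters_below R (fun i hi => ih hi) i
      obtain ⟨i, rfl⟩ : ∃ i', i = i' + 1 := ⟨i - 1, by omega⟩
      exact ⟨k, hk.turnRight hm⟩

lemma enters_left_iff {R : Graph} (hR : IsPlaced R) {k i j : ℕ} :
    Enters R k .left i j ↔
      1 ≤ i ∧ 1 ≤ j ∧ k = (perm (rowsFrom R (i + 1)))⁻¹ (carryPos (rowLabels R i) (i + j - 1)) := by
  constructor
  · intro h
    obtain ⟨h1, h2, h3⟩ := h.spec hR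
    exact ⟨h2, h1, by rw [eq_comm, Perm.inv_eq_iff_eq, h3]⟩
  · rintro ⟨h1, h2, rfl⟩
    obtain ⟨k, hk⟩ := exists_enters_left R h1 h2
    obtain ⟨-, -, h3⟩ := hk.spec hR
    rwa [← h3, perm_inv_apply]

lemma enters_below_iff {R : Graph} (hR : IsPlaced R) {k i j : ℕ} :
    Enters R k .below i j ↔ 1 ≤ j ∧ k = (perm (rowsFrom R (i + 1)))⁻¹ (i + j) := by
  constructor
  · intro h
    obtain ⟨h1, h2⟩ := h.spec hR
    simp only at h2
    exact ⟨h1, by rw [eq_comm, Perm.inv_eq_iff_eq, h2]⟩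
  · rintro ⟨h2, rfl⟩
    obtain ⟨k, hk⟩ := exists_enters_below R (fun i hi => exists_enters_left R hi h2) i
    obtain ⟨-, h3⟩ := hk.spec hR
    simp only at h3
    rwa [← h3, perm_inv_apply]

lemma pass_iff {R : Graph} (hR : IsPlaced R) {i j c d : ℕ} :
    Pass R i j c d ↔ 1 ≤ i ∧ 1 ≤ j ∧
      c = (perm (rowsFrom R (i + 1)))⁻¹ (carryPos (rowLabels R i) (i + j - 1)) ∧
      d = (perm (rowsFrom R (i + 1)))⁻¹ (i + j) := by
  rw [Pass, enters_left_iff hR, enters_below_iff hR]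
  tauto

/-! ### Rectification of graphs -/

/-- The crossings in row `l` with labels `C`. -/
def rowGraph (l : ℕ) (C : Finset ℕ) : Graph := C.image fun p => (l, p + 1 - l)

lemma mem_rowGraph {l : ℕ} {C : Finset ℕ} (hC : ∀ p ∈ C, l ≤ p) {i j : ℕ} :
    (i, j) ∈ rowGraph l C ↔ i = l ∧ 1 ≤ j ∧ l + j - 1 ∈ C := by
  simp only [rowGraph, Finset.mem_image, Prod.mk.injEq]
  constructor
  · rintro ⟨p, hp, rfl, rfl⟩
    have := hC p hp
    refine ⟨rfl, by omega, ?_⟩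
    convert hp using 1
    omega
  · rintro ⟨rfl, h1, h2⟩
    exact ⟨_, h2, rfl, by omega⟩

lemma card_rowGraph {l : ℕ} {C : Finset ℕ} (hC : ∀ p ∈ C, l ≤ p) :
    (rowGraph l C).card = C.card := by
  apply Finset.card_image_of_injOn
  intro p hp q hq h
  have h1 := hC p hp
  have h2 := hC q hq
  simp only [Prod.mk.injEq] at h
  omega

/-- A graph `S` in the rows below row `l` and a row of crossings with labels `C`. -/
structure IsLayered (l : ℕ) (S : Graph) (C : Finset ℕ) : Prop where
  one_le : 1 ≤ l
  below : ∀ p ∈ S, l < p.1 ∧ 1 ≤ p.2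
  labels : ∀ p ∈ C, l ≤ p

namespace IsLayered

variable {l : ℕ} {S : Graph} {C : Finset ℕ}

lemma placed (h : IsLayered l S C) : IsPlaced (S ∪ rowGraph l C) := by
  rintro ⟨i, j⟩ hp
  rcases Finset.mem_union.1 hp with hp | hp
  · have := h.below _ hp
    simp only at this ⊢
    omega
  · have := (mem_rowGraph h.labels).1 hp
    have := h.one_le
    simp only
    omega

lemma mem_iff (h : IsLayered l S C) {j : ℕ} :
    (l, j) ∈ S ∪ rowGraph l C ↔ 1 ≤ j ∧ l + j - 1 ∈ C := by
  rw [Finset.mem_union, mem_rowGraph h.labels]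
  constructor
  · rintro (hp | hp)
    · have := (h.below _ hp).1
      simp only at this
      omega
    · exact hp.2
  · intro hp; exact Or.inr ⟨rfl, hp⟩

lemma row_eq (h : IsLayered l S C) : row (S ∪ rowGraph l C) l = rowGraph l C := by
  ext ⟨i, j⟩
  simp only [row, Finset.mem_filter, Finset.mem_union]
  constructor
  · rintro ⟨hp | hp, rfl⟩
    · have := (h.below _ hp).1
      simp only at this
      omega
    · exact hp
  · intro hp
    exact ⟨Or.inr hp, ((mem_rowGraph h.labels).1 hp).1⟩

lemma rowsFrom_succ (h : IsLayered l S C) : rowsFrom (S ∪ rowGraph l C) (l + 1) = S := by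
  ext ⟨i, j⟩
  simp only [rowsFrom, Finset.mem_filter, Finset.mem_union]
  constructor
  · rintro ⟨hp | hp, h1⟩
    · exact hp
    · have := ((mem_rowGraph h.labels).1 hp).1
      omega
  · intro hp
    exact ⟨Or.inl hp, (h.below _ hp).1⟩

lemma rowsFrom_self (h : IsLayered l S C) : rowsFrom (S ∪ rowGraph l C) l = S ∪ rowGraph l C := by
  apply Finset.filter_true_of_mem
  rintro ⟨i, j⟩ hp
  rcases Finset.mem_union.1 hp with hp | hp
  · exact (h.below _ hp).1.le
  · exact ((mem_rowGraph h.labels).1 hp).1.ge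

lemma rowLabels_eq (h : IsLayered l S C) : rowLabels (S ∪ rowGraph l C) l = C := by
  ext p
  by_cases hp : l ≤ p
  · have h1 := mem_rowLabels (R := S ∪ rowGraph l C) (j := p + 1 - l) h.one_le
    have h2 : l + (p + 1 - l) - 1 = p := by omega
    rw [h2] at h1
    rw [h1, h.mem_iff, h2]
    exact ⟨fun h => h.2, fun h => ⟨by omega, h⟩⟩
  · refine ⟨fun hm => absurd (rowLabels_ge h.placed hm) hp, fun hm => absurd (h.labels _ hm) hp⟩

lemma perm_eq (h : IsLayered l S C) : perm (S ∪ rowGraph l C) = rowPerm C * perm S := by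
  conv_lhs => rw [← h.rowsFrom_self]
  rw [perm_rowsFrom h.one_le, h.rowLabels_eq, h.rowsFrom_succ]

lemma card_eq (h : IsLayered l S C) : (S ∪ rowGraph l C).card = S.card + C.card := by
  rw [Finset.card_union_of_disjoint, card_rowGraph h.labels]
  rw [Finset.disjoint_left]
  rintro ⟨i, j⟩ hp hq
  have h1 := (h.below _ hp).1
  have h2 := ((mem_rowGraph h.labels).1 hq).1
  simp only at h1
  omega

lemma pass_iff (h : IsLayered l S C) {j c d : ℕ} :
    Pass (S ∪ rowGraph l C) l j c d ↔ 1 ≤ j ∧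
      c = (perm S)⁻¹ (carryPos C (l + j - 1)) ∧ d = (perm S)⁻¹ (l + j) := by
  rw [RcInsertion.pass_iff h.placed, h.rowsFrom_succ, h.rowLabels_eq]
  exact ⟨fun hh => hh.2, fun hh => ⟨h.one_le, hh⟩⟩

lemma isRcGraph (h : IsLayered l S C) (hS : IsRcGraph S) (hg : GoodRow (perm S) C) :
    IsRcGraph (S ∪ rowGraph l C) := by
  have hS' := isRcGraph_iff.1 hS
  have h0 : 0 ∉ C := fun hm => by
    have := h.labels 0 hm
    have := h.one_le
    omega
  rw [isRcGraph_iff]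
  exact ⟨h.placed, by rw [h.perm_eq, hg.len_eq hS'.1.isFinitary h0, hS'.2, h.card_eq]⟩

lemma insert_eq {p : ℕ} :
    insert (l, p + 1 - l) (S ∪ rowGraph l C) = S ∪ rowGraph l (insert p C) := by
  rw [rowGraph, rowGraph, Finset.image_insert, Finset.union_insert]

lemma erase_eq (h : IsLayered l S C) {p : ℕ} (hp : p ∈ C) :
    (S ∪ rowGraph l C).erase (l, p + 1 - l) = S ∪ rowGraph l (C.erase p) := by
  have hlp := h.labels p hp
  ext ⟨i, j⟩
  rw [Finset.mem_erase, Finset.mem_union, Finset.mem_union, mem_rowGraph h.labels,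
    mem_rowGraph fun q hq => h.labels q (Finset.mem_of_mem_erase hq), Finset.mem_erase]
  simp only [Ne, Prod.mk.injEq]
  constructor
  · rintro ⟨h1, h2 | ⟨rfl, h2, h3⟩⟩
    · exact Or.inl h2
    · exact Or.inr ⟨rfl, h2, fun h4 => h1 ⟨rfl, by omega⟩, h3⟩
  · rintro (h2 | ⟨rfl, h2, h3, h4⟩)
    · refine ⟨fun h3 => ?_, Or.inl h2⟩
      have := (h.below _ h2).1
      simp only at this
      omega
    · exact ⟨fun h5 => h3 (by omega), Or.inr ⟨rfl, h2, h4⟩⟩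

end IsLayered

lemma allowed_iff {r l : ℕ} {S : Graph} {C : Finset ℕ} (h : IsLayered l S C) {j c d : ℕ} :
    Allowed r (S ∪ rowGraph l C) l j c d ↔ 1 ≤ j ∧ IsAllowed r (perm S) C (l + j - 1) ∧
      c = (perm S)⁻¹ (carryPos C (l + j - 1)) ∧ d = (perm S)⁻¹ (l + j) := by
  have hl := h.one_le
  rw [Allowed, h.mem_iff, h.pass_iff, IsAllowed, Nat.sub_add_cancel (by omega)]
  constructor
  · rintro ⟨h1, ⟨h2, rfl, rfl⟩, h3, h4⟩
    exact ⟨h2, ⟨fun h5 => h1 ⟨h2, h5⟩, h3, h4⟩, rfl, rfl⟩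
  · rintro ⟨h1, ⟨h2, h3, h4⟩, rfl, rfl⟩
    exact ⟨fun h5 => h2 h5.2, ⟨h1, rfl, rfl⟩, h3, h4⟩

lemma allowedSecond_iff {r l : ℕ} {S : Graph} {C : Finset ℕ} (h : IsLayered l S C)
    {T : Tableau (ℕ × ℕ)} {j : ℕ} {L : List (ℕ × ℕ)} {e g d : ℕ} :
    AllowedSecond r (S ∪ rowGraph l C) T l j L e g d ↔ 1 ≤ j ∧ T.word = L ++ [(e, g)] ∧
      IsAllowedSecond r (perm S) C g (l + j - 1) ∧ d = (perm S)⁻¹ (l + j) := by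
  have hl := h.one_le
  rw [AllowedSecond, h.mem_iff, h.pass_iff, IsAllowedSecond, Nat.sub_add_cancel (by omega)]
  constructor
  · rintro ⟨h0, h1, ⟨h2, rfl, rfl⟩, h3⟩
    exact ⟨h2, h0, ⟨fun h5 => h1 ⟨h2, h5⟩, rfl, h3⟩, rfl⟩
  · rintro ⟨h1, h0, ⟨h2, h3, h4⟩, rfl⟩
    exact ⟨h0, fun h5 => h2 h5.2, ⟨h1, h3.symm, rfl⟩, h4⟩

/-- The insertion of a crossing at the rightmost allowed place of the row. -/
lemma insertionStep_of {r l : ℕ} {S : Graph} {C : Finset ℕ} (h : IsLayered l S C)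
    (D : YoungDiagram) (L : List (ℕ × ℕ)) {p : ℕ} (hlp : l ≤ p) (hp : IsAllowed r (perm S) C p)
    (hno : ∀ k, p < k → ¬ IsAllowed r (perm S) C k) :
    InsertionStep r l (S ∪ rowGraph l C) ⟨D, L⟩ (S ∪ rowGraph l (insert p C))
      ⟨D, L ++ [((perm S)⁻¹ (carryPos C p), (perm S)⁻¹ (p + 1))]⟩ := by
  have h1 : l + (p + 1 - l) - 1 = p := by omega
  have h2 : l + (p + 1 - l) = p + 1 := by omega
  refine ⟨p + 1 - l, (perm S)⁻¹ (carryPos C p), (perm S)⁻¹ (p + 1), ?_, ?_, ?_, rfl⟩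
  · rw [allowed_iff h, h1, h2]
    exact ⟨by omega, hp, rfl, rfl⟩
  · intro j' c' d' hj hA
    have := (allowed_iff h).1 hA
    exact hno _ (by omega) this.2.1
  · rw [IsLayered.insert_eq]

/-- A rectification of labels gives a rectification of graphs. -/
lemma exists_removal_reinsertion {r l : ℕ} {S : Graph} {C C' : Finset ℕ} (h : IsLayered l S C)
    (hlr : l ≤ r) (hfix : ∀ k ≤ l, perm S k = k) (D : YoungDiagram) {L L' : List (ℕ × ℕ)} {a b : ℕ}
    (hR : RowRectification r (perm S) C L a b C' L') :
    ∃ j₀ Q₂ T₂, RemovalStep l (S ∪ rowGraph l C) ⟨D, L ++ [(a, b)]⟩ j₀ Q₂ T₂ ∧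
      ReinsertionStep r l j₀ Q₂ T₂ (S ∪ rowGraph l C') ⟨D, L'⟩ := by
  obtain ⟨j, L₂, ⟨hj, hjb, hrem⟩, p, hpj, hno, rfl, hins⟩ := hR
  have hlj := h.labels j hj
  have h1 : l + (j + 1 - l) - 1 = j := by omega
  have h2 : l + (j + 1 - l) = j + 1 := by omega
  have hD : IsLayered l S (C.erase j) :=
    ⟨h.one_le, h.below, fun q hq => h.labels q (Finset.mem_of_mem_erase hq)⟩
  refine ⟨j + 1 - l, S ∪ rowGraph l (C.erase j), ⟨D, L₂⟩, ⟨(h.erase_eq hj).symm, ?_⟩, ?_⟩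
  · rcases hrem with ⟨h3, rfl⟩ | ⟨h3, L₀, f, rfl, h4, rfl⟩
    · left
      refine ⟨⟨L₂, a, b, rfl, ?_, ?_⟩, by simp⟩
      · rw [h.mem_iff, h1]; exact ⟨by omega, hj⟩
      · rw [h.pass_iff, h1, h2]; exact ⟨by omega, hjb.symm, h3.symm⟩
    · right
      refine ⟨?_, L₀, a, b, ⟨f, by simp, ?_, ?_⟩, rfl⟩
      · rintro j' ⟨L, a', b', hw, hm, hp⟩
        have h5 := concat_inj hw
        simp only [Prod.mk.injEq] at h5
        obtain ⟨-, rfl, rfl⟩ := h5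
        rw [h.mem_iff] at hm
        rw [h.pass_iff] at hp
        refine h3 _ hm.2 hp.2.1.symm ?_
        rw [Nat.sub_add_cancel (by omega)]
        exact hp.2.2.symm
      · rw [h.mem_iff, h1]; exact ⟨by omega, hj⟩
      · rw [h.pass_iff, h1, h2]; exact ⟨by omega, hjb.symm, h4.symm⟩
  · have hlp : l ≤ p := by
      rcases hins with ⟨hA, -⟩ | ⟨_, _, _, -, hA, -⟩
      · exact le_of_inv_gt hlr hfix hA.2.2
      · exact le_of_inv_gt hlr hfix hA.2.2
    have h3 : l + (p + 1 - l) - 1 = p := by omega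
    have h4 : l + (p + 1 - l) = p + 1 := by omega
    refine ⟨p + 1 - l, by omega, ?_, IsLayered.insert_eq.symm, ?_⟩
    · intro j' hj1 hj2
      obtain ⟨h5, h6⟩ := hno (l + j' - 1) (by omega) (by omega)
      refine ⟨fun c d hA => h5 ((allowed_iff hD).1 hA).2.1, fun L e g d hA => ?_⟩
      have := (allowedSecond_iff hD).1 hA
      exact h6 _ _ _ this.2.1 this.2.2.1
    · rcases hins with ⟨hA, rfl⟩ | ⟨L₀, e, g, rfl, hA, rfl⟩
      · left
        refine ⟨_, _, ?_, rfl⟩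
        rw [allowed_iff hD, h3, h4]
        exact ⟨by omega, hA, rfl, rfl⟩
      · right
        refine ⟨L₀, e, g, _, ?_, rfl⟩
        rw [allowedSecond_iff hD, h3, h4]
        exact ⟨by omega, rfl, hA, rfl⟩

/-! ### Removing crossings along a chain -/

lemma simple_mul_eq_mul_swap {u : Perm ℕ} {a b i : ℕ} (ha : u a = i) (hb : u b = i + 1) :
    simple i * u = u * swap a b := by
  have := swap_apply_apply u a b
  rw [ha, hb] at this
  rw [simple, this]
  simp [mul_assoc]

/-- The exchange condition: an inversion of `w` is undone by deleting a letter of a word of `w`. -/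
lemma exists_delete (L : List ℕ) {a b : ℕ} (hab : a < b) (h : wordPerm L b < wordPerm L a) :
    ∃ L₁ i L₂, L = L₁ ++ i :: L₂ ∧ wordPerm (L₁ ++ L₂) = wordPerm L * swap a b := by
  induction L with
  | nil => simp at h; omega
  | cons i L ih =>
    rcases lt_or_gt_of_ne ((wordPerm L).injective.ne hab.ne') with h1 | h1
    · obtain ⟨L₁, k, L₂, rfl, h2⟩ := ih h1
      refine ⟨i :: L₁, k, L₂, rfl, ?_⟩
      rw [List.cons_append, wordPerm_cons, h2, wordPerm_cons, mul_assoc]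
    · refine ⟨[], i, L, rfl, ?_⟩
      rw [wordPerm_cons, Perm.mul_apply, Perm.mul_apply, simple_apply, simple_apply] at h
      have h2 : wordPerm L a = i ∧ wordPerm L b = i + 1 := by
        split_ifs at h <;> omega
      rw [wordPerm_cons, mul_assoc, ← simple_mul_eq_mul_swap h2.1 h2.2, ← mul_assoc,
        simple_mul_self]
      simp

/-- In a reduced word different deletions give different permutations. -/
lemma delete_ne {A B E : List ℕ} {i k : ℕ} (hL : ∀ m ∈ A ++ i :: B ++ k :: E, 1 ≤ m)
    (hlen : len (wordPerm (A ++ i :: B ++ k :: E)) = (A ++ i :: B ++ k :: E).length) :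
    wordPerm (A ++ B ++ k :: E) ≠ wordPerm (A ++ i :: B ++ E) := by
  intro h
  have h1 : wordPerm (A ++ i :: B ++ k :: E) = wordPerm (A ++ B ++ E) := by
    simp only [wordPerm_append, wordPerm_cons, mul_assoc, mul_right_inj] at h ⊢
    rw [h, ← mul_assoc, simple_mul_self, one_mul]
  have h2 : len (wordPerm (A ++ B ++ E)) ≤ (A ++ B ++ E).length := by
    refine len_wordPerm_le fun m hm => hL m ?_
    simp only [List.mem_append, List.mem_cons] at hm ⊢
    tauto
  rw [h1] at hlen
  simp only [List.length_append, List.length_cons] at hlen h2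
  omega

lemma sort_erase {R : Graph} {A B : List (ℕ × ℕ)} {p : ℕ × ℕ}
    (h : R.sort ReadBefore = A ++ p :: B) : (R.erase p).sort ReadBefore = A ++ B := by
  have h1 := R.pairwise_sort ReadBefore
  have h2 := R.sort_nodup ReadBefore
  have h3 : ∀ q, q ∈ A ++ p :: B ↔ q ∈ R := fun q => by rw [← h, Finset.mem_sort]
  rw [h] at h1 h2
  have hsub : (A ++ B).Sublist (A ++ p :: B) := by simp
  apply sort_eq_of_perm
  · exact h1.sublist hsub
  · exact h2.sublist hsub
  · intro q
    rw [Finset.mem_erase, ← h3]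
    have h4 : p ∉ A ++ B := (List.nodup_middle.1 h2).notMem
    simp only [List.mem_append, List.mem_cons] at h4 ⊢
    constructor
    · intro hq
      refine ⟨?_, by tauto⟩
      rintro rfl
      exact h4 hq
    · tauto

lemma exists_erase {R : Graph} {a b : ℕ} (hab : a < b) (h : perm R b < perm R a) :
    ∃ p ∈ R, perm (R.erase p) = perm R * swap a b := by
  obtain ⟨L₁, i, L₂, h1, h2⟩ := exists_delete (graphWord R) hab h
  unfold graphWord at h1
  rw [List.map_eq_append_iff] at h1
  obtain ⟨A, M, h3, h4, h5⟩ := h1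
  rw [List.map_eq_cons_iff] at h5
  obtain ⟨p, B, rfl, rfl, rfl⟩ := h5
  refine ⟨p, ?_, ?_⟩
  · rw [← Finset.mem_sort (r := ReadBefore), h3]
    simp
  · rw [perm, graphWord, sort_erase h3, List.map_append, h4, h2, perm]

lemma erase_unique {R : Graph} (hR : IsRcGraph R) {p q : ℕ × ℕ} (hp : p ∈ R) (hq : q ∈ R)
    (h : perm (R.erase p) = perm (R.erase q)) : p = q := by
  by_contra hne
  have key : ∀ A B E : List (ℕ × ℕ), ∀ p q, R.sort ReadBefore = A ++ p :: B ++ q :: E →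
      perm (R.erase p) ≠ perm (R.erase q) := by
    intro A B E p q hs
    have h1 := sort_erase (R := R) (A := A) (B := B ++ q :: E) (p := p) (by rw [hs]; simp)
    have h2 := sort_erase (R := R) (A := A ++ p :: B) (B := E) (p := q) hs
    obtain ⟨h3, h4, -, h5⟩ := hR
    rw [perm, perm, graphWord, graphWord, h1, h2]
    rw [perm] at h5
    have e : graphWord R = A.map (fun p => p.1 + p.2 - 1) ++
        (p.1 + p.2 - 1) :: B.map (fun p => p.1 + p.2 - 1) ++
        (q.1 + q.2 - 1) :: E.map (fun p => p.1 + p.2 - 1) := by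
      rw [graphWord, hs]; simp
    rw [e] at h5 h4
    have := delete_ne h4 h5.symm
    simpa using this
  obtain ⟨A, B, hs⟩ := List.append_of_mem ((Finset.mem_sort (r := ReadBefore)).2 hp)
  have hq' := (Finset.mem_sort (r := ReadBefore)).2 hq
  rw [hs, List.mem_append, List.mem_cons] at hq'
  rcases hq' with hq' | rfl | hq'
  · obtain ⟨A₁, A₂, rfl⟩ := List.append_of_mem hq'
    exact key A₁ A₂ B q p hs h.symm
  · exact hne rfl
  · obtain ⟨B₁, B₂, rfl⟩ := List.append_of_mem hq'
    exact key A B₁ B₂ p q (by rw [hs]; simp) h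

/-- The graphs `S_0, …, S_m` exist for every package. -/
lemma exists_backtrack {r : ℕ} {w : Perm ℕ} (hw : IsFinitary w) (L : List (ℕ × ℕ)) (U : Graph)
    (hU : IsRcGraph U) (hp : perm U = w * chainProd L) (hL : CoverChain r w L) :
    ∃ S : ℕ → Graph, S L.length = U ∧
      (∀ j < L.length, ∃ p ∈ S (j + 1), S j = (S (j + 1)).erase p) ∧
      ∀ j ≤ L.length, IsRcGraph (S j) ∧ perm (S j) = w * chainProd (L.take j) := by
  induction L using List.reverseRecOn generalizing U with
  | nil => exact ⟨fun _ => U, rfl, by simp, by simpa using ⟨hU, by simpa using hp⟩⟩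
  | append_singleton L x ih =>
    obtain ⟨a, b⟩ := x
    obtain ⟨ha, har, hb, hc⟩ := hL.last
    have hp' : perm U = w * chainProd L * swap a b := by rw [hp]; simp [mul_assoc]
    obtain ⟨p, hpU, he⟩ := exists_erase (R := U) hc.1 (by rw [hp']; simpa using hc.2.1)
    have he' : perm (U.erase p) = w * chainProd L := by
      rw [he, hp', mul_assoc, swap_mul_self, mul_one]
    have hrc : IsRcGraph (U.erase p) := by
      rw [isRcGraph_iff] at hU ⊢
      refine ⟨hU.1.subset (Finset.erase_subset _ _), ?_⟩
      have h1 := hc.len_eq (hL.of_append.isFinitary hw) ha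
      rw [← hp', hU.2] at h1
      have h2 := Finset.card_erase_add_one hpU
      rw [he']
      omega
    obtain ⟨S, h1, h2, h3⟩ := ih _ hrc he' hL.of_append
    refine ⟨fun j => if j ≤ L.length then S j else U, by simp, ?_, ?_⟩
    · intro j hj
      simp only [List.length_append, List.length_singleton] at hj
      have hj1 : j ≤ L.length := by omega
      by_cases hj' : j + 1 ≤ L.length
      · simp only [if_pos hj', if_pos hj1]
        exact h2 j hj'
      · simp only [if_neg hj', if_pos hj1]
        have : j = L.length := by omega
        subst this
        exact ⟨p, hpU, h1⟩
    · intro j hj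
      simp only [List.length_append, List.length_singleton] at hj
      by_cases hj' : j ≤ L.length
      · simp only [if_pos hj']
        rw [List.take_append_of_le_length hj']
        exact h3 j hj'
      · simp only [if_neg hj']
        rw [List.take_of_length_le (by simp; omega)]
        exact ⟨hU, hp⟩

/-- The graphs `S_0, …, S_m` are unique. -/
lemma backtrack_unique {w : Perm ℕ} {U : Graph} {T : Tableau (ℕ × ℕ)} {S S' : ℕ → Graph}
    (hS : ∀ j ≤ T.word.length, IsRcGraph (S j)) (h : IsBacktrack w U T S)
    (h' : IsBacktrack w U T S') {j : ℕ} (hj : j ≤ T.word.length) : S' j = S j := by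
  induction hn : T.word.length - j generalizing j with
  | zero =>
    have : j = T.word.length := by omega
    rw [this, h.1, h'.1]
  | succ n ih =>
    have e := ih (j := j + 1) (by omega) (by omega)
    obtain ⟨⟨p, hp, h1⟩, h2⟩ := h.2 j (by omega)
    obtain ⟨⟨q, hq, h3⟩, h4⟩ := h'.2 j (by omega)
    rw [e] at hq h3
    have : q = p := erase_unique (hS (j + 1) (by omega)) hq hp (by rw [← h1, ← h3, h2, h4])
    rw [h1, h3, this]

/-! ### The recording graph -/

lemma card_rowLabels {R : Graph} (hR : IsPlaced R) (l : ℕ) :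
    (rowLabels R l).card = (row R l).card := by
  rw [rowLabels, Finset.card_image_of_injOn]
  intro p hp q hq h
  have hp' := Finset.mem_filter.1 hp
  have hq' := Finset.mem_filter.1 hq
  have h1 := hR p hp'.1
  have h2 := hR q hq'.1
  simp only at h
  have h3 := hp'.2
  have h4 := hq'.2
  apply Prod.ext <;> omega

lemma card_rowsFrom_eq {R : Graph} (hR : IsPlaced R) (l : ℕ) :
    (rowsFrom R l).card = (rowLabels R l).card + (rowsFrom R (l + 1)).card := by
  rw [rowsFrom_eq_union, Finset.card_union_of_disjoint, card_rowLabels hR]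
  rw [Finset.disjoint_left]
  intro p hp hq
  have hp' := (Finset.mem_filter.1 hp).2
  have hq' := (Finset.mem_filter.1 hq).2
  omega

/-- The lower part of an rc-graph is an rc-graph, to which the next row is added in a
length-increasing way. -/
lemma IsRcGraph.lower {R : Graph} (hR : IsRcGraph R) {l : ℕ} (hl : 1 ≤ l) :
    IsRcGraph (rowsFrom R l) ∧
      GoodRow (perm (rowsFrom R (l + 1))) (rowLabels R l) := by
  have hP := (isRcGraph_iff.1 hR).1
  have hsub : ∀ m, IsPlaced (rowsFrom R m) := fun m =>
    hP.subset (Finset.filter_subset _ _)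
  have hC : ∀ m, 1 ≤ m → 0 ∉ rowLabels R m := fun m hm h0 => by
    have := rowLabels_ge hP h0
    omega
  have key : ∀ m, 1 ≤ m → len (perm (rowsFrom R m)) = (rowsFrom R m).card →
      len (perm (rowsFrom R (m + 1))) = (rowsFrom R (m + 1)).card ∧
      GoodRow (perm (rowsFrom R (m + 1))) (rowLabels R m) := fun m hm h => by
    have h1 := len_rowPerm_mul (hsub (m + 1)).isFinitary (hC m hm)
    rw [perm_rowsFrom hm, card_rowsFrom_eq hP m] at h
    have h2 : len (perm (rowsFrom R (m + 1))) ≤ (rowsFrom R (m + 1)).card := by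
      have := len_wordPerm_le (hsub (m + 1)).letters
      rwa [length_graphWord] at this
    have h3 : len (perm (rowsFrom R (m + 1))) =
        (rowsFrom R (m + 1)).card := by omega
    exact ⟨h3, h1.2.1 (by omega)⟩
  have h1 : rowsFrom R 1 = R := Finset.filter_true_of_mem fun p hp => (hP p hp).1
  have hall : ∀ m, 1 ≤ m →
      len (perm (rowsFrom R m)) = (rowsFrom R m).card := by
    intro m hm
    induction m, hm using Nat.le_induction with
    | base => rw [h1]; exact (isRcGraph_iff.1 hR).2
    | succ m hm ih => exact (key m hm ih).1
  exact ⟨isRcGraph_iff.2 ⟨hsub l, hall l hl⟩, (key l hl (hall l hl)).2⟩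

lemma rowsFrom_one {R : Graph} (hR : IsPlaced R) : rowsFrom R 1 = R :=
  Finset.filter_true_of_mem fun p hp => (hR p hp).1

lemma row_eq_rowGraph {R : Graph} (hR : IsPlaced R) {l : ℕ} (hl : 1 ≤ l) :
    row R l = rowGraph l (rowLabels R l) := by
  ext ⟨i, j⟩
  rw [mem_rowGraph fun p hp => rowLabels_ge hR hp]
  simp only [row, Finset.mem_filter]
  constructor
  · rintro ⟨h, rfl⟩
    exact ⟨rfl, (hR _ h).2, (mem_rowLabels hl).2 h⟩
  · rintro ⟨rfl, h1, h2⟩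
    exact ⟨(mem_rowLabels hl).1 h2, rfl⟩

lemma GoodRow.lt_of_lt {u : Perm ℕ} {C : Finset ℕ} (h : GoodRow u C) {i k : ℕ} (hik : i < k)
    (hw : (rowPerm C * u) i < (rowPerm C * u) k) : u i < u k := by
  by_contra hn
  have hne : u i ≠ u k := fun e => by
    have := u.injective e
    omega
  have := goodRow_iff.1 h k i (by omega) hw
  omega

lemma GoodRow.isShuffle {r : ℕ} {u : Perm ℕ} {C : Finset ℕ} (h : GoodRow u C)
    (hw : IsShuffle (rowPerm C * u) r) : IsShuffle u r :=
  fun i hi hir => h.lt_of_lt (Nat.lt_succ_self i) (hw i hi hir)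

lemma GoodRow.isSemiShuffle {r : ℕ} {u : Perm ℕ} {C : Finset ℕ} (h : GoodRow u C)
    (hw : IsSemiShuffle (rowPerm C * u) r) : IsSemiShuffle u r :=
  fun i hi => h.lt_of_lt (Nat.lt_succ_self i) (hw i hi)

lemma IsShuffle.lt_of_le {r : ℕ} {v : Perm ℕ} (h : IsShuffle v r) {i k : ℕ} (hi : 1 ≤ i)
    (hik : i < k) (hk : k ≤ r) : v i < v k := by
  induction k, hik using Nat.le_induction with
  | base => exact h i hi (by omega)
  | succ k hk' ih => exact (ih (by omega)).trans (h k (by omega) (by omega))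

lemma IsSemiShuffle.lt {r : ℕ} {v : Perm ℕ} (h : IsSemiShuffle v r) {i k : ℕ} (hi : r < i)
    (hik : i < k) : v i < v k := by
  induction k, hik using Nat.le_induction with
  | base => exact h i hi
  | succ k hk' ih => exact ih.trans (h k (by omega))

lemma IsShuffle.isSemiShuffle {r : ℕ} {v : Perm ℕ} (h : IsShuffle v r) : IsSemiShuffle v r :=
  fun i hi => h i (by omega) (by omega)

lemma GoodRow.crossing_small_big {r : ℕ} {u : Perm ℕ} {C : Finset ℕ} (hg : GoodRow u C)
    (hu : IsFinitary u) (hC : 0 ∉ C) (hw : IsShuffle (rowPerm C * u) r) {p : ℕ} (hp : p ∈ C) :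
    u⁻¹ (carryPos C p) ≤ r ∧ r < u⁻¹ (p + 1) := by
  have hlt := hg p hp
  have h1 : (rowPerm C * u) (u⁻¹ (p + 1)) < (rowPerm C * u) (u⁻¹ (carryPos C p)) := by
    rw [Perm.mul_apply, Perm.mul_apply, perm_apply_inv, perm_apply_inv, rowPerm_of_mem hp]
    exact lt_rowPerm_carryPos hp
  have h0 : 1 ≤ u⁻¹ (carryPos C p) := by
    have h2 : 1 ≤ carryPos C p := one_le_carryPos hC (by
      rcases Nat.eq_zero_or_pos p with rfl | h
      · exact absurd hp hC
      · exact h)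
    rcases Nat.eq_zero_or_pos (u⁻¹ (carryPos C p)) with h | h
    · have h3 := perm_apply_inv u (carryPos C p)
      rw [h, hu.apply_zero] at h3
      omega
    · exact h
  constructor
  · by_contra hn
    exact absurd (hw.isSemiShuffle.lt (by omega) hlt) (by omega)
  · by_contra hn
    exact absurd (hw.lt_of_le h0 hlt (by omega)) (by omega)

/-- In the recording graph the crossings of a row on a small strand form an interval. -/
lemma GoodRow.filter_carryPos {r : ℕ} {u : Perm ℕ} {C : Finset ℕ} (hg : GoodRow u C)
    (hu : IsFinitary u) (hC : 0 ∉ C) (hw : IsShuffle (rowPerm C * u) r) {s : ℕ} (hs : s ≤ r) :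
    u s ≤ (rowPerm C * u) s ∧
      (C.filter fun p => carryPos C p = u s) = Finset.Ico (u s) ((rowPerm C * u) s) := by
  rw [Perm.mul_apply]
  obtain ⟨h1, h2⟩ | ⟨h1, h2, h3⟩ := rowPerm_cases C (u s)
  · have := (hg.crossing_small_big hu hC hw h1).2
    rw [h2, perm_inv_apply] at this
    omega
  refine ⟨h2, ?_⟩
  ext p
  rw [Finset.mem_filter, Finset.mem_Ico]
  constructor
  · rintro ⟨hp, hps⟩
    exact ⟨hps ▸ carryPos_le C p, hps ▸ lt_rowPerm_carryPos hp⟩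
  · rintro ⟨h4, h5⟩
    have := carryPos_spec (C := C) (q := rowPerm C (u s)) (p := p) (by omega) h5.le
    exact ⟨this.2 h5, this.1.trans h3⟩

lemma GoodRow.interlace {r : ℕ} {u : Perm ℕ} {C : Finset ℕ} (hg : GoodRow u C)
    (hu : IsFinitary u) (hC : 0 ∉ C) (hw : IsShuffle (rowPerm C * u) r) {s : ℕ} (hs1 : 1 ≤ s)
    (hs : s + 1 ≤ r) : (rowPerm C * u) s < u (s + 1) := by
  by_contra hn
  have h1 := (hg.isShuffle hw) s hs1 (by omega)
  have h2 := (hg.filter_carryPos hu hC hw (s := s) (by omega)).2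
  have h3 : u (s + 1) - 1 ∈ Finset.Ico (u s) ((rowPerm C * u) s) :=
    Finset.mem_Ico.2 ⟨by omega, by omega⟩
  rw [← h2] at h3
  have h4 := (hg.crossing_small_big hu hC hw (Finset.mem_filter.1 h3).1).2
  rw [show u (s + 1) - 1 + 1 = u (s + 1) by omega, perm_inv_apply] at h4
  omega

lemma rowsFrom_rowsFrom (R : Graph) {l m : ℕ} (h : l ≤ m) :
    rowsFrom (rowsFrom R l) m = rowsFrom R m := by
  ext p
  simp only [rowsFrom, Finset.mem_filter]
  constructor
  · rintro ⟨⟨h1, h2⟩, h3⟩; exact ⟨h1, h3⟩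
  · rintro ⟨h1, h3⟩; exact ⟨⟨h1, by omega⟩, h3⟩

lemma rowLabels_rowsFrom (R : Graph) {l m : ℕ} (h : l ≤ m) :
    rowLabels (rowsFrom R l) m = rowLabels R m := by
  have : row (rowsFrom R l) m = row R m := by
    ext p
    simp only [row, rowsFrom, Finset.mem_filter]
    constructor
    · rintro ⟨⟨h1, h2⟩, h3⟩; exact ⟨h1, h3⟩
    · rintro ⟨h1, h3⟩; exact ⟨⟨h1, by omega⟩, h3⟩
  rw [rowLabels, this, rowLabels]

lemma enters_rowsFrom {R : Graph} (hR : IsPlaced R) {l k i j : ℕ} {side : Side} (h : l ≤ i) :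
    Enters (rowsFrom R l) k side i j ↔ Enters R k side i j := by
  have h1 : IsPlaced (rowsFrom R l) := hR.subset (Finset.filter_subset _ _)
  cases side with
  | left =>
    rw [enters_left_iff hR, enters_left_iff h1, rowsFrom_rowsFrom R (by omega),
      rowLabels_rowsFrom R h]
  | below =>
    rw [enters_below_iff hR, enters_below_iff h1, rowsFrom_rowsFrom R (by omega)]

lemma sort_add_replicate {A : Multiset ℕ} {l n : ℕ} (h : ∀ k ∈ A, l < k) :
    (A + Multiset.replicate n l).sort (· ≥ ·) = A.sort (· ≥ ·) ++ List.replicate n l := by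
  refine List.Perm.eq_of_pairwise' (r := (· ≥ ·)) (Multiset.pairwise_sort _ _) ?_ ?_
  · rw [List.pairwise_append]
    refine ⟨Multiset.pairwise_sort _ _, List.pairwise_replicate.2 (Or.inr le_rfl), ?_⟩
    intro x hx y hy
    rw [List.eq_of_mem_replicate hy]
    exact (h x ((Multiset.mem_sort _).1 hx)).le
  · rw [← Multiset.coe_eq_coe, ← Multiset.coe_add, Multiset.sort_eq, Multiset.sort_eq]
    rfl

/-- The word of a small strand of the recording graph grows at its end, by one letter for each
crossing in the new row. -/
lemma strandWord_rowsFrom {r : ℕ} {Y : Graph} (hY : IsRcGraph Y) {l : ℕ} (hl : 1 ≤ l)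
    (hw : IsShuffle (perm (rowsFrom Y l)) r) {s : ℕ} (hs : s ≤ r) :
    strandWord (rowsFrom Y l) s = strandWord (rowsFrom Y (l + 1)) s ++
      List.replicate (perm (rowsFrom Y l) s - perm (rowsFrom Y (l + 1)) s) l := by
  classical
  have hP := (isRcGraph_iff.1 hY).1
  have hg := (hY.lower hl).2
  have hu : IsFinitary (perm (rowsFrom Y (l + 1))) :=
    (hP.subset (Finset.filter_subset _ _)).isFinitary
  have hC : 0 ∉ rowLabels Y l := fun h0 => by
    have := rowLabels_ge hP h0
    omega
  rw [perm_rowsFrom hl] at hw ⊢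
  set u := perm (rowsFrom Y (l + 1)) with hudef
  set C := rowLabels Y l with hCdef
  obtain ⟨-, hI⟩ := hg.filter_carryPos hu hC hw hs
  have hsplit : ((rowsFrom Y l).filter fun p => ∃ side, Enters (rowsFrom Y l) s side p.1 p.2) =
      ((rowsFrom Y (l + 1)).filter fun p => ∃ side, Enters (rowsFrom Y (l + 1)) s side p.1 p.2) ∪
      rowGraph l (C.filter fun p => carryPos C p = u s) := by
    ext ⟨i, j⟩
    rw [Finset.mem_union, mem_rowGraph fun p hp => rowLabels_ge hP (Finset.mem_filter.1 hp).1]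
    simp only [Finset.mem_filter, rowsFrom_eq_union Y l, Finset.mem_union]
    constructor
    · rintro ⟨h1 | h1, side, h2⟩
      · have hil : i = l := (Finset.mem_filter.1 h1).2
        rw [← rowsFrom_eq_union] at h2
        subst hil
        have hjC : i + j - 1 ∈ C := (mem_rowLabels hl).2 (Finset.mem_filter.1 h1).1
        have hj : 1 ≤ j := (hP _ (Finset.mem_filter.1 h1).1).2
        rw [enters_rowsFrom hP le_rfl] at h2
        refine Or.inr ⟨rfl, hj, hjC, ?_⟩
        cases side with
        | left =>
          rw [enters_left_iff hP] at h2
          rw [h2.2.2, ← hudef, perm_apply_inv]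
        | below =>
          rw [enters_below_iff hP] at h2
          have := (hg.crossing_small_big hu hC hw hjC).2
          rw [show i + j - 1 + 1 = i + j by omega] at this
          have h3 := h2.2
          rw [← hudef] at h3
          omega
      · refine Or.inl ⟨h1, side, ?_⟩
        rw [← rowsFrom_eq_union] at h2
        have hil : l + 1 ≤ i := (Finset.mem_filter.1 h1).2
        rw [enters_rowsFrom hP (by omega)] at h2
        rwa [enters_rowsFrom hP hil]
    · rintro (⟨h1, side, h2⟩ | ⟨rfl, hj, hjC, h⟩)
      · refine ⟨Or.inr h1, side, ?_⟩
        rw [← rowsFrom_eq_union]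
        have hil : l + 1 ≤ i := (Finset.mem_filter.1 h1).2
        rw [enters_rowsFrom hP hil] at h2
        rwa [enters_rowsFrom hP (by omega)]
      · refine ⟨Or.inl (Finset.mem_filter.2 ⟨(mem_rowLabels hl).1 hjC, rfl⟩), .left, ?_⟩
        rw [← rowsFrom_eq_union, enters_rowsFrom hP le_rfl, enters_left_iff hP, ← hudef, ← hCdef, h,
          perm_inv_apply]
        exact ⟨hl, hj, rfl⟩
  have hdisj : Disjoint
      ((rowsFrom Y (l + 1)).filter fun p => ∃ side, Enters (rowsFrom Y (l + 1)) s side p.1 p.2)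
      (rowGraph l (C.filter fun p => carryPos C p = u s)) := by
    rw [Finset.disjoint_left]
    rintro ⟨i, j⟩ hp hq
    have h1 := (Finset.mem_filter.1 (Finset.mem_filter.1 hp).1).2
    have h2 := ((mem_rowGraph fun p hp => rowLabels_ge hP (Finset.mem_filter.1 hp).1).1 hq).1
    simp only at h1
    omega
  have hrep : (rowGraph l (C.filter fun p => carryPos C p = u s)).val.map Prod.fst =
      Multiset.replicate ((rowPerm C * u) s - u s) l := by
    rw [Multiset.eq_replicate]
    constructor
    · rw [Multiset.card_map, Finset.card_val,
        card_rowGraph fun p hp => rowLabels_ge hP (Finset.mem_filter.1 hp).1, hI, Nat.card_Ico]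
    · intro b hb
      obtain ⟨⟨i, j⟩, hp, rfl⟩ := Multiset.mem_map.1 hb
      exact ((mem_rowGraph fun p hp => rowLabels_ge hP (Finset.mem_filter.1 hp).1).1 hp).1
  unfold strandWord
  rw [Finset.filter_congr_decidable, hsplit, ← Finset.disjUnion_eq_union _ _ hdisj,
    Finset.disjUnion_val, Multiset.map_add, hrep, sort_add_replicate]
  intro k hk
  obtain ⟨p, hp, rfl⟩ := Multiset.mem_map.1 hk
  exact (Finset.mem_filter.1 (Finset.mem_filter.1 hp).1).2

lemma lt_of_mem_strandWord {Y : Graph} {l s k : ℕ} (hk : k ∈ strandWord (rowsFrom Y (l + 1)) s) :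
    l < k := by
  classical
  rw [strandWord, Multiset.mem_sort] at hk
  obtain ⟨p, hp, rfl⟩ := Multiset.mem_map.1 hk
  exact (Finset.mem_filter.1 (Finset.mem_filter.1 hp).1).2

/-! ### Shapes and the numbering of boxes -/

/-- The rows of length `m 0, m 1, …` are numbered from the bottom up; `rowOffset m t` is the number
of boxes in the first `t` of them. -/
def rowOffset (m : ℕ → ℕ) (t : ℕ) : ℕ := ∑ i ∈ Finset.range t, m i

lemma rowOffset_zero (m : ℕ → ℕ) : rowOffset m 0 = 0 := rfl

lemma rowOffset_succ (m : ℕ → ℕ) (t : ℕ) : rowOffset m (t + 1) = rowOffset m t + m t :=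
  Finset.sum_range_succ _ _

lemma rowOffset_mono (m : ℕ → ℕ) {s t : ℕ} (h : s ≤ t) : rowOffset m s ≤ rowOffset m t := by
  induction t, h using Nat.le_induction with
  | base => rfl
  | succ t _ ih => rw [rowOffset_succ]; omega

lemma rowOffset_add_inj {m : ℕ → ℕ} {s t i j : ℕ} (hi : i < m s) (hj : j < m t)
    (h : rowOffset m s + i = rowOffset m t + j) : s = t ∧ i = j := by
  have aux : ∀ s t i j, i < m s → rowOffset m s + i = rowOffset m t + j → ¬ s < t := by
    intro s t i j hi h hst
    have := rowOffset_mono m (show s + 1 ≤ t from hst)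
    rw [rowOffset_succ] at this
    omega
  have h1 := aux s t i j hi h
  have h2 := aux t s j i hj h.symm
  have h3 : s = t := by omega
  subst h3
  exact ⟨rfl, by omega⟩

/-- `D` has at most `r` rows, and `m 0, …, m (r - 1)` are their lengths, from the bottom up. -/
def HasRows (r : ℕ) (D : YoungDiagram) (m : ℕ → ℕ) : Prop :=
  D.rowLen r = 0 ∧ ∀ t < r, D.rowLen (r - 1 - t) = m t

lemma HasRows.unique {r : ℕ} {D D' : YoungDiagram} {m : ℕ → ℕ} (h : HasRows r D m)
    (h' : HasRows r D' m) : D = D' := by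
  have key : ∀ i, D.rowLen i = D'.rowLen i := fun i => by
    rcases lt_or_ge i r with hi | hi
    · have h1 := h.2 (r - 1 - i) (by omega)
      have h2 := h'.2 (r - 1 - i) (by omega)
      rw [show r - 1 - (r - 1 - i) = i by omega] at h1 h2
      rw [h1, h2]
    · have h1 := D.rowLen_anti r i hi
      have h2 := D'.rowLen_anti r i hi
      have h3 := h.1
      have h4 := h'.1
      omega
  ext ⟨i, j⟩
  rw [YoungDiagram.mem_cells, YoungDiagram.mem_cells, YoungDiagram.mem_iff_lt_rowLen,
    YoungDiagram.mem_iff_lt_rowLen, key]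

lemma HasRows.mono {r : ℕ} {D : YoungDiagram} {m : ℕ → ℕ} (h : HasRows r D m) {s t : ℕ}
    (hst : s ≤ t) (ht : t < r) : m s ≤ m t := by
  rw [← h.2 s (by omega), ← h.2 t ht]
  exact D.rowLen_anti _ _ (by omega)

lemma exists_hasRows {r : ℕ} {m : ℕ → ℕ} (hm : ∀ t, t + 1 < r → m t ≤ m (t + 1)) :
    ∃ D, HasRows r D m := by
  have hmono : ∀ s t, s ≤ t → t < r → m s ≤ m t := by
    intro s t hst
    induction t, hst using Nat.le_induction with
    | base => exact fun _ => le_rfl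
    | succ t _ ih => exact fun h => (ih (by omega)).trans (hm t h)
  let f : ℕ → ℕ := fun i => if i < r then m (r - 1 - i) else 0
  let D : YoungDiagram :=
    { cells := (Finset.range r ×ˢ Finset.range (f 0)).filter fun c => c.2 < f c.1
      isLowerSet := by
        rintro ⟨i, j⟩ ⟨i', j'⟩ ⟨h1, h2⟩ h
        simp only [Finset.coe_filter, Finset.mem_product, Finset.mem_range, Set.mem_ofPred_eq, f]
          at h ⊢
        simp only at h1 h2
        obtain ⟨⟨h3, h4⟩, h5⟩ := h
        rw [if_pos h3] at h5
        have h6 := hmono (r - 1 - i) (r - 1 - i') (by omega) (by omega)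
        rw [if_pos (by omega : i' < r)]
        refine ⟨⟨by omega, by omega⟩, by omega⟩ }
  have hmem : ∀ i j, (i, j) ∈ D ↔ j < f i := by
    intro i j
    rw [← YoungDiagram.mem_cells]
    simp only [D, Finset.mem_filter, Finset.mem_product, Finset.mem_range]
    constructor
    · exact fun h => h.2
    · intro h
      by_cases hi : i < r
      · refine ⟨⟨hi, ?_⟩, h⟩
        simp only [f] at h ⊢
        rw [if_pos hi] at h
        rw [if_pos (by omega : 0 < r)]
        have h6 := hmono (r - 1 - i) (r - 1 - 0) (by omega) (by omega)
        omega
      · simp only [f] at h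
        rw [if_neg hi] at h
        omega
  have hrow : ∀ i, D.rowLen i = f i := fun i => by
    have h1 := (YoungDiagram.mem_iff_lt_rowLen (μ := D) (i := i) (j := f i))
    have h2 := (YoungDiagram.mem_iff_lt_rowLen (μ := D) (i := i) (j := D.rowLen i))
    rw [hmem] at h1 h2
    have h3 : ¬ f i < D.rowLen i := fun h => lt_irrefl _ (h1.2 h)
    have h4 : ¬ D.rowLen i < f i := fun h => lt_irrefl _ (h2.1 h)
    omega
  refine ⟨D, ?_, fun t ht => ?_⟩
  · rw [hrow]; exact if_neg (lt_irrefl r)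
  · rw [hrow]
    simp only [f]
    rw [if_pos (by omega), show r - 1 - (r - 1 - t) = t by omega]

lemma HasRows.card_below {r : ℕ} {D : YoungDiagram} {m : ℕ → ℕ} (h : HasRows r D m) (t : ℕ)
    (ht : t ≤ r) : (D.cells.filter fun d => r ≤ d.1 + t).card = rowOffset m t := by
  induction t with
  | zero =>
    rw [rowOffset_zero, Finset.card_eq_zero, Finset.filter_eq_empty_iff]
    rintro ⟨i, j⟩ hd hr
    rw [YoungDiagram.mem_cells, YoungDiagram.mem_iff_lt_rowLen] at hd
    have h1 := D.rowLen_anti r i hr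
    have h2 := h.1
    omega
  | succ t ih =>
    have hsplit : (D.cells.filter fun d => r ≤ d.1 + (t + 1)) =
        (D.cells.filter fun d => r ≤ d.1 + t) ∪ D.row (r - 1 - t) := by
      ext d
      rw [Finset.mem_union, Finset.mem_filter, Finset.mem_filter, YoungDiagram.row,
        Finset.mem_filter]
      constructor
      · rintro ⟨h1, h2⟩
        by_cases h3 : r ≤ d.1 + t
        · exact Or.inl ⟨h1, h3⟩
        · exact Or.inr ⟨h1, by omega⟩
      · rintro (⟨h1, h2⟩ | ⟨h1, h2⟩)
        · exact ⟨h1, by omega⟩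
        · exact ⟨h1, by omega⟩
    rw [hsplit, Finset.card_union_of_disjoint, ih (by omega), rowOffset_succ,
      ← YoungDiagram.rowLen_eq_card, h.2 t (by omega)]
    rw [Finset.disjoint_left]
    intro d hd hd'
    have h1 := (Finset.mem_filter.1 hd).2
    have h2 := (Finset.mem_filter.1 hd').2
    omega

lemma HasRows.card {r : ℕ} {D : YoungDiagram} {m : ℕ → ℕ} (h : HasRows r D m) :
    D.card = rowOffset m r := by
  rw [← h.card_below r le_rfl, YoungDiagram.card, Finset.filter_true_of_mem]
  intro d _
  omega

lemma HasRows.mem_iff {r : ℕ} {D : YoungDiagram} {m : ℕ → ℕ} (h : HasRows r D m) {i j : ℕ} :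
    (i, j) ∈ D ↔ i < r ∧ j < m (r - 1 - i) := by
  rw [YoungDiagram.mem_iff_lt_rowLen]
  rcases lt_or_ge i r with hi | hi
  · have h1 := h.2 (r - 1 - i) (by omega)
    rw [show r - 1 - (r - 1 - i) = i by omega] at h1
    rw [h1]
    exact ⟨fun h => ⟨hi, h⟩, fun h => h.2⟩
  · have h1 := D.rowLen_anti r i hi
    have h2 := h.1
    exact ⟨fun h => by omega, fun h => by omega⟩

lemma HasRows.boxNumber_eq {r : ℕ} {D : YoungDiagram} {m : ℕ → ℕ} (h : HasRows r D m) {t j : ℕ}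
    (ht : t < r) (hj : j < m t) : boxNumber D (r - 1 - t, j) = rowOffset m t + j + 1 := by
  have hsplit : (D.cells.filter fun d => r - 1 - t < d.1 ∨ (d.1 = r - 1 - t ∧ d.2 ≤ j)) =
      (D.cells.filter fun d => r ≤ d.1 + t) ∪
        (Finset.range (j + 1)).map
          ⟨fun k => (r - 1 - t, k), fun a b hab => by simpa using hab⟩ := by
    ext ⟨a, b⟩
    simp only [Finset.mem_union, Finset.mem_filter, Finset.mem_map, Finset.mem_range,
      YoungDiagram.mem_cells]
    constructor
    · rintro ⟨h1, h2 | h2⟩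
      · exact Or.inl ⟨h1, by omega⟩
      · exact Or.inr ⟨b, by omega, by rw [h2.1]; rfl⟩
    · rintro (⟨h1, h2⟩ | ⟨k, hk, hab⟩)
      · exact ⟨h1, Or.inl (by omega)⟩
      · obtain ⟨rfl, rfl⟩ := Prod.mk.inj hab
        refine ⟨h.mem_iff.2 ⟨by omega, ?_⟩, Or.inr ⟨rfl, by omega⟩⟩
        rw [show r - 1 - (r - 1 - t) = t by omega]
        omega
  rw [boxNumber, hsplit, Finset.card_union_of_disjoint, h.card_below t ht.le,
    Finset.card_map, Finset.card_range, add_assoc]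
  rw [Finset.disjoint_left]
  intro d hd hd'
  have h1 := (Finset.mem_filter.1 hd).2
  obtain ⟨k, -, rfl⟩ := Finset.mem_map.1 hd'
  have h2 : r ≤ r - 1 - t + t := h1
  omega

/-- The number of boxes in row `t`, from the bottom, of the shape of an rc-graph of the `r`-shuffle
`v`. -/
def excess (v : Perm ℕ) (t : ℕ) : ℕ := v (t + 1) - (t + 1)

lemma IsShuffleOf.hasRows {v : Perm ℕ} {D : YoungDiagram} {r : ℕ} (h : IsShuffleOf v D r) :
    HasRows r D (excess v) := by
  refine ⟨by simpa [part] using h.2.1, fun t ht => ?_⟩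
  have := h.2.2 (r - t) (by omega) (by omega)
  rw [show r + 1 - (r - t) = t + 1 by omega, part, show r - t - 1 = r - 1 - t by omega] at this
  rw [excess]
  omega

lemma HasRows.isShuffleOf {v : Perm ℕ} {D : YoungDiagram} {r : ℕ} (h : HasRows r D (excess v))
    (hv : IsShuffle v r) (hle : ∀ s, 1 ≤ s → s ≤ r → s ≤ v s) : IsShuffleOf v D r := by
  refine ⟨hv, by simpa [part] using h.1, fun j hj hjr => ?_⟩
  have h1 := h.2 (r - j) (by omega)
  rw [show r - 1 - (r - j) = j - 1 by omega, excess, show r - j + 1 = r + 1 - j by omega] at h1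
  have h2 := hle (r + 1 - j) (by omega) (by omega)
  rw [part, h1]
  omega

lemma IsShuffle.le_apply {v : Perm ℕ} {r : ℕ} (h : IsShuffle v r) (h0 : v 0 = 0) {s : ℕ}
    (hs1 : 1 ≤ s) (hs : s ≤ r) : s ≤ v s := by
  induction s, hs1 using Nat.le_induction with
  | base =>
    rcases Nat.eq_zero_or_pos (v 1) with h1 | h1
    · rw [← h0] at h1
      exact absurd (v.injective h1) one_ne_zero
    · exact h1
  | succ s hs1 ih =>
    have := h s hs1 (by omega)
    have := ih (by omega)
    omega

lemma IsShuffle.exists_shape {v : Perm ℕ} {r : ℕ} (h : IsShuffle v r) (h0 : v 0 = 0) :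
    ∃ D, IsShuffleOf v D r := by
  obtain ⟨D, hD⟩ := exists_hasRows (r := r) (m := excess v) fun t ht => by
    have h1 := h (t + 1) (by omega) (by omega)
    rw [excess, excess]
    omega
  exact ⟨D, hD.isShuffleOf h fun s hs1 hs => h.le_apply h0 hs1 hs⟩

/-! ### The word of the recording graph -/

section
variable {r : ℕ} {Y : Graph}

lemma IsRcGraph.shuffle_rowsFrom (hY : IsRcGraph Y) (hv : IsShuffle (perm Y) r) {l : ℕ}
    (hl : 1 ≤ l) : IsShuffle (perm (rowsFrom Y l)) r := by
  induction l, hl using Nat.le_induction with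
  | base => rwa [rowsFrom_one (isRcGraph_iff.1 hY).1]
  | succ l hl ih =>
    rw [perm_rowsFrom hl] at ih
    exact (hY.lower hl).2.isShuffle ih

lemma IsRcGraph.semiShuffle_rowsFrom (hY : IsRcGraph Y) (hv : IsSemiShuffle (perm Y) r) {l : ℕ}
    (hl : 1 ≤ l) : IsSemiShuffle (perm (rowsFrom Y l)) r := by
  induction l, hl using Nat.le_induction with
  | base => rwa [rowsFrom_one (isRcGraph_iff.1 hY).1]
  | succ l hl ih =>
    rw [perm_rowsFrom hl] at ih
    exact (hY.lower hl).2.isSemiShuffle ih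

lemma IsRcGraph.isFinitary_rowsFrom (hY : IsRcGraph Y) (l : ℕ) :
    IsFinitary (perm (rowsFrom Y l)) :=
  ((isRcGraph_iff.1 hY).1.subset (Finset.filter_subset _ _)).isFinitary

lemma IsRcGraph.zero_notMem (hY : IsRcGraph Y) {l : ℕ} (hl : 1 ≤ l) : 0 ∉ rowLabels Y l :=
  fun h0 => by
    have := rowLabels_ge (isRcGraph_iff.1 hY).1 h0
    omega

/-- The graph of an `r`-shuffle lives in the first `r` rows. -/
lemma IsRcGraph.rowsFrom_eq_empty (hY : IsRcGraph Y) (hv : IsShuffle (perm Y) r) :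
    rowsFrom Y (r + 1) = ∅ := by
  have hP := (isRcGraph_iff.1 hY).1
  have hs := hY.shuffle_rowsFrom hv (l := r + 1) (by omega)
  have hfix : ∀ k ≤ r, perm (rowsFrom Y (r + 1)) k = k := fun k hk =>
    hP.rowsFrom_fix (by omega)
  have h1 : perm (rowsFrom Y (r + 1)) = 1 := by
    refine perm_eq_one_of_no_descent fun i => ?_
    rcases lt_or_ge r i with hi | hi
    · exact hs i (by omega) (by omega)
    · rw [hfix i hi]
      by_contra hn
      have h2 := hfix _ (show perm (rowsFrom Y (r + 1)) (i + 1) ≤ r by omega)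
      have h3 := (perm (rowsFrom Y (r + 1))).injective h2
      omega
  have h2 := (isRcGraph_iff.1 (hY.lower (l := r + 1) (by omega)).1).2
  rw [← Finset.card_eq_zero, ← h2, h1]
  have := len_wordPerm_le (L := []) (by simp)
  simpa [wordPerm] using this

lemma IsRcGraph.apply_le_rowsFrom (hY : IsRcGraph Y) (hv : IsShuffle (perm Y) r) {l : ℕ}
    (hl : 1 ≤ l) {s : ℕ} (hs : s ≤ r) :
    perm (rowsFrom Y (l + 1)) s ≤ perm (rowsFrom Y l) s := by
  have h := hY.shuffle_rowsFrom hv hl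
  rw [perm_rowsFrom hl] at h ⊢
  exact ((hY.lower hl).2.filter_carryPos (hY.isFinitary_rowsFrom _) (hY.zero_notMem hl) h hs).1

lemma IsRcGraph.excess_le (hY : IsRcGraph Y) (hv : IsShuffle (perm Y) r) {l : ℕ}
    (hl : 1 ≤ l) {t : ℕ} (ht : t < r) :
    excess (perm (rowsFrom Y (l + 1))) t ≤
      excess (perm (rowsFrom Y l)) t := by
  have := hY.apply_le_rowsFrom hv hl (s := t + 1) (by omega)
  rw [excess, excess]
  omega

/-- The shapes of two successive parts of the recording graph differ by a horizontal strip. -/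
lemma IsRcGraph.excess_interlace (hY : IsRcGraph Y) (hv : IsShuffle (perm Y) r) {l : ℕ}
    (hl : 1 ≤ l) {t : ℕ} (ht : t + 1 < r) :
    excess (perm (rowsFrom Y l)) t ≤
      excess (perm (rowsFrom Y (l + 1))) (t + 1) := by
  have h := hY.shuffle_rowsFrom hv hl
  rw [perm_rowsFrom hl] at h ⊢
  have := (hY.lower hl).2.interlace (hY.isFinitary_rowsFrom _) (hY.zero_notMem hl) h
    (s := t + 1) (by omega) (by omega)
  rw [excess, excess]
  omega

lemma IsRcGraph.length_strandWord (hY : IsRcGraph Y) (hv : IsShuffle (perm Y) r) {l : ℕ}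
    (hl : 1 ≤ l) (hlr : l ≤ r + 1) {t : ℕ} (ht : t < r) :
    (strandWord (rowsFrom Y l) (t + 1)).length =
      excess (perm (rowsFrom Y l)) t := by
  induction hlr using Nat.decreasingInduction with
  | self =>
    rw [hY.rowsFrom_eq_empty hv, perm_empty]
    simp [strandWord, excess]
  | of_succ l hlr ih =>
    have h0 : t + 1 ≤ perm (rowsFrom Y (l + 1)) (t + 1) :=
      (hY.shuffle_rowsFrom hv (l := l + 1) (by omega)).le_apply
        (hY.isFinitary_rowsFrom _).apply_zero (by omega) ht
    have h1 := hY.apply_le_rowsFrom hv hl (s := t + 1) ht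
    rw [strandWord_rowsFrom hY hl (hY.shuffle_rowsFrom hv hl) ht, List.length_append,
      List.length_replicate, ih (by omega), excess, excess]
    simp only [Nat.succ_eq_add_one]
    omega
end

lemma length_flatMap_range (f : ℕ → List ℕ) (t : ℕ) :
    ((List.range t).flatMap f).length = rowOffset (fun i => (f i).length) t := by
  induction t with
  | zero => rfl
  | succ t ih =>
    rw [List.range_succ, List.flatMap_append, List.length_append, ih, rowOffset_succ]
    simp

lemma flatMap_range_eq {r t : ℕ} (ht : t < r) (f : ℕ → List ℕ) :
    ∃ M, (List.range r).flatMap f = (List.range t).flatMap f ++ (f t ++ M) := by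
  obtain ⟨n, rfl⟩ : ∃ n, r = t + (n + 1) := ⟨r - t - 1, by omega⟩
  refine ⟨((List.range n).map fun i => t + (i + 1)).flatMap f, ?_⟩
  rw [List.range_add, List.flatMap_append, List.range_succ_eq_map, List.map_cons, List.flatMap_cons,
    List.map_map]
  rfl

lemma rowOffset_congr {m m' : ℕ → ℕ} {t : ℕ} (h : ∀ i < t, m i = m' i) :
    rowOffset m t = rowOffset m' t :=
  Finset.sum_congr rfl fun i hi => h i (Finset.mem_range.1 hi)

/-- The letters of `word(Y_{≥ l})` in terms of the shapes of `Y_{≥ l}` and `Y_{≥ l + 1}`: the letter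
of box `j` of row `t` is old if `j` is at most the length of row `t` of the smaller shape, and it is
then the letter of the same box of the smaller shape. -/
lemma IsRcGraph.insWord_rowsFrom {r : ℕ} {Y : Graph} (hY : IsRcGraph Y)
    (hv : IsShuffle (perm Y) r) {l : ℕ} (hl : 1 ≤ l) (hlr : l ≤ r) {m m' : ℕ → ℕ}
    (hm : m = excess (perm (rowsFrom Y l)))
    (hm' : m' = excess (perm (rowsFrom Y (l + 1))))
    {t j : ℕ} (ht : t < r) (hj : j < m t) :
    (j < m' t → ∃ k, l < k ∧ (insWord r (rowsFrom Y l))[rowOffset m t + j]? = some k ∧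
      (((insWord r (rowsFrom Y l)).take (rowOffset m t + j)).filter
        fun k' => l < k').length = rowOffset m' t + j) ∧
    (m' t ≤ j → (insWord r (rowsFrom Y l))[rowOffset m t + j]? = some l) := by
  set f : ℕ → List ℕ := fun s => strandWord (rowsFrom Y l) (s + 1) with hf
  set g : ℕ → List ℕ := fun s => strandWord (rowsFrom Y (l + 1)) (s + 1) with hg
  have hflen : ∀ s < r, (f s).length = m s := fun s hs => by
    rw [hm]; exact hY.length_strandWord hv hl (by omega) hs
  have hglen : ∀ s < r, (g s).length = m' s := fun s hs => by
    rw [hm']; exact hY.length_strandWord hv (by omega) (by omega) hs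
  have hfg : ∀ s < r, ∃ n, f s = g s ++ List.replicate n l := fun s hs =>
    ⟨_, strandWord_rowsFrom hY hl (hY.shuffle_rowsFrom hv hl) hs⟩
  have hgl : ∀ s, ∀ k ∈ g s, l < k := fun s k hk => lt_of_mem_strandWord hk
  have hfilt : ∀ s ≤ r, ((List.range s).flatMap f).filter (fun k' => l < k') =
      (List.range s).flatMap g := by
    intro s hs
    induction s with
    | zero => rfl
    | succ s ih =>
      obtain ⟨n, hn⟩ := hfg s hs
      rw [List.range_succ, List.flatMap_append, List.filter_append, ih (by omega),
        List.flatMap_append]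
      congr 1
      simp only [List.flatMap_cons, List.flatMap_nil, List.append_nil]
      rw [hn, List.filter_append, List.filter_eq_self.2 fun k hk => by simpa using hgl s k hk]
      simp
  obtain ⟨M, hM⟩ := flatMap_range_eq ht f
  have hI : insWord r (rowsFrom Y l) = (List.range t).flatMap f ++ (f t ++ M) := hM
  have hoff : ((List.range t).flatMap f).length = rowOffset m t := by
    rw [length_flatMap_range]
    exact rowOffset_congr fun i hi => hflen i (by omega)
  have hoff' : ((List.range t).flatMap g).length = rowOffset m' t := by
    rw [length_flatMap_range]
    exact rowOffset_congr fun i hi => hglen i (by omega)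
  obtain ⟨n, hn⟩ := hfg t ht
  have hget : (insWord r (rowsFrom Y l))[rowOffset m t + j]? = (f t)[j]? := by
    rw [hI, ← hoff, List.getElem?_append_right (by omega), Nat.add_sub_cancel_left,
      List.getElem?_append_left (by rw [hflen t ht]; exact hj)]
  rw [hget]
  constructor
  · intro hj'
    have hjg : j < (g t).length := by rw [hglen t ht]; exact hj'
    refine ⟨(g t)[j], hgl t _ (List.getElem_mem hjg), ?_, ?_⟩
    · rw [hn, List.getElem?_append_left hjg, List.getElem?_eq_getElem hjg]
    · rw [hI, ← hoff, List.take_length_add_append, List.filter_append, hfilt t ht.le,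
        List.length_append, hoff', List.take_append_of_le_length (by rw [hflen t ht]; omega), hn,
        List.take_append_of_le_length hjg.le,
        List.filter_eq_self.2 fun k hk => by simpa using hgl t k (List.mem_of_mem_take hk),
        List.length_take]
      omega
  · intro hj'
    have hft : j < (f t).length := by rw [hflen t ht]; exact hj
    rw [List.getElem?_eq_getElem hft]
    congr 1
    have hjg : (g t).length ≤ j := by rw [hglen t ht]; exact hj'
    have : ∀ A : List ℕ, ∀ hA : j < A.length, A = g t ++ List.replicate n l → A[j] = l := by
      rintro A hA rfl
      rw [List.getElem_append_right hjg, List.getElem_replicate]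
    exact this _ hft hn

lemma IsRcGraph.card_rowsFrom {r : ℕ} {Y : Graph} (hY : IsRcGraph Y)
    (hv : IsShuffle (perm Y) r) {l : ℕ} (hl : 1 ≤ l) (hlr : l ≤ r + 1) :
    (rowsFrom Y l).card =
      rowOffset (excess (perm (rowsFrom Y l))) r := by
  have hP := (isRcGraph_iff.1 hY).1
  induction hlr using Nat.decreasingInduction with
  | self =>
    rw [hY.rowsFrom_eq_empty hv, perm_empty, rowOffset, Finset.card_empty]
    exact (Finset.sum_eq_zero fun i _ => by simp [excess]).symm
  | of_succ l hlr ih =>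
    have hg := (hY.lower hl).2
    have hu := hY.isFinitary_rowsFrom (l + 1)
    have hC := hY.zero_notMem hl
    have hw := hY.shuffle_rowsFrom hv hl
    have h0 : ∀ t, t < r → t + 1 ≤ perm (rowsFrom Y (l + 1)) (t + 1) := fun t ht =>
      (hY.shuffle_rowsFrom hv (l := l + 1) (by omega)).le_apply
        (hY.isFinitary_rowsFrom _).apply_zero (by omega) ht
    have h1 : (rowLabels Y l).card = ∑ t ∈ Finset.range r,
        (perm (rowsFrom Y l) (t + 1) -
          perm (rowsFrom Y (l + 1)) (t + 1)) := by
      rw [perm_rowsFrom hl] at hw ⊢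
      rw [Finset.card_eq_sum_card_fiberwise (t := Finset.range r)
        (f := fun p => (perm (rowsFrom Y (l + 1)))⁻¹ (carryPos (rowLabels Y l) p) - 1)]
      · refine Finset.sum_congr rfl fun t ht => ?_
        have h2 := (hg.filter_carryPos hu hC hw (s := t + 1) (Finset.mem_range.1 ht)).2
        rw [← Nat.card_Ico, ← h2]
        congr 1
        refine Finset.filter_congr fun p hp => ?_
        have h3 : 1 ≤ (perm (rowsFrom Y (l + 1)))⁻¹ (carryPos (rowLabels Y l) p) := by
          have h4 : 1 ≤ carryPos (rowLabels Y l) p := one_le_carryPos hC (by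
            have := rowLabels_ge hP hp
            omega)
          by_contra hn
          have h5 := perm_apply_inv (perm (rowsFrom Y (l + 1)))
            (carryPos (rowLabels Y l) p)
          rw [Nat.lt_one_iff.1 (not_le.1 hn), hu.apply_zero] at h5
          omega
        constructor
        · intro h4
          rw [← show (perm (rowsFrom Y (l + 1)))⁻¹ (carryPos (rowLabels Y l) p) = t + 1
            by omega, perm_apply_inv]
        · intro h4
          rw [h4, perm_inv_apply]
          rfl
      · intro p hp
        have h2 := (hg.crossing_small_big hu hC hw hp).1
        have h3 := hg p hp
        have h4 := (hg.crossing_small_big hu hC hw hp).2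
        rcases Nat.eq_zero_or_pos r with rfl | hr
        · omega
        · simp only [Finset.coe_range, Set.mem_Iio]
          omega
    rw [card_rowsFrom_eq hP l, h1, ih (by omega), rowOffset, rowOffset, ← Finset.sum_add_distrib]
    refine Finset.sum_congr rfl fun t ht => ?_
    have h2 := hY.apply_le_rowsFrom hv hl (s := t + 1) (Finset.mem_range.1 ht)
    have h3 := h0 t (Finset.mem_range.1 ht)
    rw [excess, excess]
    omega

/-! ### Tableaux -/

lemma eq_take_append_drop {α : Type*} {L : List α} {i : ℕ} {x : α} (h : L[i]? = some x) :
    L = L.take i ++ x :: L.drop (i + 1) := by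
  obtain ⟨hi, rfl⟩ := List.getElem?_eq_some_iff.1 h
  rw [List.cons_getElem_drop_succ, List.take_append_drop]

lemma getElem?_concat {α : Type*} {L : List α} {v x : α} {i : ℕ} (h : (L ++ [v])[i]? = some x) :
    L[i]? = some x ∨ (i = L.length ∧ x = v) := by
  rcases lt_trichotomy i L.length with hi | rfl | hi
  · left; rwa [List.getElem?_append_left hi] at h
  · right
    rw [List.getElem?_append_right le_rfl, Nat.sub_self] at h
    exact ⟨rfl, (by simpa using h.symm)⟩
  · rw [List.getElem?_eq_none (by simp; omega)] at h
    cases h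

lemma getElem?_append_of_some {α : Type*} {L M : List α} {x : α} {i : ℕ} (h : L[i]? = some x) :
    (L ++ M)[i]? = some x := by
  rw [List.getElem?_append_left (List.getElem?_eq_some_iff.1 h).1, h]

lemma getElem?_chainEntries {w : Perm ℕ} {L : List (ℕ × ℕ)} {i a b : ℕ}
    (h : L[i]? = some (a, b)) :
    (chainEntries w L)[i]? = some ((w * chainProd (L.take i)) a) := by
  have hi := (List.getElem?_eq_some_iff.1 h).1
  conv_lhs => rw [eq_take_append_drop h, chainEntries_append]
  rw [List.getElem?_append_right (by rw [length_chainEntries, List.length_take]; omega),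
    length_chainEntries, List.length_take, Nat.min_eq_left hi.le, Nat.sub_self]
  rfl

lemma chainProd_concat (L : List (ℕ × ℕ)) (a b : ℕ) :
    chainProd (L ++ [(a, b)]) = chainProd L * swap a b := by
  simp [chainProd]

lemma take_succ_of_getElem? {α : Type*} {L : List α} {i : ℕ} {x : α} (h : L[i]? = some x) :
    L.take (i + 1) = L.take i ++ [x] := by
  rw [List.take_add_one, h]; rfl

lemma E_eq (w : Perm ℕ) (D : YoungDiagram) (L : List (ℕ × ℕ)) :
    E w ⟨D, L⟩ = ⟨D, chainEntries w L⟩ := by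
  unfold E
  congr 1
  apply List.ext_getElem?
  intro i
  simp only [List.getElem?_mapIdx]
  cases hL : L[i]? with
  | none =>
    rw [List.getElem?_eq_none (l := chainEntries w L)]
    · rfl
    · rw [length_chainEntries]; exact List.getElem?_eq_none_iff.1 hL
  | some p =>
    obtain ⟨a, b⟩ := p
    rw [getElem?_chainEntries hL]
    simp only [Option.map_some, Option.some.injEq]
    change (w * chainProd (L.take (i + 1))) b = _
    rw [take_succ_of_getElem? hL, chainProd_concat, ← mul_assoc, mul_swap_apply_right]

/-- The list `V`, placed into the boxes of a diagram with rows of length `m 0, m 1, …, m (r - 1)`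
from the bottom up, increases from left to right and from top to bottom. Only adjacent boxes are
compared. -/
structure StrictFilling (r : ℕ) (m : ℕ → ℕ) (V : List ℕ) : Prop where
  row : ∀ t j x y, t < r → j + 1 < m t → V[rowOffset m t + j]? = some x →
    V[rowOffset m t + (j + 1)]? = some y → x < y
  col : ∀ t j x y, t + 1 < r → j < m t → V[rowOffset m t + j]? = some x →
    V[rowOffset m (t + 1) + j]? = some y → y < x

lemma StrictFilling.nil (r : ℕ) (m : ℕ → ℕ) : StrictFilling r m [] :=
  ⟨by simp, by simp⟩

lemma StrictFilling.concat {r : ℕ} {m : ℕ → ℕ} {V : List ℕ} (h : StrictFilling r m V)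
    (hm : ∀ s t, s ≤ t → t < r → m s ≤ m t) {t j v : ℕ} (hj : j < m t)
    (hlen : V.length = rowOffset m t + j)
    (hrow : ∀ x, 1 ≤ j → V[rowOffset m t + (j - 1)]? = some x → x < v)
    (hcol : ∀ s x, t = s + 1 → j < m s → V[rowOffset m s + j]? = some x → v < x) :
    StrictFilling r m (V ++ [v]) := by
  constructor
  · intro t' j' x y ht' hj' hx hy
    rcases getElem?_concat hy with hy' | ⟨hy', rfl⟩
    · rcases getElem?_concat hx with hx' | ⟨hx', rfl⟩
      · exact h.row t' j' x y ht' hj' hx' hy'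
      · have := (List.getElem?_eq_some_iff.1 hy').1
        omega
    · obtain ⟨rfl, rfl⟩ := rowOffset_add_inj hj' hj (hy'.trans hlen)
      rcases getElem?_concat hx with hx' | ⟨hx', -⟩
      · exact hrow x (by omega) hx'
      · omega
  · intro t' j' x y ht' hj' hx hy
    have hlt := hm t' (t' + 1) (by omega) ht'
    rcases getElem?_concat hy with hy' | ⟨hy', rfl⟩
    · rcases getElem?_concat hx with hx' | ⟨hx', rfl⟩
      · exact h.col t' j' x y ht' hj' hx' hy'
      · have := (List.getElem?_eq_some_iff.1 hy').1
        have h2 := rowOffset_succ m t'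
        omega
    · obtain ⟨rfl, rfl⟩ := rowOffset_add_inj (show j' < m (t' + 1) by omega) hj (hy'.trans hlen)
      rcases getElem?_concat hx with hx' | ⟨hx', -⟩
      · exact hcol t' x rfl hj' hx'
      · have h2 := rowOffset_succ m t'
        omega

lemma HasRows.hasEntry_iff {r : ℕ} {D : YoungDiagram} {m : ℕ → ℕ} (h : HasRows r D m) {V : List ℕ}
    {t j x : ℕ} (ht : t < r) :
    (⟨D, V⟩ : Tableau ℕ).HasEntry (r - 1 - t, j) x ↔
      j < m t ∧ V[rowOffset m t + j]? = some x := by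
  have h1 : (r - 1 - t, j) ∈ D ↔ j < m t := by
    rw [h.mem_iff, show r - 1 - (r - 1 - t) = t by omega]
    exact ⟨fun h => h.2, fun h => ⟨by omega, h⟩⟩
  constructor
  · rintro ⟨h2, h3⟩
    have hj := h1.1 h2
    simp only [h.boxNumber_eq ht hj, Nat.add_sub_cancel] at h3
    exact ⟨hj, h3⟩
  · rintro ⟨hj, h3⟩
    refine ⟨h1.2 hj, ?_⟩
    simp only [h.boxNumber_eq ht hj, Nat.add_sub_cancel]
    exact h3

lemma StrictFilling.row_lt {r : ℕ} {m : ℕ → ℕ} {V : List ℕ} (h : StrictFilling r m V) {t j j' : ℕ}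
    (ht : t < r) (hjj : j < j') (hj' : j' < m t) {x y : ℕ}
    (hx : V[rowOffset m t + j]? = some x) (hy : V[rowOffset m t + j']? = some y) : x < y := by
  induction j', hjj using Nat.le_induction generalizing y with
  | base => exact h.row t j x y ht hj' hx hy
  | succ k hk ih =>
    have hlen := (List.getElem?_eq_some_iff.1 hy).1
    have hz : V[rowOffset m t + k]? = some V[rowOffset m t + k] :=
      List.getElem?_eq_getElem (by omega)
    exact (ih (by omega) hz).trans (h.row t k _ y ht hj' hz hy)

lemma StrictFilling.col_lt {r : ℕ} {m : ℕ → ℕ} {V : List ℕ} (h : StrictFilling r m V)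
    (hm : ∀ s t, s ≤ t → t < r → m s ≤ m t) {s t j : ℕ}
    (hst : s < t) (ht : t < r) (hj : j < m s) {x y : ℕ}
    (hx : V[rowOffset m s + j]? = some x) (hy : V[rowOffset m t + j]? = some y) : y < x := by
  induction t, hst using Nat.le_induction generalizing y with
  | base => exact h.col s j x y ht hj hx hy
  | succ k hk ih =>
    have hlen := (List.getElem?_eq_some_iff.1 hy).1
    have h1 := rowOffset_succ m k
    have hz : V[rowOffset m k + j]? = some (V[rowOffset m k + j]'(by omega)) :=
      List.getElem?_eq_getElem (by omega)
    have h2 := hm s k (by omega) (by omega)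
    exact (h.col k j _ y ht (by omega) hz hy).trans (ih (by omega) hz)

lemma HasRows.strict {r : ℕ} {D : YoungDiagram} {m : ℕ → ℕ} (h : HasRows r D m) {V : List ℕ}
    (hV : StrictFilling r m V) : RowStrict ⟨D, V⟩ ∧ ColumnStrict ⟨D, V⟩ := by
  have hrow : ∀ i j j' x y, j < j' → (⟨D, V⟩ : Tableau ℕ).HasEntry (i, j) x →
      (⟨D, V⟩ : Tableau ℕ).HasEntry (i, j') y → x < y := by
    intro i j j' x y hjj hx hy
    have hi := (h.mem_iff.1 hx.1).1
    rw [show i = r - 1 - (r - 1 - i) by omega, h.hasEntry_iff (by omega)] at hx hy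
    exact hV.row_lt (by omega) hjj hy.1 hx.2 hy.2
  have hcol : ∀ i i' j x y, i < i' → (⟨D, V⟩ : Tableau ℕ).HasEntry (i, j) x →
      (⟨D, V⟩ : Tableau ℕ).HasEntry (i', j) y → x < y := by
    intro i i' j x y hii hx hy
    have hi := (h.mem_iff.1 hx.1).1
    have hi' := (h.mem_iff.1 hy.1).1
    rw [show i = r - 1 - (r - 1 - i) by omega, h.hasEntry_iff (by omega)] at hx
    rw [show i' = r - 1 - (r - 1 - i') by omega, h.hasEntry_iff (by omega)] at hy
    exact hV.col_lt (fun s t => h.mono) (show r - 1 - i' < r - 1 - i by omega) (by omega) hy.1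
      hy.2 hx.2
  exact ⟨⟨hrow, fun i i' j x y h1 h2 h3 => (hcol i i' j x y h1 h2 h3).le⟩,
    ⟨fun i j j' x y h1 h2 h3 => (hrow i j j' x y h1 h2 h3).le, hcol⟩⟩

lemma CoverChain.at {r : ℕ} {w : Perm ℕ} {L : List (ℕ × ℕ)} (h : CoverChain r w L) {i a b : ℕ}
    (hi : L[i]? = some (a, b)) :
    1 ≤ a ∧ a ≤ r ∧ r < b ∧ Cover (w * chainProd (L.take i)) a b :=
  h (L.take i) a b (L.drop (i + 1)) (eq_take_append_drop hi)

lemma CoverChain.take {r : ℕ} {w : Perm ℕ} {L : List (ℕ × ℕ)} (h : CoverChain r w L) (i : ℕ) :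
    CoverChain r w (L.take i) :=
  CoverChain.of_append (M := L.drop i) (by rwa [List.take_append_drop])

lemma CoverChain.len_eq {r : ℕ} {w : Perm ℕ} {L : List (ℕ × ℕ)} (h : CoverChain r w L)
    (hw : IsFinitary w) {i : ℕ} (hi : i ≤ L.length) :
    len (w * chainProd (L.take i)) = len w + i := by
  induction i with
  | zero => simp [chainProd]
  | succ i ih =>
    obtain ⟨⟨a, b⟩, hab⟩ : ∃ p, L[i]? = some p := ⟨_, List.getElem?_eq_getElem hi⟩
    obtain ⟨h1, -, -, h2⟩ := h.at hab
    rw [take_succ_of_getElem? hab, chainProd_concat, ← mul_assoc,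
      h2.len_eq ((h.take i).isFinitary hw) h1, ih (by omega), add_assoc]

lemma CoverChain.isBruhatChain {r : ℕ} {w : Perm ℕ} {L : List (ℕ × ℕ)} (h : CoverChain r w L)
    (hw : IsFinitary w) (D : YoungDiagram) : IsBruhatChain r w ⟨D, L⟩ := by
  refine ⟨fun p hp => ?_, fun i _ hi => h.len_eq hw hi⟩
  obtain ⟨i, hi⟩ := List.getElem?_of_mem hp
  obtain ⟨h1, h2, h3, -⟩ := h.at (a := p.1) (b := p.2) hi
  exact ⟨h1, h2, h3⟩

lemma CoverChain.isBruhatPackage {r : ℕ} {w : Perm ℕ} {L : List (ℕ × ℕ)} (h : CoverChain r w L)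
    (hw : IsFinitary w) (D : YoungDiagram) {U : Graph} (hU : IsRcGraph U)
    (hp : perm U = w * chainProd L) : IsBruhatPackage r w U ⟨D, L⟩ := by
  refine ⟨hU, ?_, h.isBruhatChain hw D⟩
  rw [hp]
  change w * chainProd (L.take L.length) = _
  rw [List.take_length]

lemma valid_of {r : ℕ} {w : Perm ℕ} {L : List (ℕ × ℕ)} (h : CoverChain r w L) (hw : IsFinitary w)
    {D : YoungDiagram} {m : ℕ → ℕ} (hD : HasRows r D m) (hs : StrictFilling r m (chainEntries w L))
    {U : Graph} (hU : IsRcGraph U) (hp : perm U = w * chainProd L) : Valid r w U ⟨D, L⟩ := by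
  rw [Valid, E_eq]
  exact ⟨(hD.strict hs).1, (hD.strict hs).2, h.isBruhatPackage hw D hU hp⟩

lemma not_valid_of_lt {r : ℕ} {w : Perm ℕ} {L : List (ℕ × ℕ)} {a b : ℕ} {D : YoungDiagram}
    {U : Graph} (hz : IsFinitary (w * chainProd L)) (ha : 1 ≤ a) (hab : a < b)
    (h : (w * chainProd L) b < (w * chainProd L) a) : ¬ Valid r w U ⟨D, L ++ [(a, b)]⟩ := by
  rintro ⟨-, -, -, -, -, hlen⟩
  have h1 : len (w * chainProd (L ++ [(a, b)])) = len w + (L.length + 1) := by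
    have := hlen (L.length + 1) (by omega) (by simp)
    rw [← this, chainPerm]
    simp only [List.take_of_length_le (l := L ++ [(a, b)]) (i := L.length + 1) (by simp)]
    rfl
  have h2 : len (w * chainProd L) = len w + L.length := by
    rcases Nat.eq_zero_or_pos L.length with h0 | h0
    · rw [List.length_eq_zero_iff] at h0
      subst h0
      simp [chainProd]
    · have := hlen L.length h0 (by simp)
      rw [← this, chainPerm]
      simp only [List.take_left' (l₂ := [(a, b)]) (rfl : L.length = L.length)]
      rfl
  rw [chainProd_concat, ← mul_assoc] at h1
  have := len_mul_swap_lt hz ha hab h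
  omega

lemma not_valid_of_col {r : ℕ} {w : Perm ℕ} {L : List (ℕ × ℕ)} {D : YoungDiagram} {m : ℕ → ℕ}
    (hD : HasRows r D m) {U : Graph} {t j x y : ℕ} (ht : t + 1 < r) (hj : j < m t)
    (hx : (chainEntries w L)[rowOffset m t + j]? = some x)
    (hy : (chainEntries w L)[rowOffset m (t + 1) + j]? = some y) (hxy : x < y) :
    ¬ Valid r w U ⟨D, L⟩ := by
  rintro ⟨-, h, -⟩
  rw [E_eq] at h
  have := h.2 (r - 1 - (t + 1)) (r - 1 - t) j y x (by omega)
    ((hD.hasEntry_iff ht).2 ⟨hj.trans_le (hD.mono (by omega) ht), hy⟩)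
    ((hD.hasEntry_iff (by omega)).2 ⟨hj, hx⟩)
  omega

/-! ### The algorithm is deterministic -/

lemma Enters.one_le {R : Graph} {k : ℕ} {side : Side} {i j : ℕ} (h : Enters R k side i j) :
    1 ≤ j ∧ (side = .left → 1 ≤ i) := by
  induction h with
  | start h => exact ⟨le_rfl, fun _ => h⟩
  | straightRight _ _ ih => exact ⟨by omega, fun _ => ih.2 rfl⟩
  | turnUp _ _ ih => exact ⟨ih.1, fun h => by cases h⟩
  | straightUp _ _ ih => exact ⟨ih.1, fun h => by cases h⟩
  | turnRight _ _ ih => exact ⟨by omega, fun _ => by omega⟩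

lemma Pass.one_le {Q : Graph} {i j c d : ℕ} (h : Pass Q i j c d) : 1 ≤ i ∧ 1 ≤ j :=
  ⟨h.1.one_le.2 rfl, h.1.one_le.1⟩

lemma Pass.unique {Q : Graph} (hQ : IsPlaced Q) {i j c d c' d' : ℕ} (h : Pass Q i j c d)
    (h' : Pass Q i j c' d') : c = c' ∧ d = d' := by
  rw [pass_iff hQ] at h h'
  exact ⟨h.2.2.1.trans h'.2.2.1.symm, h.2.2.2.trans h'.2.2.2.symm⟩

lemma Pass.unique_col {Q : Graph} (hQ : IsPlaced Q) {i j j' c d c' : ℕ} (h : Pass Q i j c d)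
    (h' : Pass Q i j' c' d) : j = j' := by
  rw [pass_iff hQ] at h h'
  have := (perm (rowsFrom Q (i + 1)))⁻¹.injective (h.2.2.2.symm.trans h'.2.2.2)
  omega

/-- Graphs and tableaux which can occur in the algorithm: rows and columns are numbered from `1`,
and the entries are pairs `(a, b)` with `a ≤ r < b`. -/
def IsRegular (r : ℕ) (Q : Graph) (T : Tableau (ℕ × ℕ)) : Prop :=
  IsPlaced Q ∧ ∀ p ∈ T.word, p.1 ≤ r ∧ r < p.2

lemma IsPlaced.insert {Q : Graph} (h : IsPlaced Q) {i j : ℕ} (hi : 1 ≤ i) (hj : 1 ≤ j) :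
    IsPlaced (insert (i, j) Q) := by
  intro p hp
  rcases Finset.mem_insert.1 hp with rfl | hp
  · exact ⟨hi, hj⟩
  · exact h p hp

lemma IsBacktrack.subset {w : Perm ℕ} {U : Graph} {T : Tableau (ℕ × ℕ)} {S : ℕ → Graph}
    (h : IsBacktrack w U T S) {j : ℕ} (hj : j ≤ T.word.length) : S j ⊆ U := by
  induction hj using Nat.decreasingInduction with
  | self => rw [h.1]
  | of_succ j hj ih =>
    obtain ⟨⟨p, -, hp⟩, -⟩ := h.2 j hj
    rw [hp]
    exact (Finset.erase_subset _ _).trans ih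

lemma InsertionStep.regular {r l : ℕ} {Q Q' : Graph} {T T' : Tableau (ℕ × ℕ)}
    (h : InsertionStep r l Q T Q' T') (hQ : IsRegular r Q T) : IsRegular r Q' T' := by
  obtain ⟨j, c, d, ha, -, rfl, rfl⟩ := h
  refine ⟨hQ.1.insert ha.2.1.one_le.1 ha.2.1.one_le.2, fun p hp => ?_⟩
  rcases List.mem_append.1 hp with hp | hp
  · exact hQ.2 p hp
  · rw [List.mem_singleton.1 hp]
    exact ha.2.2

lemma RemovalStep.regular {r l j : ℕ} {Q Q' : Graph} {T T' : Tableau (ℕ × ℕ)}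
    (h : RemovalStep l Q T j Q' T') (hQ : IsRegular r Q T) : IsRegular r Q' T' := by
  obtain ⟨rfl, ⟨-, rfl⟩ | ⟨-, L, a, b, ⟨f, hf, -⟩, rfl⟩⟩ := h
  · exact ⟨hQ.1.subset (Finset.erase_subset _ _), fun p hp => hQ.2 p (List.mem_of_mem_dropLast hp)⟩
  · refine ⟨hQ.1.subset (Finset.erase_subset _ _), fun p hp => hQ.2 p ?_⟩
    rw [hf]
    rcases List.mem_append.1 hp with hp | hp
    · exact List.mem_append_left _ hp
    · rw [List.mem_singleton.1 hp]
      simp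

lemma ReinsertionStep.regular {r l j : ℕ} {Q Q' : Graph} {T T' : Tableau (ℕ × ℕ)}
    (h : ReinsertionStep r l j Q T Q' T') (hQ : IsRegular r Q T) : IsRegular r Q' T' := by
  obtain ⟨j, -, -, rfl, ⟨c, d, ha, rfl⟩ | ⟨L, e, g, d, ha, rfl⟩⟩ := h
  · refine ⟨hQ.1.insert ha.2.1.one_le.1 ha.2.1.one_le.2, fun p hp => ?_⟩
    rcases List.mem_append.1 hp with hp | hp
    · exact hQ.2 p hp
    · rw [List.mem_singleton.1 hp]
      exact ha.2.2
  · obtain ⟨hw, -, hp, hd⟩ := ha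
    refine ⟨hQ.1.insert hp.one_le.1 hp.one_le.2, fun p hp => ?_⟩
    have heg := hQ.2 (e, g) (by rw [hw]; simp)
    rcases List.mem_append.1 hp with hp | hp
    · exact hQ.2 p (by rw [hw]; exact List.mem_append_left _ hp)
    · simp only [List.mem_cons, List.not_mem_nil, or_false] at hp
      rcases hp with rfl | rfl
      · exact ⟨heg.1, hd⟩
      · exact heg

lemma IsRegular.add_crossing {r : ℕ} {w : Perm ℕ} {Q U : Graph} {T V : Tableau (ℕ × ℕ)}
    (hQ : IsRegular r Q T) {S : ℕ → Graph} (hS : IsBacktrack w U V S) (hU : IsRegular r U V) {n : ℕ}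
    {ab : ℕ × ℕ} (hab : V.word[n]? = some ab) :
    IsRegular r (Q ∪ (S (n + 1) \ S n)) ⟨T.shape, T.word ++ [ab]⟩ := by
  have hlen := (List.getElem?_eq_some_iff.1 hab).1
  constructor
  · intro p hp
    rcases Finset.mem_union.1 hp with hp | hp
    · exact hQ.1 p hp
    · exact hU.1 p (hS.subset hlen (Finset.mem_sdiff.1 hp).1)
  · intro p hp
    rcases List.mem_append.1 hp with hp | hp
    · exact hQ.2 p hp
    · rw [List.mem_singleton.1 hp]
      exact hU.2 ab (List.mem_of_getElem? hab)

lemma Step.regular {r : ℕ} {R Y : Graph} (hR : IsPlaced R) {l i : ℕ} {Q : Graph}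
    {T : Tableau (ℕ × ℕ)} (h : Step r R Y l i Q T) : l ≤ r ∧ IsRegular r Q T := by
  induction h with
  | start hD => exact ⟨le_rfl, hR.subset (Finset.filter_subset _ _), by simp⟩
  | rowToRow hl hprev hS hD ih =>
    refine ⟨by omega, fun p hp => ?_, by simp⟩
    rcases Finset.mem_union.1 hp with hp | hp
    · exact ih.2.1 p (hS.subset (Nat.zero_le _) hp)
    · exact hR p (Finset.mem_filter.1 hp).1
  | insertion hcur hletter hstep ih => exact ⟨ih.1, hstep.regular ih.2⟩
  | @rectification l i k n U Q Q' V T T' S ab hprev hS hcur hletter hk hn hab hstep ih1 ih2 =>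
    refine ⟨ih2.1, ?_⟩
    have h1 := ih2.2.add_crossing hS ih1.2 hab
    rcases hstep with ⟨-, rfl, rfl⟩ | ⟨-, j, Q₂, T₂, h2, h3⟩
    · exact h1
    · exact h3.regular (h2.regular h1)

lemma InsertionStep.unique {r l : ℕ} {Q Q₁ Q₂ : Graph} {T T₁ T₂ : Tableau (ℕ × ℕ)}
    (hQ : IsRegular r Q T) (h₁ : InsertionStep r l Q T Q₁ T₁)
    (h₂ : InsertionStep r l Q T Q₂ T₂) : Q₁ = Q₂ ∧ T₁ = T₂ := by
  obtain ⟨j, c, d, ha, hno, rfl, rfl⟩ := h₁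
  obtain ⟨j', c', d', ha', hno', rfl, rfl⟩ := h₂
  have hj : j = j' := by
    rcases lt_trichotomy j j' with h | h | h
    · exact absurd ha' (hno j' c' d' h)
    · exact h
    · exact absurd ha (hno' j c d h)
  subst hj
  obtain ⟨rfl, rfl⟩ := ha.2.1.unique hQ.1 ha'.2.1
  exact ⟨rfl, rfl⟩

lemma RemovalStep.unique {r l j₁ j₂ : ℕ} {Q Q₁ Q₂ : Graph} {T T₁ T₂ : Tableau (ℕ × ℕ)}
    (hQ : IsRegular r Q T) (h₁ : RemovalStep l Q T j₁ Q₁ T₁) (h₂ : RemovalStep l Q T j₂ Q₂ T₂) :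
    j₁ = j₂ ∧ Q₁ = Q₂ ∧ T₁ = T₂ := by
  obtain ⟨rfl, ⟨hf, rfl⟩ | ⟨hn, L, a, b, ⟨f, hw, -, hp⟩, rfl⟩⟩ := h₁ <;>
  obtain ⟨rfl, ⟨hf', rfl⟩ | ⟨hn', L', a', b', ⟨f', hw', -, hp'⟩, rfl⟩⟩ := h₂
  · obtain ⟨L, a, b, hw, -, hp⟩ := hf
    obtain ⟨L', a', b', hw', -, hp'⟩ := hf'
    obtain ⟨rfl, h⟩ := concat_inj (hw.symm.trans hw')
    obtain ⟨rfl, rfl⟩ := Prod.mk.inj h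
    obtain rfl := hp.unique_col hQ.1 hp'
    exact ⟨rfl, rfl, rfl⟩
  · exact absurd hf (hn' _)
  · exact absurd hf' (hn _)
  · have h := hw.symm.trans hw'
    rw [show [(a, f), (a, b)] = [(a, f)] ++ [(a, b)] from rfl,
      show [(a', f'), (a', b')] = [(a', f')] ++ [(a', b')] from rfl, ← List.append_assoc,
      ← List.append_assoc] at h
    obtain ⟨h1, h2⟩ := concat_inj h
    obtain ⟨rfl, h3⟩ := concat_inj h1
    obtain ⟨rfl, rfl⟩ := Prod.mk.inj h3
    obtain ⟨-, rfl⟩ := Prod.mk.inj h2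
    obtain rfl := hp.unique_col hQ.1 hp'
    exact ⟨rfl, rfl, rfl⟩

lemma ReinsertionStep.unique {r l j₀ : ℕ} {Q Q₁ Q₂ : Graph} {T T₁ T₂ : Tableau (ℕ × ℕ)}
    (hQ : IsRegular r Q T) (h₁ : ReinsertionStep r l j₀ Q T Q₁ T₁)
    (h₂ : ReinsertionStep r l j₀ Q T Q₂ T₂) : Q₁ = Q₂ ∧ T₁ = T₂ := by
  obtain ⟨j, hj, hno, rfl, h⟩ := h₁
  obtain ⟨j', hj', hno', rfl, h'⟩ := h₂
  have aux : ∀ j j' : ℕ, j < j' → j' < j₀ → (∀ k, j < k → k < j₀ →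
      (∀ c d, ¬ Allowed r Q l k c d) ∧ (∀ L e g d, ¬ AllowedSecond r Q T l k L e g d)) →
      ∀ T' : Tableau (ℕ × ℕ), ¬ ((∃ c d, Allowed r Q l j' c d ∧ T' = ⟨T.shape, T.word ++ [(c, d)]⟩) ∨
      (∃ L e g d, AllowedSecond r Q T l j' L e g d ∧ T' = ⟨T.shape, L ++ [(e, d), (e, g)]⟩)) := by
    rintro j j' hlt hj' hno T' (⟨c, d, ha, -⟩ | ⟨L, e, g, d, ha, -⟩)
    · exact (hno j' hlt hj').1 c d ha
    · exact (hno j' hlt hj').2 L e g d ha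
  have hjj : j = j' := by
    rcases lt_trichotomy j j' with h1 | h1 | h1
    · exact absurd h' (aux j j' h1 hj' hno _)
    · exact h1
    · exact absurd h (aux j' j h1 hj hno' _)
  subst hjj
  refine ⟨rfl, ?_⟩
  -- A place cannot be allowed for both reasons, as `c ≤ r < g`.
  have hboth : ∀ c d L e g d', Allowed r Q l j c d → ¬ AllowedSecond r Q T l j L e g d' := by
    rintro c d L e g d' ⟨-, hp, hc, -⟩ ⟨hw, -, hp', -⟩
    have h1 := (hQ.2 (e, g) (by rw [hw]; simp)).2
    have h2 := (hp.unique hQ.1 hp').1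
    omega
  rcases h with ⟨c, d, ha, rfl⟩ | ⟨L, e, g, d, ha, rfl⟩ <;>
  rcases h' with ⟨c', d', ha', rfl⟩ | ⟨L', e', g', d', ha', rfl⟩
  · obtain ⟨rfl, rfl⟩ := ha.2.1.unique hQ.1 ha'.2.1
    rfl
  · exact absurd ha' (hboth _ _ _ _ _ _ ha)
  · exact absurd ha (hboth _ _ _ _ _ _ ha')
  · obtain ⟨rfl, h1⟩ := concat_inj (ha.1.symm.trans ha'.1)
    obtain ⟨rfl, rfl⟩ := Prod.mk.inj h1
    obtain ⟨-, rfl⟩ := ha.2.2.1.unique hQ.1 ha'.2.2.1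
    rfl

lemma RectifyStep.unique {r l : ℕ} {w : Perm ℕ} {Q Q₁ Q₂ : Graph} {T T₁ T₂ : Tableau (ℕ × ℕ)}
    (hQ : IsRegular r Q T) (h₁ : RectifyStep r l w Q T Q₁ T₁)
    (h₂ : RectifyStep r l w Q T Q₂ T₂) : Q₁ = Q₂ ∧ T₁ = T₂ := by
  rcases h₁ with ⟨hv, rfl, rfl⟩ | ⟨hv, j, Q', T', h3, h4⟩ <;>
  rcases h₂ with ⟨hv', rfl, rfl⟩ | ⟨hv', j', Q'', T'', h3', h4'⟩
  · exact ⟨rfl, rfl⟩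
  · exact absurd hv hv'
  · exact absurd hv' hv
  · obtain ⟨rfl, rfl, rfl⟩ := h3.unique hQ h3'
    exact h4.unique (h3.regular hQ) h4'

/-- If the result of row `l + 1` is unique, and so is the way in which it is backtracked, then the
steps of row `l` have unique results. -/
theorem Step.unique {r : ℕ} {R Y : Graph} (hR : IsPlaced R) {l : ℕ}
    (hprev : l < r → ∃ U V S,
      (∀ U' V', Step r R Y (l + 1) (rowsFrom Y (l + 1)).card U' V' → U' = U ∧ V' = V) ∧
      IsBacktrack (perm (rowsFrom R (l + 1))) U V S ∧ ∀ j ≤ V.word.length, IsRcGraph (S j))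
    {i : ℕ} {Q Q' : Graph} {T T' : Tableau (ℕ × ℕ)} (h : Step r R Y l i Q T)
    (h' : Step r R Y l i Q' T') : Q = Q' ∧ T = T' := by
  induction i generalizing Q Q' T T' with
  | zero =>
    cases h with
    | start hD =>
      cases h' with
      | start hD' => rw [hD.hasRows.unique hD'.hasRows]; exact ⟨rfl, rfl⟩
      | rowToRow hl hp hS hD' =>
        have := (hp.regular hR).1
        omega
    | rowToRow hl hp hS hD =>
      have hlr := (hp.regular hR).1
      cases h' with
      | start hD' => omega
      | rowToRow hl' hp' hS' hD' =>
        obtain ⟨U, V, S, hU, hb, hrc⟩ := hprev hlr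
        obtain ⟨rfl, rfl⟩ := hU _ _ hp
        obtain ⟨rfl, rfl⟩ := hU _ _ hp'
        rw [hD.hasRows.unique hD'.hasRows, backtrack_unique hrc hb hS (Nat.zero_le _),
          backtrack_unique hrc hb hS' (Nat.zero_le _)]
        exact ⟨rfl, rfl⟩
  | succ i ih =>
    cases h with
    | insertion hcur hletter hstep =>
      cases h' with
      | insertion hcur' hletter' hstep' =>
        obtain ⟨rfl, rfl⟩ := ih hcur hcur'
        exact hstep.unique (hcur.regular hR).2 hstep'
      | rectification hp' hS' hcur' hletter' hk' hn' hab' hstep' =>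
        have := Option.some.inj (hletter.symm.trans hletter')
        omega
    | @rectification _ _ k n _ _ _ _ _ _ S₁ ab hp hS hcur hletter hk hn hab hstep =>
      cases h' with
      | insertion hcur' hletter' hstep' =>
        have := Option.some.inj (hletter.symm.trans hletter')
        omega
      | @rectification _ _ k' n' _ _ _ _ _ _ S₂ ab' hp' hS' hcur' hletter' hk' hn' hab' hstep' =>
        have hlr := (hp.regular hR).1
        obtain ⟨U, V, S, hU, hb, hrc⟩ := hprev hlr
        obtain ⟨rfl, rfl⟩ := ih hcur hcur'
        obtain ⟨rfl, rfl⟩ := hU _ _ hp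
        obtain ⟨rfl, rfl⟩ := hU _ _ hp'
        obtain rfl : n = n' := hn.trans hn'.symm
        obtain rfl := Option.some.inj (hab.symm.trans hab')
        have hlen := (List.getElem?_eq_some_iff.1 hab).1
        have hreg := (hcur.regular hR).2.add_crossing hS (hp.regular hR).2 hab
        rw [backtrack_unique hrc hb hS' (j := n + 1) hlen,
          backtrack_unique hrc hb hS' (j := n) hlen.le,
          ← backtrack_unique hrc hb hS (j := n + 1) hlen,
          ← backtrack_unique hrc hb hS (j := n) hlen.le] at hstep'
        exact hstep.unique hreg hstep'

/-! ### The steps of a row -/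

lemma IsFinitary.exists_bound {u : Perm ℕ} (hu : IsFinitary u) : ∃ M, ∀ k, M < k → u k = k := by
  obtain ⟨L, -, rfl⟩ := hu
  induction L with
  | nil => exact ⟨0, fun k _ => rfl⟩
  | cons i L ih =>
    obtain ⟨M, hM⟩ := ih
    refine ⟨M + i + 1, fun k hk => ?_⟩
    rw [wordPerm_cons, Perm.mul_apply, hM k (by omega), simple_apply, if_neg (by omega),
      if_neg (by omega)]

/-- The data from which a row of the algorithm starts. The row `l + 1` has produced, with lower
permutation `w'`, the chain `K` in a diagram with rows `m'`, and `S` is its backtrack; in row `l` a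
chain for `w` is to be built in the diagram `D` with rows `m`. `St i Q L` says that `i` steps of
row `l` lead to the graph `Q` and the chain `L`. -/
structure RowSetting (r l : ℕ) (w w' : Perm ℕ) (K : List (ℕ × ℕ)) (S : ℕ → Graph) (m m' : ℕ → ℕ)
    (D : YoungDiagram) (St : ℕ → Graph → List (ℕ × ℕ) → Prop) : Prop where
  one_le : 1 ≤ l
  le : l ≤ r
  finW : IsFinitary w
  chain : CoverChain r w' K
  rc : ∀ n ≤ K.length, IsRcGraph (S n) ∧ perm (S n) = w' * chainProd (K.take n)
  below : ∀ n ≤ K.length, ∀ p ∈ S n, l < p.1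
  subset : ∀ n < K.length, S n ⊆ S (n + 1)
  length_eq : K.length = rowOffset m' r
  strict : StrictFilling r m' (chainEntries w' K)
  rows : HasRows r D m
  le_rows : ∀ t < r, m' t ≤ m t
  interlace : ∀ t, t + 1 < r → m t ≤ m' (t + 1)
  insertion : ∀ t j Q L Q' L', t < r → m' t ≤ j → j < m t → St (rowOffset m t + j) Q L →
    InsertionStep r l Q ⟨D, L⟩ Q' ⟨D, L'⟩ → St (rowOffset m t + (j + 1)) Q' L'
  rectification : ∀ t j Q L Q' L' ab, t < r → j < m' t → St (rowOffset m t + j) Q L →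
    K[rowOffset m' t + j]? = some ab →
    RectifyStep r l w (Q ∪ (S (rowOffset m' t + j + 1) \ S (rowOffset m' t + j)))
      ⟨D, L ++ [ab]⟩ Q' ⟨D, L'⟩ → St (rowOffset m t + (j + 1)) Q' L'

/-- The number of boxes of the smaller shape among the first `j` boxes of row `t` and the boxes
below them. -/
def lowerIndex (m' : ℕ → ℕ) (t j : ℕ) : ℕ := rowOffset m' t + min j (m' t)

/-- The state of the algorithm before box `j` of row `t` is filled: the graph consists of a graph of
the backtrack and of a row with labels `C`, which has grown by the number of insertions, and the
entries of `E` are strict so far. If the last box belongs to the smaller shape, then it is ready for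
the next box to its right. -/
structure LoopState (r l : ℕ) (w w' : Perm ℕ) (K : List (ℕ × ℕ)) (S : ℕ → Graph) (m m' : ℕ → ℕ)
    (St : ℕ → Graph → List (ℕ × ℕ) → Prop) (N : ℕ) (t j : ℕ) (C : Finset ℕ)
    (L : List (ℕ × ℕ)) : Prop where
  step : St (rowOffset m t + j) (S (lowerIndex m' t j) ∪ rowGraph l C) L
  state : RowState r l w (perm (S (lowerIndex m' t j))) C L
  card : C.card + lowerIndex m' t j = N + (rowOffset m t + j)
  length_eq : L.length = rowOffset m t + j
  strict : StrictFilling r m (chainEntries w L)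
  rowInv : 1 ≤ j → j ≤ m' t → ∀ L₀ α β q, L = L₀ ++ [(α, β)] →
    (chainEntries w' K)[rowOffset m' t + (j - 1)]? = some q →
    RowInv r (perm (S (lowerIndex m' t j))) C α β q

section
variable {r l N : ℕ} {w w' : Perm ℕ} {K : List (ℕ × ℕ)} {S : ℕ → Graph} {m m' : ℕ → ℕ}
  {D : YoungDiagram} {St : ℕ → Graph → List (ℕ × ℕ) → Prop}

namespace RowSetting

lemma lowerIndex_le (X : RowSetting r l w w' K S m m' D St) {t j : ℕ} (ht : t < r) :
    lowerIndex m' t j ≤ K.length := by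
  have h1 := rowOffset_mono m' (show t + 1 ≤ r from ht)
  rw [rowOffset_succ] at h1
  rw [X.length_eq, lowerIndex]
  have := min_le_right j (m' t)
  omega

lemma isLayered (X : RowSetting r l w w' K S m m' D St) {n : ℕ} (hn : n ≤ K.length)
    {C : Finset ℕ} (hC : ∀ p ∈ C, l ≤ p) : IsLayered l (S n) C :=
  ⟨X.one_le, fun p hp => ⟨X.below n hn p hp, ((isRcGraph_iff.1 (X.rc n hn).1).1 p hp).2⟩, hC⟩

lemma fix (X : RowSetting r l w w' K S m m' D St) {n : ℕ} (hn : n ≤ K.length) :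
    ∀ k ≤ l, perm (S n) k = k := fun k hk =>
  perm_fix (m := l + 1)
    (fun p hp => ⟨X.below n hn p hp, ((isRcGraph_iff.1 (X.rc n hn).1).1 p hp).2⟩)
    (by omega)

/-- The next box of the lower chain. -/
lemma next (X : RowSetting r l w w' K S m m' D St) {t j : ℕ} (ht : t < r) (hj : j < m' t) :
    ∃ a b, K[rowOffset m' t + j]? = some (a, b) ∧ rowOffset m' t + j + 1 ≤ K.length ∧
      lowerIndex m' t j = rowOffset m' t + j ∧ lowerIndex m' t (j + 1) = rowOffset m' t + j + 1 ∧
      1 ≤ a ∧ a ≤ r ∧ r < b ∧ Cover (perm (S (rowOffset m' t + j))) a b ∧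
      perm (S (rowOffset m' t + j + 1)) = perm (S (rowOffset m' t + j)) * swap a b ∧
      (chainEntries w' K)[rowOffset m' t + j]? = some (perm (S (rowOffset m' t + j)) a) := by
  have h1 : lowerIndex m' t (j + 1) = rowOffset m' t + j + 1 := by
    rw [lowerIndex, min_eq_left (by omega)]
    rfl
  have h2 : lowerIndex m' t j = rowOffset m' t + j := by rw [lowerIndex, min_eq_left (by omega)]
  have h3 := X.lowerIndex_le (j := j + 1) ht
  rw [h1] at h3
  obtain ⟨⟨a, b⟩, hK⟩ : ∃ p, K[rowOffset m' t + j]? = some p := ⟨_, List.getElem?_eq_getElem h3⟩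
  obtain ⟨h4, h5, h6, h7⟩ := X.chain.at hK
  have h8 := (X.rc (rowOffset m' t + j) (by omega)).2
  refine ⟨a, b, hK, h3, h2, h1, h4, h5, h6, ?_, ?_, ?_⟩
  · rw [h8]; exact h7
  · rw [h8, (X.rc _ h3).2, take_succ_of_getElem? hK, mul_assoc, ← chainProd_concat]
  · rw [h8]; exact getElem?_chainEntries hK

end RowSetting

namespace LoopState

/-- A rectified box completes the next state. -/
lemma rectified (X : RowSetting r l w w' K S m m' D St) {t j : ℕ} {C : Finset ℕ}
    {L : List (ℕ × ℕ)} (Z : LoopState r l w w' K S m m' St N t j C L) (ht : t < r) (hj : j < m' t)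
    {a b : ℕ} (hab : K[rowOffset m' t + j]? = some (a, b)) {C' : Finset ℕ} {L' : List (ℕ × ℕ)}
    {v : ℕ} (P : RowState r l w (perm (S (rowOffset m' t + j + 1))) C' L')
    (hcard : C'.card = C.card) (hent : chainEntries w L' = chainEntries w L ++ [v])
    (hrow : ∀ x, 1 ≤ j → (chainEntries w L)[rowOffset m t + (j - 1)]? = some x → x < v)
    (hcol : ∀ s x, t = s + 1 → j < m s → (chainEntries w L)[rowOffset m s + j]? = some x → v < x)
    (hinv : ∀ L₀ α β, L' = L₀ ++ [(α, β)] →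
      RowInv r (perm (S (rowOffset m' t + j + 1))) C' α β (perm (S (rowOffset m' t + j)) a))
    (hstep : RectifyStep r l w (S (rowOffset m' t + j + 1) ∪ rowGraph l C) ⟨D, L ++ [(a, b)]⟩
      (S (rowOffset m' t + j + 1) ∪ rowGraph l C') ⟨D, L'⟩) :
    LoopState r l w w' K S m m' St N t (j + 1) C' L' := by
  obtain ⟨a', b', hab', hlen, h1, h2, -, -, -, -, -, hE⟩ := X.next ht hj
  obtain ⟨rfl, rfl⟩ := Prod.mk.inj (Option.some.inj (hab.symm.trans hab'))
  have hL := Z.length_eq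
  have hL' : L'.length = L.length + 1 := by
    have := congrArg List.length hent
    simpa using this
  have hjm : j < m t := hj.trans_le (X.le_rows t ht)
  constructor
  · rw [h2]
    have hs := Z.step
    rw [h1] at hs
    refine X.rectification t j _ L _ L' (a, b) ht hj hs hab ?_
    have : S (rowOffset m' t + j) ∪ rowGraph l C ∪
        (S (rowOffset m' t + j + 1) \ S (rowOffset m' t + j)) =
        S (rowOffset m' t + j + 1) ∪ rowGraph l C := by
      rw [Finset.union_right_comm, Finset.union_sdiff_of_subset (X.subset _ hlen)]
    rw [this]
    exact hstep
  · rw [h2]; exact P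
  · have := Z.card
    rw [h1] at this
    rw [h2, hcard]
    omega
  · omega
  · rw [hent]
    exact Z.strict.concat (fun s t => X.rows.mono) hjm (by simp [hL]) hrow hcol
  · intro _ _ L₀ α β q hL₀ hq
    rw [Nat.add_sub_cancel, hE] at hq
    rw [h2, ← Option.some.inj hq]
    exact hinv L₀ α β hL₀

lemma isRcGraph_succ (X : RowSetting r l w w' K S m m' D St) {n : ℕ} (hn : n ≤ K.length)
    {C : Finset ℕ} {L : List (ℕ × ℕ)} (P : RowState r l w (perm (S n)) C L) :
    IsRcGraph (S n ∪ rowGraph l C) ∧ perm (S n ∪ rowGraph l C) = w * chainProd L := by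
  have h := X.isLayered hn P.labels
  exact ⟨h.isRcGraph (X.rc n hn).1 P.good, by rw [h.perm_eq, P.eq]⟩

lemma rectify_of_keep (X : RowSetting r l w w' K S m m' D St) {n : ℕ} (hn : n ≤ K.length)
    {C : Finset ℕ} {L : List (ℕ × ℕ)} (P : RowState r l w (perm (S n)) C L)
    (hs : StrictFilling r m (chainEntries w L)) :
    RectifyStep r l w (S n ∪ rowGraph l C) ⟨D, L⟩ (S n ∪ rowGraph l C) ⟨D, L⟩ := by
  obtain ⟨h1, h2⟩ := isRcGraph_succ X hn P
  exact Or.inl ⟨valid_of P.chain X.finW X.rows hs h1 h2, rfl, rfl⟩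

lemma rectify_of_row (X : RowSetting r l w w' K S m m' D St) {n : ℕ} (hn : n ≤ K.length)
    {C C' : Finset ℕ} {L L' : List (ℕ × ℕ)} {a b : ℕ} (hC : ∀ p ∈ C, l ≤ p)
    (hv : ¬ Valid r w (S n ∪ rowGraph l C) ⟨D, L ++ [(a, b)]⟩)
    (h : RowRectification r (perm (S n)) C L a b C' L') :
    RectifyStep r l w (S n ∪ rowGraph l C) ⟨D, L ++ [(a, b)]⟩ (S n ∪ rowGraph l C') ⟨D, L'⟩ :=
  Or.inr ⟨hv, exists_removal_reinsertion (X.isLayered hn hC) X.le (X.fix hn) D h⟩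

/-- The last filled box, if there is one in the row. -/
lemma exists_last {t j : ℕ} {C : Finset ℕ} {L : List (ℕ × ℕ)}
    (Z : LoopState r l w w' K S m m' St N t j C L) (h : 1 ≤ rowOffset m t + j) :
    ∃ L₀ α β, L = L₀ ++ [(α, β)] ∧
      (chainEntries w L)[rowOffset m t + j - 1]? =
        some (rowPerm C (perm (S (lowerIndex m' t j)) β)) ∧
      L[rowOffset m t + j - 1]? = some (α, β) := by
  have hne : L ≠ [] := fun h0 => by
    have := Z.length_eq
    rw [h0] at this
    simp at this
    omega
  obtain ⟨L₀, ⟨α, β⟩, rfl⟩ : ∃ L₀ p, L = L₀ ++ [p] :=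
    ⟨L.dropLast, L.getLast hne, (List.dropLast_append_getLast hne).symm⟩
  have hl : rowOffset m t + j - 1 = L₀.length := by
    have := Z.length_eq
    simp at this
    omega
  refine ⟨L₀, α, β, rfl, ?_, ?_⟩
  · rw [hl, chainEntries_concat, List.getElem?_append_right (by simp),
      length_chainEntries, Nat.sub_self, ← Z.state.last_value]
    rfl
  · rw [hl]
    simp

/-- The place of an insertion; all positions to the right of it are taken by big strands. -/
lemma exists_place {n : ℕ} {C : Finset ℕ} {L : List (ℕ × ℕ)} (P : RowState r l w (perm (S n)) C L) :
    ∃ p, l ≤ p ∧ IsAllowed r (perm (S n)) C p ∧ (∀ k, p < k → ¬ IsAllowed r (perm (S n)) C k) ∧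
      (∀ k, p < k → r < (perm (S n))⁻¹ k) ∧
      ∀ s ≤ r, rowPerm C (perm (S n) s) ≤ p := by
  set u := perm (S n) with hu
  obtain ⟨M, hM⟩ := P.fin.exists_bound
  obtain ⟨B, hB⟩ : ∃ B, ∀ q ∈ C, q ≤ B := ⟨C.sup id, fun q hq => Finset.le_sup (f := id) hq⟩
  set e := M + B + r + 2 with he
  have hbigcarry : ∀ k, e ≤ k → r < u⁻¹ (carryPos C k) := by
    intro k hk
    rw [carryPos_of_gt fun q hq => by have := hB q hq; omega,
      Perm.inv_eq_iff_eq.2 (hM k (by omega)).symm]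
    omega
  have hsmall : u⁻¹ (carryPos C l) ≤ r := by
    rw [carryPos_eq_self P.labels, Perm.inv_eq_iff_eq.2 (P.fix l le_rfl).symm]
    exact P.le
  have hle : l ≤ e := by
    have := P.le
    omega
  obtain ⟨p₀, h1, h2, h3⟩ := exists_isAllowed hle hsmall (hbigcarry e le_rfl)
  obtain ⟨p, h4, h5, h6, h7⟩ := exists_rightmost (P := IsAllowed r u C) h2 h3
  have hno : ∀ k, p < k → ¬ IsAllowed r u C k := by
    intro k hk hal
    rcases lt_or_ge k e with hke | hke
    · exact h7 k hk hke hal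
    · have := hbigcarry k hke
      have := hal.2.1
      omega
  have hbig : ∀ k, p < k → r < u⁻¹ k := fun k hk =>
    big_of_not_isAllowed P.good (p := p) (e := max k e) (fun i hi _ => hno i hi)
      (hbigcarry _ (le_max_right _ _)) hk (le_max_left _ _)
  refine ⟨p, by omega, h6, hno, hbig, fun s hs => ?_⟩
  by_contra hp
  obtain ⟨h8, h9⟩ | ⟨h8, h9, h10⟩ := rowPerm_cases C (u s)
  · have := hbig (u s) (by omega)
    rw [perm_inv_apply] at this
    omega
  · have h11 : u⁻¹ (carryPos C (rowPerm C (u s))) ≤ r := by rwa [h10, perm_inv_apply]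
    obtain ⟨k, h12, -, h13⟩ := exists_isAllowed (n := max (rowPerm C (u s)) e)
      (le_max_left _ _) h11 (hbigcarry _ (le_max_right _ _))
    exact hno k (by omega) h13

/-- An inserted box completes the next state. -/
lemma inserted (X : RowSetting r l w w' K S m m' D St) {t j : ℕ} {C : Finset ℕ}
    {L : List (ℕ × ℕ)} (Z : LoopState r l w w' K S m m' St N t j C L) (ht : t < r) (hj : m' t ≤ j)
    (hjm : j < m t) : lowerIndex m' t (j + 1) = lowerIndex m' t j ∧
    ∃ p, IsAllowed r (perm (S (lowerIndex m' t j))) C p ∧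
      (∀ k, p < k → r < (perm (S (lowerIndex m' t j)))⁻¹ k) ∧
      LoopState r l w w' K S m m' St N t (j + 1) (insert p C)
        (L ++ [((perm (S (lowerIndex m' t j)))⁻¹ (carryPos C p),
          (perm (S (lowerIndex m' t j)))⁻¹ (p + 1))]) := by
  have hidx : lowerIndex m' t (j + 1) = lowerIndex m' t j := by
    rw [lowerIndex, lowerIndex, min_eq_right hj, min_eq_right (by omega)]
  have hn := X.lowerIndex_le (j := j) ht
  obtain ⟨p, hlp, hal, hno, hbig, hsm⟩ := exists_place Z.state
  refine ⟨hidx, p, hal, hbig, ?_⟩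
  obtain ⟨P, hv, -⟩ := Z.state.insert_place hal
  have hL := Z.length_eq
  constructor
  · rw [hidx]
    exact X.insertion t j _ L _ _ ht hj hjm Z.step
      (insertionStep_of (X.isLayered hn Z.state.labels) D L hlp hal hno)
  · rw [hidx]; exact P
  · have := Z.card
    rw [hidx, Finset.card_insert_of_notMem hal.1]
    omega
  · rw [List.length_append, List.length_singleton, hL]
    omega
  · rw [chainEntries_concat, hv]
    refine Z.strict.concat (fun s t => X.rows.mono) hjm (by simp [hL]) ?_ ?_
    · intro x hj1 hx
      obtain ⟨L₀, α, β, rfl, h1, -⟩ := Z.exists_last (by omega)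
      rw [show rowOffset m t + (j - 1) = rowOffset m t + j - 1 by omega, h1] at hx
      obtain rfl := Option.some.inj hx
      obtain ⟨-, hα, hβ, hc⟩ := Z.state.chain.last
      have h2 := hc.2.1
      rw [Z.state.last_value] at h2
      have h3 : (w * chainProd L₀) β = rowPerm C (perm (S (lowerIndex m' t j)) α) := by
        rw [← Z.state.value α, chainProd_concat, ← mul_assoc, mul_swap_apply_left]
      have := hsm α hα
      omega
    · intro s x hs hjs _
      have := X.interlace s (by omega)
      subst hs
      omega
  · intro _ h
    omega

/-- After the last box of a row the next row begins. -/
lemma next_row (X : RowSetting r l w w' K S m m' D St) {t : ℕ} {C : Finset ℕ}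
    {L : List (ℕ × ℕ)} (Z : LoopState r l w w' K S m m' St N t (m t) C L) (ht : t < r) :
    lowerIndex m' (t + 1) 0 = lowerIndex m' t (m t) ∧
      LoopState r l w w' K S m m' St N (t + 1) 0 C L := by
  have hidx : lowerIndex m' (t + 1) 0 = lowerIndex m' t (m t) := by
    rw [lowerIndex, lowerIndex, Nat.zero_min, min_eq_right (X.le_rows t ht), rowOffset_succ]
    rfl
  refine ⟨hidx, ?_⟩
  constructor
  · rw [hidx, rowOffset_succ]; exact Z.step
  · rw [hidx]; exact Z.state
  · rw [hidx, rowOffset_succ]; exact Z.card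
  · rw [rowOffset_succ]; exact Z.length_eq
  · exact Z.strict
  · intro h; omega

end LoopState
end

section
variable {r l N : ℕ} {w w' : Perm ℕ} {K : List (ℕ × ℕ)} {S : ℕ → Graph} {m m' : ℕ → ℕ}
  {D : YoungDiagram} {St : ℕ → Graph → List (ℕ × ℕ) → Prop}

namespace LoopState

/-- Rectification of a box which is not the first one of its row. Either a box `(α, β)` is appended
such that the positions from that of `β` to the one which `b` has now are taken by big strands, or
two big strands are out of order. -/
lemma row_box (X : RowSetting r l w w' K S m m' D St) {t j : ℕ} {C : Finset ℕ}
    {L : List (ℕ × ℕ)} (Z : LoopState r l w w' K S m m' St N t j C L) (ht : t < r) (hj1 : 1 ≤ j)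
    (hj : j < m' t) {a b : ℕ} (hab : K[rowOffset m' t + j]? = some (a, b))
    {u u' : Perm ℕ} (hu : u = perm (S (rowOffset m' t + j)))
    (hu' : u' = perm (S (rowOffset m' t + j + 1))) :
    ∃ C' L₁ α β v, RowState r l w u' C' (L₁ ++ [(α, β)]) ∧
      chainEntries w (L₁ ++ [(α, β)]) = chainEntries w L ++ [v] ∧
      ((L₁ = L ∧ u' β ≤ u a ∧ ∀ k, u' β ≤ k → k ≤ u a → r < u'⁻¹ k) ∨
        ∃ d, β < d ∧ r < β ∧ (w * chainProd (L₁ ++ [(α, β)])) d <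
          (w * chainProd (L₁ ++ [(α, β)])) β) ∧
      ((∀ s x, t = s + 1 → j < m s → (chainEntries w L)[rowOffset m s + j]? = some x → v < x) →
        LoopState r l w w' K S m m' St N t (j + 1) C' (L₁ ++ [(α, β)])) := by
  obtain ⟨a', b', hab', hlen, h1, h2, ha, har, hb, hc, hswap, hE⟩ := X.next ht hj
  obtain ⟨rfl, rfl⟩ := Prod.mk.inj (Option.some.inj (hab.symm.trans hab'))
  have P := Z.state
  have hinv := fun q L₀ α β hL hq => Z.rowInv hj1 hj.le L₀ α β q hL hq
  obtain ⟨L₀, α, β, rfl, hev, -⟩ := Z.exists_last (by omega)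
  rw [h1] at P hinv hev
  rw [← hu] at P hinv hev hE hc hswap
  rw [← hu'] at hswap
  have hidx : (chainEntries w' K)[rowOffset m' t + (j - 1)]? =
      some ((chainEntries w' K)[rowOffset m' t + (j - 1)]'(by
        rw [length_chainEntries]; omega)) := List.getElem?_eq_getElem _
  set qp := (chainEntries w' K)[rowOffset m' t + (j - 1)]'(by rw [length_chainEntries]; omega)
  have I := hinv qp L₀ α β rfl hidx
  have hqp : qp < u a := X.strict.row t (j - 1) qp (u a) ht (by omega) hidx
    (by rw [Nat.sub_add_cancel hj1]; exact hE)
  have hfix : ∀ k ≤ l, (u * swap a b) k = k := by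
    rw [← hswap, hu']; exact X.fix hlen
  have hrow : ∀ v, rowPerm C (u β) < v → ∀ x, 1 ≤ j →
      (chainEntries w (L₀ ++ [(α, β)]))[rowOffset m t + (j - 1)]? = some x → x < v := by
    intro v hv x _ hx
    rw [← Nat.add_sub_assoc hj1, hev] at hx
    rwa [← Option.some.inj hx]
  by_cases h : rowPerm C (u a) < rowPerm C (u b)
  · obtain ⟨P', I', -⟩ := P.keep ha har hb hc hfix h
    have hent : chainEntries w (L₀ ++ [(α, β)] ++ [(a, b)]) =
        chainEntries w (L₀ ++ [(α, β)]) ++ [rowPerm C (u a)] := by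
      rw [chainEntries_concat, P.value]
    rw [← hswap] at P' I'
    have hub : u' b = u a := by rw [hswap, mul_swap_apply_right]
    refine ⟨C, L₀ ++ [(α, β)], a, b, rowPerm C (u a), P', hent, Or.inl ⟨rfl, hub.le, ?_⟩, ?_⟩
    · intro k hk1 hk2
      rw [show k = u' b by omega, perm_inv_apply]
      exact hb
    · intro hcol
      rw [hu'] at P' I'
      refine Z.rectified X ht hj hab P' rfl hent (hrow _ (I.small a har hqp)) hcol ?_ ?_
      · intro L₁ α' β' hL
        obtain ⟨-, hp⟩ := concat_inj hL
        obtain ⟨rfl, rfl⟩ := Prod.mk.inj hp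
        rw [← hu]
        exact I'
      · refine rectify_of_keep X hlen P' ?_
        rw [hent]
        exact Z.strict.concat (fun s t => X.rows.mono) (hj.trans_le (X.le_rows t ht))
          (by rw [length_chainEntries]; exact Z.length_eq) (hrow _ (I.small a har hqp)) hcol
  · have hne : rowPerm C (u a) ≠ rowPerm C (u b) := fun e => by
      have := u.injective ((rowPerm C).injective e)
      omega
    have h' : rowPerm C (u b) < rowPerm C (u a) := by omega
    obtain ⟨C', L₁, α', β', v, hR, P', hcard, -, hent, hv, I', hlab⟩ :=
      P.row_step ha har hb I hc hqp hfix h'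
    rw [← hswap] at hR P' I' hlab
    refine ⟨C', L₁, α', β', v, P', hent, hlab, fun hcol => ?_⟩
    rw [hu'] at P' I' hR
    refine Z.rectified X ht hj hab P' hcard hent (hrow v hv) hcol ?_ ?_
    · intro L₁ α₁ β₁ hL
      obtain ⟨-, hp⟩ := concat_inj hL
      obtain ⟨rfl, rfl⟩ := Prod.mk.inj hp
      rw [← hu]
      exact I'
    · refine rectify_of_row X hlen P.labels ?_ hR
      refine not_valid_of_lt (P.chain.isFinitary P.finW) ha hc.1 ?_
      rw [P.value, P.value]
      exact h'

/-- Rectification of the first box of a row, if no place of the second kind can be used. -/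
lemma first_box (X : RowSetting r l w w' K S m m' D St) {t : ℕ} {C : Finset ℕ}
    {L : List (ℕ × ℕ)} (Z : LoopState r l w w' K S m m' St N t 0 C L) (ht : t < r)
    (hj : 0 < m' t) {a b : ℕ} (hab : K[rowOffset m' t + 0]? = some (a, b))
    {u u' : Perm ℕ} (hu : u = perm (S (rowOffset m' t + 0)))
    (hu' : u' = perm (S (rowOffset m' t + 0 + 1)))
    (hlast : ∀ L₀ α β, L = L₀ ++ [(α, β)] → u a ≤ u' β) :
    ∃ C' α β v, RowState r l w u' C' (L ++ [(α, β)]) ∧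
      chainEntries w (L ++ [(α, β)]) = chainEntries w L ++ [v] ∧
      u' β ≤ u a ∧ (∀ k, u' β ≤ k → k ≤ u a → r < u'⁻¹ k) ∧ ColInv r u' C' α β (u a) ∧
      ((∀ s x, t = s + 1 → 0 < m s → (chainEntries w L)[rowOffset m s + 0]? = some x → v < x) →
        LoopState r l w w' K S m m' St N t 1 C' (L ++ [(α, β)])) := by
  obtain ⟨a', b', hab', hlen, h1, h2, ha, har, hb, hc, hswap, hE⟩ := X.next ht hj
  obtain ⟨rfl, rfl⟩ := Prod.mk.inj (Option.some.inj (hab.symm.trans hab'))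
  have P := Z.state
  rw [h1] at P
  rw [← hu] at P hE hc hswap
  rw [← hu'] at hswap
  have hfix : ∀ k ≤ l, (u * swap a b) k = k := by
    rw [← hswap, hu']; exact X.fix hlen
  by_cases h : rowPerm C (u a) < rowPerm C (u b)
  · obtain ⟨P', I', J'⟩ := P.keep ha har hb hc hfix h
    have hent : chainEntries w (L ++ [(a, b)]) = chainEntries w L ++ [rowPerm C (u a)] := by
      rw [chainEntries_concat, P.value]
    rw [← hswap] at P' I' J'
    have hub : u' b = u a := by rw [hswap, mul_swap_apply_right]
    refine ⟨C, a, b, rowPerm C (u a), P', hent, hub.le, ?_, J', ?_⟩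
    · intro k hk1 hk2
      rw [show k = u' b by omega, perm_inv_apply]
      exact hb
    · intro hcol
      rw [hu'] at P' I'
      refine Z.rectified X ht hj hab P' rfl hent (fun x hx => by omega) hcol ?_ ?_
      · intro L₁ α' β' hL
        obtain ⟨-, hp⟩ := concat_inj hL
        obtain ⟨rfl, rfl⟩ := Prod.mk.inj hp
        rw [← hu]
        exact I'
      · refine rectify_of_keep X hlen P' ?_
        rw [hent]
        exact Z.strict.concat (fun s t => X.rows.mono) (hj.trans_le (X.le_rows t ht))
          (by rw [length_chainEntries]; exact Z.length_eq) (fun x hx => by omega) hcol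
  · have hne : rowPerm C (u a) ≠ rowPerm C (u b) := fun e => by
      have := u.injective ((rowPerm C).injective e)
      omega
    have h' : rowPerm C (u b) < rowPerm C (u a) := by omega
    obtain ⟨C', c, d, v, hR, P', hcard, hent, I', J', hd, hbig⟩ :=
      P.first_step ha hb hc hfix (by rw [← hswap]; exact hlast) h'
    rw [← hswap] at hR P' I' J' hd hbig
    refine ⟨C', c, d, v, P', hent, hd, hbig, J', fun hcol => ?_⟩
    rw [hu'] at P' I' hR
    refine Z.rectified X ht hj hab P' hcard hent (fun x hx => by omega) hcol ?_ ?_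
    · intro L₁ α₁ β₁ hL
      obtain ⟨-, hp⟩ := concat_inj hL
      obtain ⟨rfl, rfl⟩ := Prod.mk.inj hp
      rw [← hu]
      exact I'
    · refine rectify_of_row X hlen P.labels ?_ hR
      refine not_valid_of_lt (P.chain.isFinitary P.finW) ha hc.1 ?_
      rw [P.value, P.value]
      exact h'

/-- Rectification of the first box of a row, if the box below it was filled just before. -/
lemma col_box (X : RowSetting r l w w' K S m m' D St) {t s : ℕ} {C : Finset ℕ}
    {L₀ : List (ℕ × ℕ)} {α β qp : ℕ}
    (Z : LoopState r l w w' K S m m' St N t 0 C (L₀ ++ [(α, β)])) (ht : t < r) (hts : t = s + 1)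
    (hms : m s = 1) (hj : 0 < m' t) {a b : ℕ} (hab : K[rowOffset m' t + 0]? = some (a, b))
    {u u' : Perm ℕ} (hu : u = perm (S (rowOffset m' t + 0)))
    (hu' : u' = perm (S (rowOffset m' t + 0 + 1)))
    (J : ColInv r u C α β qp) (hqp : u a < qp) :
    ∃ C' L₁ c d, ColInv r u' C' c d (u a) ∧
        LoopState r l w w' K S m m' St N t 1 C' (L₁ ++ [(c, d)]) := by
  obtain ⟨a', b', hab', hlen, h1, h2, ha, har, hb, hc, hswap, hE⟩ := X.next ht hj
  obtain ⟨rfl, rfl⟩ := Prod.mk.inj (Option.some.inj (hab.symm.trans hab'))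
  have P := Z.state
  have hoff : rowOffset m t = rowOffset m s + 1 := by rw [hts, rowOffset_succ, hms]
  obtain ⟨L₀', α', β', hL, hev, -⟩ := Z.exists_last (by omega)
  obtain ⟨rfl, hp⟩ := concat_inj hL
  obtain ⟨rfl, rfl⟩ := Prod.mk.inj hp
  rw [h1] at P hev
  rw [← hu] at P hE hc hswap hev
  rw [← hu'] at hswap
  have hfix : ∀ k ≤ l, (u * swap a b) k = k := by
    rw [← hswap, hu']; exact X.fix hlen
  rw [show rowOffset m t + 0 - 1 = rowOffset m s + 0 by omega] at hev
  have hcol : ∀ v, v < rowPerm C (u β) → ∀ s x, t = s + 1 → 0 < m s →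
      (chainEntries w (L₀ ++ [(α, β)]))[rowOffset m s + 0]? = some x → v < x := by
    intro v hv s' x hs' _ hx
    obtain rfl : s = s' := by omega
    rw [hev] at hx
    rwa [← Option.some.inj hx]
  have hne : rowPerm C (u a) ≠ rowPerm C (u b) := fun e => by
    have := u.injective ((rowPerm C).injective e)
    omega
  have hne' : rowPerm C (u a) ≠ rowPerm C (u β) := fun e => by
    have := u.injective ((rowPerm C).injective e)
    have := P.chain.last.2.2.1
    omega
  by_cases h : rowPerm C (u b) < rowPerm C (u a) ∨ rowPerm C (u β) < rowPerm C (u a)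
  · obtain ⟨C', L₁, c, d, v, hR, P', hcard, -, hent, hv, I', J'⟩ :=
      P.col_step ha har hb J hc hqp hfix h
    rw [← hswap] at hR P' I' J'
    refine ⟨C', L₁, c, d, J', ?_⟩
    rw [hu'] at P' I' hR
    refine Z.rectified X ht hj hab P' hcard hent (fun x hx => by omega) (hcol v hv) ?_ ?_
    · intro L₁ α₁ β₁ hL
      obtain ⟨-, hp⟩ := concat_inj hL
      obtain ⟨rfl, rfl⟩ := Prod.mk.inj hp
      rw [← hu]
      exact I'
    · refine rectify_of_row X hlen P.labels ?_ hR
      rcases h with h | h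
      · refine not_valid_of_lt (P.chain.isFinitary P.finW) ha hc.1 ?_
        rw [P.value, P.value]
        exact h
      · have hlenL := Z.length_eq
        refine not_valid_of_col X.rows (t := s) (j := 0) (x := rowPerm C (u β))
          (y := rowPerm C (u a)) (by omega) (by omega) ?_ ?_ h
        · rw [chainEntries_concat]
          exact getElem?_append_of_some hev
        · rw [chainEntries_concat, P.value, ← hts, ← hlenL,
            ← length_chainEntries w (L₀ ++ [(α, β)])]
          simp
  · push Not at h
    obtain ⟨P', I', J'⟩ := P.keep ha har hb hc hfix (by omega)
    have hent : chainEntries w (L₀ ++ [(α, β)] ++ [(a, b)]) =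
        chainEntries w (L₀ ++ [(α, β)]) ++ [rowPerm C (u a)] := by
      rw [chainEntries_concat, P.value]
    rw [← hswap] at P' I' J'
    refine ⟨C, L₀ ++ [(α, β)], a, b, J', ?_⟩
    rw [hu'] at P' I'
    have hcol' := hcol (rowPerm C (u a)) (by omega)
    refine Z.rectified X ht hj hab P' rfl hent (fun x hx => by omega) hcol' ?_ ?_
    · intro L₁ α' β' hL
      obtain ⟨-, hp⟩ := concat_inj hL
      obtain ⟨rfl, rfl⟩ := Prod.mk.inj hp
      rw [← hu]
      exact I'
    · refine rectify_of_keep X hlen P' ?_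
      rw [hent]
      exact Z.strict.concat (fun s t => X.rows.mono) (hj.trans_le (X.le_rows t ht))
        (by rw [length_chainEntries]; exact Z.length_eq) (fun x hx => by omega) hcol'
end LoopState

/-! ### Hooks -/

/-- The last box of the chain is ready for the next box above it; `s` is its row. -/
def ColReady (r : ℕ) (w' : Perm ℕ) (K : List (ℕ × ℕ)) (m' : ℕ → ℕ) (u : Perm ℕ) (C : Finset ℕ)
    (L : List (ℕ × ℕ)) (s : ℕ) : Prop :=
  ∀ L₀ α β q, L = L₀ ++ [(α, β)] → (1 ≤ m' s → (chainEntries w' K)[rowOffset m' s]? = some q) →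
    ColInv r u C α β q

/-- A state for a hook: in the first column the last box is ready for the next one above it. -/
structure HookState (r l : ℕ) (w w' : Perm ℕ) (K : List (ℕ × ℕ)) (S : ℕ → Graph) (m m' : ℕ → ℕ)
    (St : ℕ → Graph → List (ℕ × ℕ) → Prop) (N : ℕ) (t j : ℕ) (C : Finset ℕ)
    (L : List (ℕ × ℕ)) : Prop where
  loop : LoopState r l w w' K S m m' St N t j C L
  cur : j = 1 → ColReady r w' K m' (perm (S (lowerIndex m' t j))) C L t
  prev : j = 0 → ∀ s, t = s + 1 → m s = 1 →
    ColReady r w' K m' (perm (S (lowerIndex m' t j))) C L s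

lemma HookState.step (X : RowSetting r l w w' K S m m' D St) (hh : ∀ t, t + 1 < r → m t ≤ 1)
    {t j : ℕ} {C : Finset ℕ} {L : List (ℕ × ℕ)}
    (Z : HookState r l w w' K S m m' St N t j C L) (ht : t < r) (hj : j < m t) :
    ∃ C' L', HookState r l w w' K S m m' St N t (j + 1) C' L' := by
  rcases le_or_gt (m' t) j with hj' | hj'
  · obtain ⟨hidx, p, hal, hbig, Z'⟩ := Z.loop.inserted X ht hj' hj
    refine ⟨_, _, Z', fun hj0 => ?_, fun h => by omega⟩
    rw [hidx]
    intro L₀ α β q hL _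
    obtain ⟨-, hp⟩ := concat_inj hL
    obtain ⟨rfl, rfl⟩ := Prod.mk.inj hp
    exact colInv_insert (e := q) (by omega) fun k hk _ => hbig k hk
  obtain ⟨a, b, hab, hlen, h1, h2, ha, har, hb, hc, hswap, hE⟩ := X.next ht hj'
  rcases Nat.eq_zero_or_pos j with rfl | hj1
  · have hready : ∀ C' (L₁ : List (ℕ × ℕ)) c d,
        ColInv r (perm (S (rowOffset m' t + 0 + 1))) C' c d (perm (S (rowOffset m' t + 0)) a) →
        ColReady r w' K m' (perm (S (lowerIndex m' t (0 + 1)))) C' (L₁ ++ [(c, d)]) t := by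
      intro C' L₁ c d J L₂ α β q hL hq
      obtain ⟨-, hp⟩ := concat_inj hL
      obtain ⟨rfl, rfl⟩ := Prod.mk.inj hp
      rw [h2, ← Option.some.inj (hE.symm.trans (hq hj'))]
      exact J
    have hfirst : L = [] → ∃ C' L', HookState r l w w' K S m m' St N t (0 + 1) C' L' := by
      rintro rfl
      obtain ⟨C', c, d, v, -, -, -, -, J, hZ⟩ := Z.loop.first_box X ht hj' hab rfl rfl
        (fun L₀ α β h => by simp at h)
      exact ⟨C', _, hZ (fun s x _ _ hx => by simp [chainEntries] at hx),
        fun _ => hready C' [] c d J, fun h => by omega⟩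
    rcases Nat.eq_zero_or_pos t with rfl | ht0
    · refine hfirst ?_
      have := Z.loop.length_eq
      rw [rowOffset_zero] at this
      exact List.length_eq_zero_iff.1 this
    obtain ⟨s, rfl⟩ : ∃ s, t = s + 1 := ⟨t - 1, by omega⟩
    rcases Nat.eq_zero_or_pos (m s) with hms | hms
    · refine hfirst ?_
      have h3 : rowOffset m (s + 1) = 0 :=
        Finset.sum_eq_zero fun i hi => by
          have := X.rows.mono (s := i) (t := s) (by have := Finset.mem_range.1 hi; omega) (by omega)
          omega
      have := Z.loop.length_eq
      rw [h3] at this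
      exact List.length_eq_zero_iff.1 this
    · have hms1 : m s = 1 := by
        have := hh s ht
        omega
      obtain ⟨L₀, α, β, rfl, -, -⟩ := Z.loop.exists_last (by rw [rowOffset_succ]; omega)
      have hR := Z.prev rfl s rfl hms1 L₀ α β
      rw [h1] at hR
      obtain ⟨q, hq, hJ⟩ : ∃ q, perm (S (rowOffset m' (s + 1) + 0)) a < q ∧
          ColInv r (perm (S (rowOffset m' (s + 1) + 0))) C α β q := by
        rcases Nat.eq_zero_or_pos (m' s) with h0 | h0
        · exact ⟨_, Nat.lt_succ_self _, hR _ rfl fun h => by omega⟩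
        · have hlt : rowOffset m' s < (chainEntries w' K).length := by
            rw [length_chainEntries]
            have := rowOffset_succ m' s
            omega
          refine ⟨_, X.strict.col s 0 _ _ ht h0 (List.getElem?_eq_getElem hlt) hE, hR _ rfl fun _ =>
            List.getElem?_eq_getElem hlt⟩
      obtain ⟨C', L₁, c, d, J', Z'⟩ := Z.loop.col_box X ht rfl hms1 hj' hab rfl rfl hJ hq
      exact ⟨C', _, Z', fun _ => hready C' L₁ c d J', fun h => by omega⟩
  · have hcol : ∀ s, t = s + 1 → ¬ j < m s := fun s hs hjs => by
      have := hh s (by omega)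
      omega
    obtain ⟨C', L₁, α, β, v, -, -, -, hZ⟩ := Z.loop.row_box X ht hj1 hj' hab rfl rfl
    exact ⟨C', _, hZ (fun s x hs hjs => absurd hjs (hcol s hs)), fun h => by omega,
      fun h => by omega⟩

lemma HookState.next_row (X : RowSetting r l w w' K S m m' D St)
    {t : ℕ} {C : Finset ℕ} {L : List (ℕ × ℕ)}
    (Z : HookState r l w w' K S m m' St N t (m t) C L) (ht : t < r) :
    HookState r l w w' K S m m' St N (t + 1) 0 C L := by
  obtain ⟨hidx, Z'⟩ := Z.loop.next_row X ht
  refine ⟨Z', fun h => by omega, fun _ s hs hms => ?_⟩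
  obtain rfl : t = s := by omega
  rw [hidx]
  exact Z.cur hms

/-- A loop over the boxes of a diagram, row by row. -/
lemma exists_loop {σ : Type*} {P : ℕ → ℕ → σ → Prop} {r : ℕ} {m : ℕ → ℕ}
    (h0 : ∃ x, P 0 0 x) (hstep : ∀ t j x, t < r → j < m t → P t j x → ∃ y, P t (j + 1) y)
    (hnext : ∀ t x, t < r → P t (m t) x → ∃ y, P (t + 1) 0 y) : ∃ x, P r 0 x := by
  have h1 : ∀ t, t ≤ r → ∃ x, P t 0 x := by
    intro t
    induction t with
    | zero => exact fun _ => h0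
    | succ t ih =>
      intro ht
      have h2 : ∀ j, j ≤ m t → ∃ x, P t j x := by
        intro j
        induction j with
        | zero => exact fun _ => ih (by omega)
        | succ j ihj =>
          intro hj
          obtain ⟨x, hx⟩ := ihj (by omega)
          exact hstep t j x (by omega) hj hx
      obtain ⟨x, hx⟩ := h2 (m t) le_rfl
      exact hnext t x (by omega) hx
  exact h1 r le_rfl

lemma HookState.exists_end (X : RowSetting r l w w' K S m m' D St)
    (hh : ∀ t, t + 1 < r → m t ≤ 1) {C : Finset ℕ}
    (Z : LoopState r l w w' K S m m' St N 0 0 C []) :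
    ∃ C' L', LoopState r l w w' K S m m' St N r 0 C' L' := by
  obtain ⟨⟨C', L'⟩, h⟩ := exists_loop (r := r) (m := m)
    (P := fun t j (x : Finset ℕ × List (ℕ × ℕ)) => HookState r l w w' K S m m' St N t j x.1 x.2)
    ⟨(C, []), Z, fun h => by omega, fun _ s hs => by omega⟩
    (fun t j x ht hj hx => by
      obtain ⟨C', L', h⟩ := hx.step X hh ht hj
      exact ⟨(C', L'), h⟩)
    (fun t x ht hx => ⟨x, hx.next_row X ht⟩)
  exact ⟨C', L', h.loop⟩
end

/-! ### Semi-shuffles -/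

/-- The big strands `r + 1, r + 2, …` have increasing positions. -/
def BigIncreasing (r : ℕ) (u : Perm ℕ) : Prop := ∀ i k, r < i → i < k → u i < u k

lemma BigIncreasing.le {r : ℕ} {u : Perm ℕ} (h : BigIncreasing r u) {i k : ℕ} (hi : r < i)
    (hik : i ≤ k) : u i ≤ u k := by
  rcases hik.eq_or_lt with rfl | hik
  · rfl
  · exact (h i k hi hik).le

lemma BigIncreasing.lt_of_lt {r : ℕ} {u : Perm ℕ} (h : BigIncreasing r u) {i k : ℕ} (hk : r < k)
    (hik : u i < u k) : i < k := by
  by_contra hn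
  have := h.le hk (not_lt.1 hn)
  omega

lemma BigIncreasing.mul_swap {r : ℕ} {u : Perm ℕ} (h : BigIncreasing r u) {a b : ℕ} (ha : a ≤ r)
    (hc : Cover u a b) : BigIncreasing r (u * swap a b) := by
  intro i k hi hik
  obtain ⟨h1, h2, h3⟩ := hc
  by_cases hib : i = b
  · subst hib
    rw [mul_swap_apply_right, mul_swap_apply_other u (by omega) (by omega)]
    exact h2.trans (h i k hi hik)
  · rw [mul_swap_apply_other u (by omega) hib]
    by_cases hkb : k = b
    · subst hkb
      rw [mul_swap_apply_right]
      have h4 := h3 i (by omega) hik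
      have h5 := h i k hi hik
      have h6 : u i ≠ u a := fun e => by
        have := u.injective e
        omega
      omega
    · rw [mul_swap_apply_other u (by omega) hkb]
      exact h i k hi hik

lemma CoverChain.bigIncreasing {r : ℕ} {w : Perm ℕ} {L : List (ℕ × ℕ)} (h : CoverChain r w L)
    (hw : BigIncreasing r w) : BigIncreasing r (w * chainProd L) := by
  induction L using List.reverseRecOn with
  | nil => simpa [chainProd] using hw
  | append_singleton L p ih =>
    obtain ⟨a, b⟩ := p
    obtain ⟨-, h1, -, h2⟩ := h.last
    rw [chainProd_concat, ← mul_assoc]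
    exact (ih h.of_append).mul_swap h1 h2

/-- The value of a big strand only decreases along a chain, so that it stays at most the entry of
the box in which the strand was used. -/
lemma CoverChain.apply_le_entry {r : ℕ} {w : Perm ℕ} {L : List (ℕ × ℕ)} (h : CoverChain r w L)
    {i a b x : ℕ} (hi : L[i]? = some (a, b)) (hx : (chainEntries w L)[i]? = some x) :
    (w * chainProd L) b ≤ x := by
  induction L using List.reverseRecOn with
  | nil => simp at hi
  | append_singleton L p ih =>
    obtain ⟨c, d⟩ := p
    obtain ⟨-, h1, h2, h3⟩ := h.last
    rw [chainProd_concat, ← mul_assoc]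
    rcases getElem?_concat hi with hi' | ⟨hi', hp⟩
    · have hlt := (List.getElem?_eq_some_iff.1 hi').1
      have hb := (h.of_append.at hi').2.2.1
      rw [chainEntries_concat, List.getElem?_append_left (by rw [length_chainEntries]; exact hlt)]
        at hx
      have h4 := ih h.of_append hi' hx
      by_cases hbd : b = d
      · subst hbd
        rw [mul_swap_apply_right]
        exact h3.2.1.le.trans h4
      · rwa [mul_swap_apply_other _ (by omega) hbd]
    · obtain ⟨rfl, rfl⟩ := Prod.mk.inj hp
      rw [chainEntries_concat, hi', ← length_chainEntries w L] at hx
      simp only [List.getElem?_concat_length, Option.some.injEq] at hx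
      rw [mul_swap_apply_right, hx]

/-- In a row the big strands increase from left to right. -/
lemma CoverChain.label_lt {r : ℕ} {w : Perm ℕ} {L : List (ℕ × ℕ)} (h : CoverChain r w L)
    (hw : BigIncreasing r w) {i a b c d x y : ℕ} (h1 : L[i]? = some (a, b))
    (h2 : L[i + 1]? = some (c, d)) (hx : (chainEntries w L)[i]? = some x)
    (hy : (chainEntries w L)[i + 1]? = some y) (hxy : x < y) : b < d := by
  have e1 := getElem?_chainEntries (w := w) h1
  have e2 := getElem?_chainEntries (w := w) h2
  rw [hx] at e1
  rw [hy] at e2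
  have e1 := Option.some.inj e1
  have e2 := Option.some.inj e2
  obtain ⟨-, -, hd, -, hcov, -⟩ := h.at h2
  have h3 : (w * chainProd (L.take (i + 1))) b = x := by
    rw [take_succ_of_getElem? h1, chainProd_concat, ← mul_assoc, mul_swap_apply_right, e1]
  refine ((h.take (i + 1)).bigIncreasing hw).lt_of_lt hd ?_
  omega

/-- The strands from `κ` to `κ'` have consecutive positions. -/
def Contiguous (u : Perm ℕ) (κ κ' : ℕ) : Prop := ∀ s, κ ≤ s → s < κ' → u (s + 1) = u s + 1

lemma Contiguous.mul_swap {u : Perm ℕ} {κ κ' a b : ℕ} (h : Contiguous u κ κ') (ha : a < κ)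
    (hb : b < κ ∨ κ' < b) : Contiguous (u * swap a b) κ κ' := by
  intro s h1 h2
  rw [mul_swap_apply_other u (by omega) (by omega), mul_swap_apply_other u (by omega) (by omega)]
  exact h s h1 h2

/-- A strand `b` which comes directly after another big one cannot be moved. -/
lemma Contiguous.le_of_cover {u : Perm ℕ} {κ κ' a b : ℕ} (h : Contiguous u κ κ') (ha : a < κ)
    (hb : b ≤ κ') (hc : Cover u a b) : b ≤ κ := by
  by_contra hn
  have h1 := h (b - 1) (by omega) (by omega)
  rw [Nat.sub_add_cancel (by omega)] at h1
  have h2 := hc.2.2 (b - 1) (by omega) (by omega)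
  have h3 : u a ≠ u (b - 1) := fun e => by
    have := u.injective e
    omega
  have := hc.2.1
  omega

lemma contiguous_of_big {r : ℕ} {u : Perm ℕ} {κ κ' : ℕ} (h : BigIncreasing r u) (hκ : r < κ)
    (hbig : ∀ k, u κ ≤ k → k ≤ u κ' → r < u⁻¹ k) : Contiguous u κ κ' := by
  intro s h1 h2
  have h3 := h.le hκ h1
  have h4 := h s (s + 1) (by omega) (by omega)
  have h5 := h.le (show r < s + 1 by omega) (show s + 1 ≤ κ' from h2)
  have h6 := hbig (u s + 1) (by omega) (by omega)
  have h7 := perm_apply_inv u (u s + 1)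
  have h8 : s < u⁻¹ (u s + 1) := by
    refine h.lt_of_lt h6 ?_
    omega
  have h9 := h.le (show r < s + 1 by omega) (show s + 1 ≤ u⁻¹ (u s + 1) from h8)
  omega

/-- The big strands of the chain `L`, placed into the boxes of a diagram, do not increase from
the bottom to the top of a column. -/
def LabelsDecrease (r : ℕ) (m : ℕ → ℕ) (L : List (ℕ × ℕ)) : Prop :=
  ∀ t j a b c d, t + 1 < r → j < m t → L[rowOffset m t + j]? = some (a, b) →
    L[rowOffset m (t + 1) + j]? = some (c, d) → d ≤ b

/-- The relation of box `j` of row `t` to the lower chain `K`: its big strand `κ` is at most the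
one of the same box of `K`, and the strands between them are contiguous. If `K` has no such box,
then all strands from `κ` on are contiguous. -/
def BoxContiguous (K : List (ℕ × ℕ)) (m m' : ℕ → ℕ) (u : Perm ℕ) (L : List (ℕ × ℕ))
    (t j : ℕ) : Prop :=
  ∀ a κ, L[rowOffset m t + j]? = some (a, κ) →
    (j < m' t → ∀ c κ', K[rowOffset m' t + j]? = some (c, κ') → κ ≤ κ' ∧ Contiguous u κ κ') ∧
    (m' t ≤ j → ∀ κ', Contiguous u κ κ')

section
variable {r l N : ℕ} {w w' : Perm ℕ} {K : List (ℕ × ℕ)} {S : ℕ → Graph} {m m' : ℕ → ℕ}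
  {D : YoungDiagram} {St : ℕ → Graph → List (ℕ × ℕ) → Prop}

/-- A state for a semi-shuffle: the relation of the boxes to those of the lower chain, for the boxes
of the current row which are filled, and for those of the row below which are not yet covered. -/
structure SemiState (r l : ℕ) (w w' : Perm ℕ) (K : List (ℕ × ℕ)) (S : ℕ → Graph) (m m' : ℕ → ℕ)
    (St : ℕ → Graph → List (ℕ × ℕ) → Prop) (N : ℕ) (t j : ℕ) (C : Finset ℕ)
    (L : List (ℕ × ℕ)) : Prop where
  loop : LoopState r l w w' K S m m' St N t j C L
  labels : LabelsDecrease r m L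
  cur : ∀ i < j, BoxContiguous K m m' (perm (S (lowerIndex m' t j))) L t i
  prev : ∀ s, t = s + 1 → ∀ i, j ≤ i → i < m s →
    BoxContiguous K m m' (perm (S (lowerIndex m' t j))) L s i

lemma BoxContiguous.append {u : Perm ℕ} {L M : List (ℕ × ℕ)} {t j : ℕ}
    (h : BoxContiguous K m m' u L t j) (hlt : rowOffset m t + j < L.length) :
    BoxContiguous K m m' u (L ++ M) t j := by
  intro a κ hκ
  rw [List.getElem?_append_left hlt] at hκ
  exact h a κ hκ

namespace SemiState

/-- The moved big strand is at most the one of the box below. -/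
lemma lower_le (X : RowSetting r l w w' K S m m' D St) (hK : LabelsDecrease r m' K) {t s j : ℕ}
    {C : Finset ℕ} {L : List (ℕ × ℕ)} (Z : SemiState r l w w' K S m m' St N t j C L)
    (hts : t = s + 1) (ht : t < r) (hj : j < m' t) (hjs : j < m s) {a b c κ : ℕ}
    (hab : K[rowOffset m' t + j]? = some (a, b)) (hκ : L[rowOffset m s + j]? = some (c, κ)) :
    b ≤ κ := by
  obtain ⟨a', b', hab', hlen, h1, -, -, har, -, hc, -⟩ := X.next ht hj
  obtain ⟨rfl, rfl⟩ := Prod.mk.inj (Option.some.inj (hab.symm.trans hab'))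
  have hrκ := (Z.loop.state.chain.at hκ).2.2.1
  obtain ⟨h2, h3⟩ := Z.prev s hts j le_rfl hjs c κ hκ
  rw [h1] at h2 h3
  rcases lt_or_ge j (m' s) with hj' | hj'
  · have hlt : rowOffset m' s + j < K.length := by
      have := rowOffset_mono m' (show s ≤ t by omega)
      omega
    obtain ⟨⟨e, κ'⟩, he⟩ : ∃ p, K[rowOffset m' s + j]? = some p := ⟨_, List.getElem?_eq_getElem hlt⟩
    obtain ⟨-, h5⟩ := h2 hj' e κ' he
    rw [hts] at hab
    exact h5.le_of_cover (by omega) (hK s j e κ' a b (by omega) hj' he hab) hc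
  · exact (h3 hj' b).le_of_cover (by omega) le_rfl hc

/-- In row `s` the big strands increase. -/
lemma label_lt (hw : BigIncreasing r w) {t j : ℕ}
    {C : Finset ℕ} {L : List (ℕ × ℕ)} (Z : SemiState r l w w' K S m m' St N t j C L) {s i i' : ℕ}
    (hs : s < r) (hii : i < i') (hi' : i' < m s) {a b c d : ℕ}
    (h1 : L[rowOffset m s + i]? = some (a, b)) (h2 : L[rowOffset m s + i']? = some (c, d)) :
    b < d := by
  have hlen := (List.getElem?_eq_some_iff.1 h2).1
  induction i', hii using Nat.le_induction generalizing c d with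
  | base =>
    have e1 : (chainEntries w L)[rowOffset m s + i]? = some _ := getElem?_chainEntries h1
    have e2 : (chainEntries w L)[rowOffset m s + (i + 1)]? = some _ := getElem?_chainEntries h2
    exact Z.loop.state.chain.label_lt hw h1 h2 e1 e2 (Z.loop.strict.row s i _ _ hs hi' e1 e2)
  | succ k hk ih =>
    obtain ⟨⟨e, f⟩, h3⟩ : ∃ p, L[rowOffset m s + k]? = some p :=
      ⟨_, List.getElem?_eq_getElem (by omega)⟩
    have e1 : (chainEntries w L)[rowOffset m s + k]? = some _ := getElem?_chainEntries h3
    have e2 : (chainEntries w L)[rowOffset m s + (k + 1)]? = some _ := getElem?_chainEntries h2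
    exact (ih (by omega) h3 (by omega)).trans
      (Z.loop.state.chain.label_lt hw h3 h2 e1 e2 (Z.loop.strict.row s k _ _ hs hi' e1 e2))

/-- A big strand of the lower chain is larger than those to its left. -/
lemma lower_label_lt (X : RowSetting r l w w' K S m m' D St) (hw' : BigIncreasing r w') {s i i' : ℕ}
    (hs : s < r) (hii : i < i') (hi' : i' < m' s) {a b c d : ℕ}
    (h1 : K[rowOffset m' s + i]? = some (a, b)) (h2 : K[rowOffset m' s + i']? = some (c, d)) :
    b < d := by
  have hlen := (List.getElem?_eq_some_iff.1 h2).1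
  induction i', hii using Nat.le_induction generalizing c d with
  | base =>
    have e1 : (chainEntries w' K)[rowOffset m' s + i]? = some _ := getElem?_chainEntries h1
    have e2 : (chainEntries w' K)[rowOffset m' s + (i + 1)]? = some _ := getElem?_chainEntries h2
    exact X.chain.label_lt hw' h1 h2 e1 e2 (X.strict.row s i _ _ hs hi' e1 e2)
  | succ k hk ih =>
    obtain ⟨⟨e, f⟩, h3⟩ : ∃ p, K[rowOffset m' s + k]? = some p :=
      ⟨_, List.getElem?_eq_getElem (by omega)⟩
    have e1 : (chainEntries w' K)[rowOffset m' s + k]? = some _ := getElem?_chainEntries h3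
    have e2 : (chainEntries w' K)[rowOffset m' s + (k + 1)]? = some _ := getElem?_chainEntries h2
    exact (ih (by omega) h3 (by omega)).trans
      (X.chain.label_lt hw' h3 h2 e1 e2 (X.strict.row s k _ _ hs hi' e1 e2))

/-- A rectified box completes the next state. -/
lemma rectified (X : RowSetting r l w w' K S m m' D St) (hK : LabelsDecrease r m' K)
    (hw : BigIncreasing r w) (hw' : BigIncreasing r w') {t j : ℕ} {C : Finset ℕ}
    {L : List (ℕ × ℕ)} (Z : SemiState r l w w' K S m m' St N t j C L) (ht : t < r) (hj : j < m' t)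
    {a b : ℕ} (hab : K[rowOffset m' t + j]? = some (a, b)) {C' : Finset ℕ} {α β v : ℕ}
    (P : RowState r l w (perm (S (rowOffset m' t + j + 1))) C' (L ++ [(α, β)]))
    (hent : chainEntries w (L ++ [(α, β)]) = chainEntries w L ++ [v])
    (hle : perm (S (rowOffset m' t + j + 1)) β ≤ perm (S (rowOffset m' t + j)) a)
    (hbig : ∀ k, perm (S (rowOffset m' t + j + 1)) β ≤ k →
      k ≤ perm (S (rowOffset m' t + j)) a → r < (perm (S (rowOffset m' t + j + 1)))⁻¹ k)
    (hnext : (∀ s x, t = s + 1 → j < m s → (chainEntries w L)[rowOffset m s + j]? = some x →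
      v < x) → LoopState r l w w' K S m m' St N t (j + 1) C' (L ++ [(α, β)])) :
    SemiState r l w w' K S m m' St N t (j + 1) C' (L ++ [(α, β)]) := by
  have hlow := fun s c κ hts hjs hκ =>
    Z.lower_le X hK (s := s) (c := c) (κ := κ) hts ht hj hjs hab hκ
  obtain ⟨a', b', hab', hlen, h1, h2, ha, har, hb, hc, hswap, hE⟩ := X.next ht hj
  obtain ⟨rfl, rfl⟩ := Prod.mk.inj (Option.some.inj (hab.symm.trans hab'))
  have hL := Z.loop.length_eq
  obtain ⟨-, hα, hβ, hcov⟩ := P.chain.last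
  have hinc' : BigIncreasing r (perm (S (rowOffset m' t + j + 1))) := by
    rw [(X.rc _ hlen).2]
    exact (X.chain.take _).bigIncreasing hw'
  have hub : perm (S (rowOffset m' t + j + 1)) b = perm (S (rowOffset m' t + j)) a := by
    rw [hswap, mul_swap_apply_right]
  have hβb : β ≤ b := by
    by_contra hn
    have := hinc' b β hb (by omega)
    omega
  have hcontig : Contiguous (perm (S (rowOffset m' t + j + 1))) β b :=
    contiguous_of_big hinc' hβ fun k hk1 hk2 => hbig k hk1 (hub ▸ hk2)
  refine ⟨hnext ?_, ?_, ?_, ?_⟩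
  · -- The box below was filled with a strand `κ ≥ β`, whose value has not increased since then.
    intro s x hts hjs hx
    have hlt : rowOffset m s + j < L.length := by
      have := (List.getElem?_eq_some_iff.1 hx).1
      rwa [length_chainEntries] at this
    obtain ⟨⟨c, κ⟩, hκ⟩ : ∃ p, L[rowOffset m s + j]? = some p := ⟨_, List.getElem?_eq_getElem hlt⟩
    have h3 := hlow s c κ hts hjs hκ
    have h4 := Z.loop.state.chain.apply_le_entry hκ hx
    have h5 := (Z.loop.state.chain.bigIncreasing hw).le hβ (show β ≤ κ by omega)
    have h6 := hcov.2.1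
    have h7 : v = (w * chainProd L) α := by
      rw [chainEntries_concat] at hent
      exact (List.singleton_injective (List.append_cancel_left hent)).symm
    omega
  · intro s i c d e f hs hi hx hy
    rcases getElem?_concat hy with hy' | ⟨hy', hp⟩
    · rw [List.getElem?_append_left (by
        have := (List.getElem?_eq_some_iff.1 hy').1
        have := rowOffset_mono m (show s ≤ s + 1 by omega)
        omega)] at hx
      exact Z.labels s i c d e f hs hi hx hy'
    · obtain ⟨rfl, rfl⟩ := Prod.mk.inj hp
      obtain ⟨rfl, rfl⟩ := rowOffset_add_inj
        (hi.trans_le (X.rows.mono (show s ≤ s + 1 by omega) hs)) (hj.trans_le (X.le_rows t ht))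
        (hy'.trans hL)
      rw [List.getElem?_append_left (by
        have := rowOffset_succ m s
        omega)] at hx
      have := hlow s c d rfl hi hx
      omega
  · intro i hi
    rw [h2]
    rcases Nat.lt_succ_iff_lt_or_eq.1 hi with hij | rfl
    · refine BoxContiguous.append ?_ (by omega)
      intro c κ hκ
      obtain ⟨h3, -⟩ := Z.cur i hij c κ hκ
      have hrκ := (Z.loop.state.chain.at hκ).2.2.1
      refine ⟨fun hi' e κ' he => ?_, fun hi' => by omega⟩
      obtain ⟨h4, h5⟩ := h3 hi' e κ' he
      have h6 := lower_label_lt X hw' ht hij hj he hab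
      rw [h1] at h5
      rw [hswap]
      exact ⟨h4, h5.mul_swap (by omega) (Or.inr h6)⟩
    · intro c κ hκ
      rw [← hL, List.getElem?_concat_length] at hκ
      obtain ⟨rfl, rfl⟩ := Prod.mk.inj (Option.some.inj hκ)
      refine ⟨fun _ e κ' he => ?_, fun hi' => by omega⟩
      obtain ⟨rfl, rfl⟩ := Prod.mk.inj (Option.some.inj (hab.symm.trans he))
      exact ⟨hβb, hcontig⟩
  · intro s hts i hi his
    rw [h2]
    have hlt : rowOffset m s + i < L.length := by
      have := rowOffset_succ m s
      rw [hL, hts]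
      omega
    refine BoxContiguous.append ?_ hlt
    intro c κ hκ
    obtain ⟨h3, h4⟩ := Z.prev s hts i (by omega) his c κ hκ
    have hrκ := (Z.loop.state.chain.at hκ).2.2.1
    obtain ⟨⟨c', κ₀⟩, hκ₀⟩ : ∃ p, L[rowOffset m s + j]? = some p :=
      ⟨_, List.getElem?_eq_getElem (by omega)⟩
    have h5 := hlow s c' κ₀ hts (by omega) hκ₀
    have h6 := Z.label_lt hw (by omega) (show j < i by omega) his hκ₀ hκ
    rw [h1] at h3 h4
    rw [hswap]
    refine ⟨fun hi' e κ' he => ?_, fun hi' κ' => ?_⟩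
    · obtain ⟨h7, h8⟩ := h3 hi' e κ' he
      exact ⟨h7, h8.mul_swap (by omega) (Or.inl (by omega))⟩
    · exact (h4 hi' κ').mul_swap (by omega) (Or.inl (by omega))

lemma step (X : RowSetting r l w w' K S m m' D St) (hK : LabelsDecrease r m' K)
    (hw : BigIncreasing r w) (hw' : BigIncreasing r w') {t j : ℕ} {C : Finset ℕ}
    {L : List (ℕ × ℕ)} (Z : SemiState r l w w' K S m m' St N t j C L) (ht : t < r) (hj : j < m t) :
    ∃ C' L', SemiState r l w w' K S m m' St N t (j + 1) C' L' := by
  have hL := Z.loop.length_eq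
  rcases le_or_gt (m' t) j with hj' | hj'
  · obtain ⟨hidx, p, hal, hbig, Z'⟩ := Z.loop.inserted X ht hj' hj
    have hn := X.lowerIndex_le (j := j) ht
    have hinc : BigIncreasing r (perm (S (lowerIndex m' t j))) := by
      rw [(X.rc _ hn).2]
      exact (X.chain.take _).bigIncreasing hw'
    have hnot : ∀ s, t = s + 1 → ¬ j < m s := fun s hs h => by
      have := X.interlace s (by omega)
      subst hs
      omega
    refine ⟨_, _, Z', ?_, ?_, ?_⟩
    · intro s i c d e f hs hi hx hy
      rcases getElem?_concat hy with hy' | ⟨hy', hp⟩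
      · rw [List.getElem?_append_left (by
          have := (List.getElem?_eq_some_iff.1 hy').1
          have := rowOffset_mono m (show s ≤ s + 1 by omega)
          omega)] at hx
        exact Z.labels s i c d e f hs hi hx hy'
      · obtain ⟨rfl, rfl⟩ := rowOffset_add_inj
          (hi.trans_le (X.rows.mono (show s ≤ s + 1 by omega) hs)) hj (hy'.trans hL)
        exact absurd hi (hnot s rfl)
    · intro i hi
      rw [hidx]
      rcases Nat.lt_succ_iff_lt_or_eq.1 hi with hij | rfl
      · exact BoxContiguous.append (Z.cur i hij) (by omega)
      · intro c κ hκ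
        rw [← hL, List.getElem?_concat_length] at hκ
        obtain ⟨rfl, rfl⟩ := Prod.mk.inj (Option.some.inj hκ)
        refine ⟨fun hi' => by omega, fun _ κ' => contiguous_of_big hinc hal.2.2 fun k hk _ => ?_⟩
        rw [perm_apply_inv] at hk
        exact hbig k (by omega)
    · intro s hs i hi his
      exact absurd (show j < m s by omega) (hnot s hs)
  obtain ⟨a, b, hab, hlen, h1, h2, ha, har, hb, hc, hswap, hE⟩ := X.next ht hj'
  rcases Nat.eq_zero_or_pos j with rfl | hj1
  · have hinc' : BigIncreasing r (perm (S (rowOffset m' t + 0 + 1))) := by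
      rw [(X.rc _ hlen).2]
      exact (X.chain.take _).bigIncreasing hw'
    -- The last strand of the row below is at least its first one, hence at least `b`.
    have hlast : ∀ L₀ α β, L = L₀ ++ [(α, β)] →
        perm (S (rowOffset m' t + 0)) a ≤ perm (S (rowOffset m' t + 0 + 1)) β := by
      rintro L₀ α β rfl
      have hub : perm (S (rowOffset m' t + 0 + 1)) b = perm (S (rowOffset m' t + 0)) a := by
        rw [hswap, mul_swap_apply_right]
      rw [← hub]
      refine hinc'.le hb ?_
      simp only [List.length_append, List.length_singleton] at hL
      obtain ⟨s, rfl⟩ : ∃ s, t = s + 1 := by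
        rcases Nat.eq_zero_or_pos t with rfl | h
        · rw [rowOffset_zero] at hL
          omega
        · exact ⟨t - 1, by omega⟩
      have hoff := rowOffset_succ m s
      have hms : 0 < m s := by
        by_contra h0
        have h3 : rowOffset m (s + 1) = 0 :=
          Finset.sum_eq_zero fun i hi => by
            have := X.rows.mono (s := i) (t := s) (by have := Finset.mem_range.1 hi; omega)
              (by omega)
            omega
        omega
      have hlastidx : (L₀ ++ [(α, β)])[rowOffset m s + (m s - 1)]? = some (α, β) := by
        rw [show rowOffset m s + (m s - 1) = L₀.length by omega, List.getElem?_concat_length]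
      obtain ⟨⟨c, κ⟩, hκ⟩ : ∃ p, (L₀ ++ [(α, β)])[rowOffset m s + 0]? = some p :=
        ⟨_, List.getElem?_eq_getElem (by simp; omega)⟩
      have h3 := Z.lower_le X hK rfl ht hj' hms hab hκ
      rcases Nat.eq_zero_or_pos (m s - 1) with h0 | h0
      · rw [h0, hκ] at hlastidx
        obtain ⟨rfl, rfl⟩ := Prod.mk.inj (Option.some.inj hlastidx)
        exact h3
      · exact h3.trans (Z.label_lt hw (by omega) h0 (by omega) hκ hlastidx).le
    obtain ⟨C', α, β, v, P, hent, hle, hbig, -, hZ⟩ := Z.loop.first_box X ht hj' hab rfl rfl hlast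
    exact ⟨C', _, Z.rectified X hK hw hw' ht hj' hab P hent hle hbig hZ⟩
  · obtain ⟨C', L₁, α, β, v, P, hent, hlab, hZ⟩ := Z.loop.row_box X ht hj1 hj' hab rfl rfl
    rcases hlab with ⟨rfl, hle, hbig⟩ | ⟨d, hd1, hd2, hd3⟩
    · exact ⟨C', _, Z.rectified X hK hw hw' ht hj' hab P hent hle hbig hZ⟩
    · have := P.chain.bigIncreasing hw β d hd2 hd1
      omega

lemma next_row (X : RowSetting r l w w' K S m m' D St) {t : ℕ} {C : Finset ℕ}
    {L : List (ℕ × ℕ)} (Z : SemiState r l w w' K S m m' St N t (m t) C L) (ht : t < r) :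
    SemiState r l w w' K S m m' St N (t + 1) 0 C L := by
  obtain ⟨hidx, Z'⟩ := Z.loop.next_row X ht
  refine ⟨Z', Z.labels, fun i hi => by omega, fun s hs i _ hi => ?_⟩
  obtain rfl : t = s := by omega
  rw [hidx]
  exact Z.cur i hi

lemma exists_end (X : RowSetting r l w w' K S m m' D St) (hK : LabelsDecrease r m' K)
    (hw : BigIncreasing r w) (hw' : BigIncreasing r w') {C : Finset ℕ}
    (Z : LoopState r l w w' K S m m' St N 0 0 C []) :
    ∃ C' L', LoopState r l w w' K S m m' St N r 0 C' L' ∧ LabelsDecrease r m L' := by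
  obtain ⟨⟨C', L'⟩, h⟩ := exists_loop (r := r) (m := m)
    (P := fun t j (x : Finset ℕ × List (ℕ × ℕ)) => SemiState r l w w' K S m m' St N t j x.1 x.2)
    ⟨(C, []), Z, fun t j a b c d _ _ h => by simp at h, fun i hi => by omega,
      fun s hs => by omega⟩
    (fun t j x ht hj hx => by
      obtain ⟨C', L', h⟩ := hx.step X hK hw hw' ht hj
      exact ⟨(C', L'), h⟩)
    (fun t x ht hx => ⟨x, hx.next_row X ht⟩)
  exact ⟨C', L', h.loop, h.labels⟩

end SemiState
end

/-! ### The rows of the algorithm -/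

/-- The result of the rows `r, …, l` of the algorithm: the graph `U` and the chain `L` in the
diagram `D`. The value `l = r + 1`, where nothing has been done, is included. -/
structure RowResult (r : ℕ) (R Y : Graph) (l : ℕ) (U : Graph) (D : YoungDiagram)
    (L : List (ℕ × ℕ)) : Prop where
  shape : IsShuffleOf (perm (rowsFrom Y l)) D r
  rc : IsRcGraph U
  perm_eq : perm U = perm (rowsFrom R l) * chainProd L
  chain : CoverChain r (perm (rowsFrom R l)) L
  length_eq : L.length = rowOffset (excess (perm (rowsFrom Y l))) r
  strict : StrictFilling r (excess (perm (rowsFrom Y l))) (chainEntries (perm (rowsFrom R l)) L)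
  below : ∀ p ∈ U, l ≤ p.1
  rows : ∀ k, (row U k).card = (row (rowsFrom R l) k).card + (row (rowsFrom Y l) k).card
  step : l ≤ r → Step r R Y l (rowsFrom Y l).card U ⟨D, L⟩
  unique : l ≤ r → ∀ U' V', Step r R Y l (rowsFrom Y l).card U' V' → U' = U ∧ V' = ⟨D, L⟩
  top : l = r + 1 → U = rowsFrom R l
  labels : IsSemiShuffle (perm R) r → LabelsDecrease r (excess (perm (rowsFrom Y l))) L

section
variable {r : ℕ} {R Y : Graph}

lemma excess_one : excess 1 = fun _ => 0 := by
  funext t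
  simp [excess]

lemma exists_rowResult_top (hR : IsRcGraph R) (hY : IsRcGraph Y) (hv : IsShuffle (perm Y) r) :
    ∃ U D L, RowResult r R Y (r + 1) U D L := by
  obtain ⟨D, hD⟩ := (hY.shuffle_rowsFrom hv (l := r + 1) (by omega)).exists_shape
    (hY.isFinitary_rowsFrom _).apply_zero
  refine ⟨rowsFrom R (r + 1), D, [], hD, (hR.lower (by omega)).1, by simp [chainProd],
    coverChain_nil _ _, ?_, StrictFilling.nil _ _, fun p hp => (Finset.mem_filter.1 hp).2, ?_,
    fun h => by omega, fun h => by omega, fun _ => rfl, fun _ t j a b c d _ _ h => by simp at h⟩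
  · rw [hY.rowsFrom_eq_empty hv, perm_empty, excess_one]
    simp [rowOffset]
  · intro k
    rw [hY.rowsFrom_eq_empty hv]
    simp [row]

lemma IsSemiShuffle.bigIncreasing {w : Perm ℕ} (h : IsSemiShuffle w r) : BigIncreasing r w :=
  fun _ _ hi hik => h.lt hi hik

lemma excess_le_part {lam : YoungDiagram} (hY : IsRcGraph Y)
    (hlam : IsShuffleOf (perm Y) lam r) {l : ℕ} (hl : 1 ≤ l) {t : ℕ} (ht : t < r) :
    excess (perm (rowsFrom Y l)) t ≤ part lam (r - t) := by
  induction l, hl using Nat.le_induction with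
  | base =>
    rw [rowsFrom_one (isRcGraph_iff.1 hY).1, ← hlam.hasRows.2 t ht, part,
      show r - t - 1 = r - 1 - t by omega]
  | succ l hl ih => exact (hY.excess_le hlam.1 hl ht).trans ih

/-- One row of the algorithm. -/
theorem RowResult.next {lam : YoungDiagram} (hR : IsRcGraph R) (hY : IsRcGraph Y)
    (hlam : IsShuffleOf (perm Y) lam r) (hcase : IsSemiShuffle (perm R) r ∨ IsHook lam) {l : ℕ}
    (hl : 1 ≤ l) (hlr : l ≤ r) {U : Graph} {D' : YoungDiagram} {K : List (ℕ × ℕ)}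
    (h : RowResult r R Y (l + 1) U D' K) : ∃ U' D L, RowResult r R Y l U' D L := by
  have hv := hlam.1
  have hPR := (isRcGraph_iff.1 hR).1
  have hPY := (isRcGraph_iff.1 hY).1
  have hfin := hR.isFinitary_rowsFrom (l + 1)
  obtain ⟨D, hD⟩ := (hY.shuffle_rowsFrom hv hl).exists_shape (hY.isFinitary_rowsFrom l).apply_zero
  obtain ⟨S, hSU, hSe, hSrc⟩ := exists_backtrack hfin K U h.rc h.perm_eq h.chain
  have hback : IsBacktrack (perm (rowsFrom R (l + 1))) U ⟨D', K⟩ S :=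
    ⟨hSU, fun j hj => ⟨hSe j hj, (hSrc j hj.le).2⟩⟩
  set m := excess (perm (rowsFrom Y l)) with hm
  set m' := excess (perm (rowsFrom Y (l + 1))) with hm'
  have hprev : ∀ t, 0 < m' t → l + 1 ≤ r := by
    intro t ht
    by_contra hn
    obtain rfl : l = r := by omega
    rw [hm', hY.rowsFrom_eq_empty hv, perm_empty, excess_one] at ht
    exact absurd ht (lt_irrefl 0)
  have X : RowSetting r l (perm (rowsFrom R l)) (perm (rowsFrom R (l + 1))) K S m m' D
      (fun i Q L => Step r R Y l i Q ⟨D, L⟩) :=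
    { one_le := hl
      le := hlr
      finW := hR.isFinitary_rowsFrom l
      chain := h.chain
      rc := hSrc
      below := fun n hn p hp => h.below p (hback.subset hn hp)
      subset := fun n hn => by
        obtain ⟨p, -, hp⟩ := hSe n hn
        rw [hp]
        exact Finset.erase_subset _ _
      length_eq := h.length_eq
      strict := h.strict
      rows := hD.hasRows
      le_rows := fun t ht => hY.excess_le hv hl ht
      interlace := fun t ht => hY.excess_interlace hv hl ht
      insertion := fun t j Q L Q' L' ht hj hjm hs hI => .insertion hs
        ((hY.insWord_rowsFrom hv hl hlr hm hm' ht hjm).2 hj) hI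
      rectification := fun t j Q L Q' L' ab ht hj hs hab hI => by
        obtain ⟨k, hk, hk1, hk2⟩ := (hY.insWord_rowsFrom hv hl hlr hm hm' ht
          (hj.trans_le (hY.excess_le hv hl ht))).1 hj
        exact .rectification (h.step (hprev t (by omega))) hback hs hk1 hk hk2.symm hab hI }
  have hidx0 : lowerIndex m' 0 0 = 0 := by simp [lowerIndex, rowOffset_zero]
  have hZ : LoopState r l (perm (rowsFrom R l)) (perm (rowsFrom R (l + 1))) K S m m'
      (fun i Q L => Step r R Y l i Q ⟨D, L⟩) (rowLabels R l).card 0 0 (rowLabels R l) [] := by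
    have hS0 := (hSrc 0 (Nat.zero_le _)).2
    rw [List.take_zero, chainProd, List.map_nil, List.prod_nil, mul_one] at hS0
    constructor
    · rw [hidx0, rowOffset_zero, ← row_eq_rowGraph hPR hl]
      rcases hlr.eq_or_lt with rfl | hlt
      · have hK : K.length = 0 := by
          rw [h.length_eq, ← hm']
          refine Finset.sum_eq_zero fun t _ => ?_
          by_contra hn
          have := hprev t (by omega)
          omega
        have hU := h.top rfl
        rw [← hSU, hK] at hU
        rw [hU, Finset.union_comm, ← rowsFrom_eq_union]
        exact .start hD
      · exact .rowToRow hl (h.step hlt) hback hD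
    · rw [hidx0, hS0]
      exact
        { one_le := hl
          le := hlr
          fix := fun k hk => hPR.rowsFrom_fix (by omega)
          labels := fun p hp => rowLabels_ge hPR hp
          fin := hfin
          finW := hR.isFinitary_rowsFrom l
          good := (hR.lower hl).2
          chain := coverChain_nil _ _
          eq := by
            rw [chainProd, List.map_nil, List.prod_nil, mul_one]
            exact perm_rowsFrom hl }
    · rw [hidx0, rowOffset_zero]
    · rfl
    · exact StrictFilling.nil _ _
    · intro h; omega
  obtain ⟨C, L, Z, hlab⟩ : ∃ C L,
      LoopState r l (perm (rowsFrom R l)) (perm (rowsFrom R (l + 1))) K S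
      m m' (fun i Q L => Step r R Y l i Q ⟨D, L⟩) (rowLabels R l).card r 0 C L ∧
      (IsSemiShuffle (perm R) r → LabelsDecrease r m L) := by
    by_cases hs : IsSemiShuffle (perm R) r
    · obtain ⟨C, L, Z, hL⟩ := SemiState.exists_end X (h.labels hs)
        (hR.semiShuffle_rowsFrom hs hl).bigIncreasing
        (hR.semiShuffle_rowsFrom hs (l := l + 1) (by omega)).bigIncreasing hZ
      exact ⟨C, L, Z, fun _ => hL⟩
    · have hhook := hcase.resolve_left hs
      obtain ⟨C, L, Z⟩ := HookState.exists_end X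
        (fun t ht => (excess_le_part hY hlam hl (by omega)).trans (hhook (r - t) (by omega))) hZ
      exact ⟨C, L, Z, fun h => absurd h hs⟩
  have hidx : lowerIndex m' r 0 = K.length := by
    rw [lowerIndex, Nat.zero_min, add_zero, h.length_eq]
  have hlen := Z.length_eq
  have hcard := Z.card
  have hP := Z.state
  have hstep := Z.step
  rw [hidx, hSU] at hP hstep
  rw [hidx, h.length_eq, add_zero, ← hm'] at hcard
  rw [add_zero] at hlen hstep
  have hlay : IsLayered l U C :=
    ⟨hl, fun p hp => ⟨h.below p hp, ((isRcGraph_iff.1 h.rc).1 p hp).2⟩, hP.labels⟩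
  have hcY := hY.card_rowsFrom hv hl (by omega)
  have hcY' := hY.card_rowsFrom hv (l := l + 1) (by omega) (by omega)
  have hcR := card_rowsFrom_eq hPY l
  rw [← hm] at hcY
  rw [← hm'] at hcY'
  rw [← hcY] at hstep
  refine ⟨U ∪ rowGraph l C, D, L, hD, hlay.isRcGraph h.rc hP.good, by rw [hlay.perm_eq, hP.eq],
    hP.chain, hlen, Z.strict, ?_, ?_, fun _ => hstep, ?_, fun h => by omega, hlab⟩
  · rintro ⟨i, j⟩ hp
    rcases Finset.mem_union.1 hp with hp | hp
    · exact (hlay.below _ hp).1.le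
    · exact ((mem_rowGraph hP.labels).1 hp).1.ge
  · intro k
    have hlow : ∀ G : Graph, l < k → row (rowsFrom G l) k = row (rowsFrom G (l + 1)) k := by
      intro G hk
      ext p
      simp only [row, rowsFrom, Finset.mem_filter]
      constructor
      · rintro ⟨⟨h1, h2⟩, h3⟩; exact ⟨⟨h1, by omega⟩, h3⟩
      · rintro ⟨⟨h1, h2⟩, h3⟩; exact ⟨⟨h1, by omega⟩, h3⟩
    have heq : ∀ G : Graph, row (rowsFrom G l) l = row G l := by
      intro G
      ext p
      simp only [row, rowsFrom, Finset.mem_filter]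
      constructor
      · rintro ⟨⟨h1, h2⟩, h3⟩; exact ⟨h1, h3⟩
      · rintro ⟨h1, h3⟩; exact ⟨⟨h1, by omega⟩, h3⟩
    rcases lt_trichotomy k l with hk | rfl | hk
    · have hemp : ∀ G : Graph, (∀ p ∈ G, l ≤ p.1) → row G k = ∅ := by
        intro G hG
        refine Finset.filter_eq_empty_iff.2 fun p hp => ?_
        have := hG p hp
        omega
      rw [hemp (rowsFrom R l) fun p hp => (Finset.mem_filter.1 hp).2,
        hemp (rowsFrom Y l) fun p hp => (Finset.mem_filter.1 hp).2, hemp]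
      · rfl
      · rintro ⟨i, j⟩ hp
        rcases Finset.mem_union.1 hp with hp | hp
        · exact (hlay.below _ hp).1.le
        · exact ((mem_rowGraph hP.labels).1 hp).1.ge
    · rw [hlay.row_eq, card_rowGraph hP.labels, heq, heq, ← card_rowLabels hPR,
        ← card_rowLabels hPY]
      omega
    · rw [hlow R hk, hlow Y hk, ← h.rows k]
      congr 1
      ext ⟨i, j⟩
      simp only [row, Finset.mem_filter, Finset.mem_union, mem_rowGraph hP.labels]
      constructor
      · rintro ⟨h1 | ⟨h1, -⟩, h2⟩
        · exact ⟨h1, h2⟩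
        · omega
      · rintro ⟨h1, h2⟩; exact ⟨Or.inl h1, h2⟩
  · intro _ U' V' hs
    obtain ⟨h1, h2⟩ := hs.unique hPR (fun hlt => ⟨U, ⟨D', K⟩, S, h.unique hlt, hback,
      fun j hj => (hSrc j hj).1⟩) hstep
    exact ⟨h1, h2⟩

lemma monomialOf_eq {U : Graph} {s : Finset ℕ} (hs : U.image Prod.fst ⊆ s) :
    monomialOf U = ∏ i ∈ s, MvPolynomial.X i ^ (row U i).card := by
  refine Finset.prod_subset hs fun i _ hi => ?_
  rw [show row U i = ∅ from Finset.filter_eq_empty_iff.2 fun p hp hpi =>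
    hi (hpi ▸ Finset.mem_image_of_mem _ hp), Finset.card_empty, pow_zero]

lemma monomialOf_mul {U : Graph} (h : ∀ k, (row U k).card = (row R k).card + (row Y k).card) :
    monomialOf U = monomialOf R * monomialOf Y := by
  set s := U.image Prod.fst ∪ R.image Prod.fst ∪ Y.image Prod.fst
  rw [monomialOf_eq (s := s) (by intro x hx; simp only [s, Finset.mem_union]; tauto),
    monomialOf_eq (U := R) (s := s) (by intro x hx; simp only [s, Finset.mem_union]; tauto),
    monomialOf_eq (U := Y) (s := s) (by intro x hx; simp only [s, Finset.mem_union]; tauto),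
    ← Finset.prod_mul_distrib]
  refine Finset.prod_congr rfl fun i _ => ?_
  rw [h, pow_add]
end

end RcInsertion

theorem theorem2p2 (r : ℕ) (hr : 1 ≤ r) (w v : Equiv.Perm ℕ) (lam : YoungDiagram)
    (hv : IsShuffleOf v lam r) (hcase : IsSemiShuffle w r ∨ IsHook lam)
    (R Y : Graph) (hR : R ∈ RC w) (hY : Y ∈ RC v) :
    ∃ (U : Graph) (T : Tableau (ℕ × ℕ)),
      (∀ (U' : Graph) (T' : Tableau (ℕ × ℕ)), Inserts r R Y U' T' ↔ U' = U ∧ T' = T) ∧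
      IsRcGraph U ∧
      IsTranspositionTableau r lam lam.card T ∧
      RowStrict (E w T) ∧ ColumnStrict (E w T) ∧
      IsBruhatPackage r w U T ∧
      monomialOf U = monomialOf R * monomialOf Y := by
  obtain ⟨hR, rfl⟩ := hR
  obtain ⟨hY, rfl⟩ := hY
  have hPR := (isRcGraph_iff.1 hR).1
  have hPY := (isRcGraph_iff.1 hY).1
  have key : ∀ l, 1 ≤ l → l ≤ r + 1 → ∃ U D L, RowResult r R Y l U D L := by
    intro l hl hlr
    induction hlr using Nat.decreasingInduction with
    | self => exact exists_rowResult_top hR hY hv.1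
    | of_succ l hlr ih =>
      obtain ⟨U, D, K, h⟩ := ih (by omega)
      exact h.next hR hY hv hcase hl (by omega)
  obtain ⟨U, D, L, h⟩ := key 1 le_rfl (by omega)
  have hstep := h.step hr
  have huniq := h.unique hr
  obtain ⟨h1, h2, h3, h4, h5, h6, -, h8, -, -, -, -⟩ := h
  rw [rowsFrom_one hPY] at h1 h5 h6 h8
  rw [rowsFrom_one hPR] at h3 h4 h6 h8
  obtain rfl : D = lam := h1.hasRows.unique hv.hasRows
  have hw : IsFinitary (perm R) := hPR.isFinitary
  have hpack := h4.isBruhatPackage hw D h2 h3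
  have hstrict := h1.hasRows.strict h6
  refine ⟨U, ⟨D, L⟩, fun U' T' => ⟨huniq U' T', ?_⟩, h2, ⟨rfl, ?_, le_rfl, hpack.2.2.1⟩, ?_, ?_,
    hpack, monomialOf_mul h8⟩
  · rintro ⟨rfl, rfl⟩
    exact hstep
  · rw [h1.hasRows.card]
    exact h5
  · rw [E_eq]
    exact hstrict.1
  · rw [E_eq]
    exact hstrict.2
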